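/- Throughout, $G=(V,E)$ is a finite simple graph and $\mathbb Z_2=\langle s\rangle$. A $\mathbb Z_2$-symmetric simple graph is a pair $(G,\theta)$ with $\theta:\mathbb Z_2\to\mathrm{Aut}(G)$ a non-trivial group homomorphism; write $s_\theta=\theta(s)$. A symmetric 2-tree decomposition $\mathcal G=(G;T_1,T_2;\theta)$ of $(G,\theta)$ consists of two edge-disjoint spanning trees $T_1,T_2$ of $G$ whose union is $G$ and with $s_\theta(T_1)=T_1$, $s_\theta(T_2)=T_2$; it has no fixed edges if $\{s_\theta(u),s_\theta(v)\}\neq\{u,v\}$ for every edge $uv$ of $G$. Let $p:V\to\mathbb R^2$ be injective. An edge $uv$ has framework colour $k\in\{1,2\}$ if $\|p(u)-p(v)\|_\infty=|p(u)_k-p(v)_k|$. The framework $(G,p)$ is well-positioned if every edge of $G$ has exactly one framework colour; equivalently, the rigidity map $f_G:(\mathbb R^2)^V\to\mathbb R^E$, $x\mapsto(\|x(u)-x(v)\|_\infty)_{uv\in E}$, is differentiable at $p$. A realisation of $(G;T_1,T_2)$ is a well-positioned framework $(G,p)$ such that, for $k=1,2$, the edges of colour $k$ are exactly the edges of $T_k$.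 A $\mathcal C_s$-realisation of $\mathcal G$ is a pair $(p,\tau)$ where $(G,p)$ is a realisation of $(G;T_1,T_2)$ and $\tau:\mathbb Z_2\to GL(\mathbb R^2)$ is a homomorphism such that $\tau(s)$ is the reflection in one of the two coordinate axes and $\tau(s)(p(v))=p(s_\theta(v))$ for all $v\in V$. The framework $(G,p)$ is locally rigid in $(\mathbb R^2,\|\cdot\|_\infty)$ if every continuous motion $(\alpha_t)_{t\in[0,1]}$ of the vertices with $\alpha_0=p$ that preserves all edge lengths has the form $\alpha_t(v)=\Gamma_t(p(v))$ for a family $(\Gamma_t)_{t\in[0,1]}$ of isometries of $(\mathbb R^2,\|\cdot\|_\infty)$ with $\Gamma_0=\mathrm{id}$ and $t\mapsto\Gamma_t(x)$ continuous for each $x$. A well-positioned $(G,p)$ is infinitesimally rigid if every element of $\ker df_G(p)$ is of the form $(a,\dots,a)$ with $a\in\mathbb R^2$. In either sense, $(G,p)$ is minimally rigid if it is rigid and $(G-e,p)$ is not rigid for every edge $e$ of $G$. **Corollary.** Let $(G,\theta)$ be a $\mathbb Z_2$-symmetric simple graph. If $(G,\theta)$ admits a symmetric 2-tree decomposition $\mathcal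 G=(G;T_1,T_2;\theta)$ with no fixed edges, then there exists a $\mathcal C_s$-realisation $(p,\tau)$ of $\mathcal G$ in the plane such that $(G,p)$ is well-positioned and minimally rigid in $(\mathbb R^2,\|\cdot\|_\infty)$, both in the sense of local rigidity and in the sense of infinitesimal rigidity, and $f_G$ is differentiable at $p$. -/

import Mathlib

namespace TreeRealisation

/-! ### Tree decompositions of simple graphs -/

/-- `(G; T 0, …, T (d-1))` is a `d`-tree decomposition: the simple graph `G` is the edge-disjoint
union of the spanning trees `T i`.  A spanning subgraph of a graph on `V` is given as a simple
graph on the same vertex type `V`. -/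
structure IsTreeDecomposition {V : Type*} {d : ℕ} (G : SimpleGraph V)
    (T : Fin d → SimpleGraph V) : Prop where
  isTree : ∀ i, (T i).IsTree
  disjoint : ∀ i j, i ≠ j → Disjoint (T i) (T j)
  union : (⨆ i, T i) = G

/-- The group `ℤ₂`, written multiplicatively. -/
abbrev Z2 : Type := Multiplicative (ZMod 2)

/-- The generator `s` of `ℤ₂`. -/
def s : Z2 := Multiplicative.ofAdd 1

/-- `(G; T 0, T 1; θ)` is a symmetric 2-tree decomposition of the simple graph `G`. -/
structure IsSymmetricTreeDecomposition {V : Type*} (G : SimpleGraph V)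
    (T : Fin 2 → SimpleGraph V) (θ : Z2 →* (G ≃g G)) : Prop where
  decomposition : IsTreeDecomposition G T
  nontrivial : θ ≠ 1
  symmetric : ∀ i, (T i).map (θ s).toEquiv.toEmbedding = T i

/-- No edge `uv` of `G` satisfies `{s u, s v} = {u, v}`. -/
def NoFixedEdges {V : Type*} (G : SimpleGraph V) (θ : Z2 →* (G ≃g G)) : Prop :=
  ∀ e ∈ G.edgeSet, Sym2.map (θ s) e ≠ e

/-! ### Frameworks in `(ℝᵈ, ‖·‖_∞)`

The norm of `Fin d → ℝ` in Mathlib is the maximum norm. -/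

/-- The pair `{x, y}` of points has framework colour `k`. -/
def HasColour {d : ℕ} (x y : Fin d → ℝ) (k : Fin d) : Prop :=
  ‖x - y‖ = |x k - y k|

/-- A placement `p` of `G` is well-positioned if each edge has exactly one framework colour. -/
def WellPositioned {V : Type*} {d : ℕ} (G : SimpleGraph V) (p : V → Fin d → ℝ) : Prop :=
  ∀ u v, G.Adj u v → ∃! k, HasColour (p u) (p v) k

/-- The monochrome subgraph of `G` formed by the edges of framework colour `k`. -/
def monochrome {V : Type*} {d : ℕ} (G : SimpleGraph V) (p : V → Fin d → ℝ) (k : Fin d) :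
    SimpleGraph V where
  Adj u v := G.Adj u v ∧ HasColour (p u) (p v) k
  symm := ⟨fun u v h => ⟨h.1.symm, by
    have h2 := h.2
    unfold HasColour at h2 ⊢
    rw [norm_sub_rev, h2, abs_sub_comm]⟩⟩
  loopless := ⟨fun u h => G.loopless.irrefl u h.1⟩

/-- `p` is a realisation of the `d`-tree decomposition `(G; T 0, …, T (d-1))`: it is injective and
well-positioned, and for each `i` the subgraph of colour `i` is `T i`. -/
structure IsRealisation {V : Type*} {d : ℕ} (G : SimpleGraph V) (T : Fin d → SimpleGraph V)
    (p : V → Fin d → ℝ) : Prop where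
  injective : Function.Injective p
  wellPositioned : WellPositioned G p
  monochrome_eq : ∀ i, monochrome G p i = T i

/-! ### Symmetric placements in the plane -/

/-- `g` is the linear reflection of the plane in a coordinate axis: it changes the sign of exactly
one coordinate. -/
def IsCoordinateReflection (g : LinearMap.GeneralLinearGroup ℝ (Fin 2 → ℝ)) : Prop :=
  ∃ j : Fin 2, ∀ x : Fin 2 → ℝ, (g : (Fin 2 → ℝ) →ₗ[ℝ] (Fin 2 → ℝ)) x = Function.update x j (-x j)

/-- `(p, τ)` is a `C_s`-placement of `(G, θ)`. -/
structure IsCsPlacement {V : Type*} (G : SimpleGraph V) (θ : Z2 →* (G ≃g G))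
    (p : V → Fin 2 → ℝ) (τ : Z2 →* LinearMap.GeneralLinearGroup ℝ (Fin 2 → ℝ)) : Prop where
  injective : Function.Injective p
  equivariant : ∀ v, (τ s : (Fin 2 → ℝ) →ₗ[ℝ] (Fin 2 → ℝ)) (p v) = p (θ s v)
  reflection : IsCoordinateReflection (τ s)

/-- `(p, τ)` is a `C_s`-realisation of `(G; T 0, T 1; θ)`. -/
structure IsCsRealisation {V : Type*} (G : SimpleGraph V) (T : Fin 2 → SimpleGraph V)
    (θ : Z2 →* (G ≃g G)) (p : V → Fin 2 → ℝ)
    (τ : Z2 →* LinearMap.GeneralLinearGroup ℝ (Fin 2 → ℝ)) : Prop where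
  placement : IsCsPlacement G θ p τ
  realisation : IsRealisation G T p

/-! ### Rigidity in `(ℝᵈ, ‖·‖_∞)` -/

/-- An edge-length preserving continuous motion of the vertices that starts at `p`. -/
structure IsFlex {V : Type*} {d : ℕ} (G : SimpleGraph V) (p : V → Fin d → ℝ)
    (α : unitInterval → V → Fin d → ℝ) : Prop where
  continuous : ∀ v, Continuous fun t => α t v
  start : α 0 = p
  length_eq : ∀ t u v, G.Adj u v → ‖α t u - α t v‖ = ‖p u - p v‖

/-- An isometric motion of the space `(ℝᵈ, ‖·‖_∞)`. -/
structure IsIsometricMotion {d : ℕ} (Γ : unitInterval → (Fin d → ℝ) → (Fin d → ℝ)) : Prop where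
  continuous : ∀ x, Continuous fun t => Γ t x
  start : Γ 0 = id
  isometry : ∀ t, Isometry (Γ t)

/-- Local rigidity: every edge-length preserving continuous motion of the vertices is obtained
from an isometric motion of the space. -/
def LocallyRigid {V : Type*} {d : ℕ} (G : SimpleGraph V) (p : V → Fin d → ℝ) : Prop :=
  ∀ α, IsFlex G p α → ∃ Γ, IsIsometricMotion Γ ∧ ∀ t v, α t v = Γ t (p v)

/-- The rigidity map `f_G : (ℝᵈ)^V → ℝ^E`, `x ↦ (‖x u - x v‖)_{uv ∈ E}`. -/
def rigidityMap {V : Type*} {d : ℕ} (G : SimpleGraph V) (x : V → Fin d → ℝ) : G.edgeSet → ℝ :=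
  fun e => Sym2.lift ⟨fun u v => ‖x u - x v‖, fun u v => norm_sub_rev (x u) (x v)⟩ e.1

/-- Infinitesimal rigidity: every element of the kernel of the differential of the rigidity map at
`p` is translational.  It is meant for well-positioned `p`, where the rigidity map is
differentiable. -/
def InfinitesimallyRigid {V : Type*} {d : ℕ} (G : SimpleGraph V) (p : V → Fin d → ℝ) : Prop :=
  ∀ η : V → Fin d → ℝ, fderiv ℝ (rigidityMap G) p η = 0 → ∃ a : Fin d → ℝ, η = fun _ => a

/-- Minimal (local) rigidity: `(G, p)` is rigid, and not rigid after the removal of any edge. -/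
def MinimallyRigid {V : Type*} {d : ℕ} (G : SimpleGraph V) (p : V → Fin d → ℝ) : Prop :=
  LocallyRigid G p ∧ ∀ e ∈ G.edgeSet, ¬ LocallyRigid (G.deleteEdges {e}) p

/-- Minimal infinitesimal rigidity. -/
def MinimallyInfinitesimallyRigid {V : Type*} {d : ℕ} (G : SimpleGraph V)
    (p : V → Fin d → ℝ) : Prop :=
  InfinitesimallyRigid G p ∧ ∀ e ∈ G.edgeSet, ¬ InfinitesimallyRigid (G.deleteEdges {e}) p

end TreeRealisation

/-! ### Symmetric forests and their edge counts. -/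

namespace MaxNormPlane
open Finset

/-! Rigidity splits by coordinates. Near a realisation `p` the length of an edge of `T k` is the
absolute difference of the `k`-th coordinates of its ends. Since each tree is connected, all `k`-th
coordinates move by a common amount; after an edge of `T k` is cut, one of the two parts can slide
in direction `k`. So any realisation is minimally rigid in both senses
(`minimallyRigid_of_isRealisation`), and the real task is to find a symmetric realisation.

Existence (`exists_realises`) is a strong induction on the number of vertices for two disjoint
`σ`-invariant forests `A` (horizontal) and `B` (vertical) without fixed edges. Forests, unlike
trees, are stable under deletion of vertices. Both reflection axes are treated at once, because
exchanging the coordinates exchanges `A` with `B` and one axis with the other. In a tree the path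
between two fixed vertices would consist of fixed edges, so `σ` has at most one fixed vertex. A
parity count then gives a non-fixed vertex `v` of total degree at most three
(`exists_degree_le_three`); `v` and `σ v` are removed and put back.

The hard case is one neighbour `a` in `A` and two neighbours `b`, `c` in `B`. A position for `v`
exists if `p a` avoids the closed diagonal box spanned by `p b` and `p c` (`exists_hz_vt_vt`). If
`bc` is not in `A`, the paths `b v c` and `σ b, σ v, σ c` are replaced by edges of `B` before
induction; then `b` and `c` are vertically separated and the box condition holds. If `bc` is in `A`,
one takes a largest set `Y` that contains `b` and `c` but not `a`, spans a tree in `A` and in the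
bridged `B`, and is disjoint from or equal to its mirror image. `Y` and `σ Y` are contracted, the
quotient is realised, and a tiny realisation of them is inserted (`exists_contraction`): `b` and `c`
nearly coincide, away from `a`. Contraction fails only if a vertex outside is joined to `Y` in both
forests. Then either a proper part of the graph spans trees in both forests and can be contracted
itself (`exists_realises_of_full`), or the graph is `Y`, `σ Y` and a few more vertices, which are
placed by hand. -/

/-- An involution with at most one fixed point. -/
structure IsPointReflection {V : Type*} (σ : V → V) : Prop where
  invol : ∀ x, σ (σ x) = x
  fixed_unique : ∀ x y, σ x = x → σ y = y → x = y

/-- The number of edges of `A` spanned by `X`. -/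
def spanned {V : Type*} [DecidableEq V] (A : Finset (Sym2 V)) (X : Finset V) : ℕ :=
  #(A ∩ X.sym2)

/-- `X` spans at least `#X - 1` edges of `A`. -/
def Full {V : Type*} [DecidableEq V] (A : Finset (Sym2 V)) (X : Finset V) : Prop :=
  #X ≤ spanned A X + 1

/-- `A` is the edge set of a `σ`-invariant forest on `S` without fixed edges. -/
structure SymForest {V : Type*} [DecidableEq V] (σ : V → V) (S : Finset V)
    (A : Finset (Sym2 V)) : Prop where
  vertex_inv : ∀ x ∈ S, σ x ∈ S
  subset : A ⊆ S.sym2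
  edge_inv : ∀ e ∈ A, e.map σ ∈ A
  not_fixed : ∀ e ∈ A, e.map σ ≠ e
  sparse : ∀ X ⊆ S, X.Nonempty → spanned A X + 1 ≤ #X

theorem IsPointReflection.injective {V : Type*} {σ : V → V} (hσ : IsPointReflection σ) :
    Function.Injective σ :=
  Function.Involutive.injective hσ.invol

variable {V : Type*} [DecidableEq V] {σ : V → V} {S X Y : Finset V} {A B C : Finset (Sym2 V)}

theorem IsPointReflection.mem_image (hσ : IsPointReflection σ) {x : V} :
    x ∈ X.image σ ↔ σ x ∈ X := by
  rw [Finset.mem_image]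
  constructor
  · rintro ⟨y, hy, rfl⟩
    rwa [hσ.invol]
  · exact fun h => ⟨σ x, h, hσ.invol x⟩

theorem IsPointReflection.card_image (hσ : IsPointReflection σ) : #(X.image σ) = #X :=
  Finset.card_image_of_injective _ hσ.injective

theorem spanned_mono_left (h : A ⊆ B) (X : Finset V) : spanned A X ≤ spanned B X :=
  card_le_card (inter_subset_inter_right h)

theorem Full.mono (h : A ⊆ B) (hX : Full A X) : Full B X :=
  hX.trans (Nat.add_le_add_right (spanned_mono_left h X) 1)

theorem full_singleton (A : Finset (Sym2 V)) (x : V) : Full A {x} := by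
  simp [Full]

theorem spanned_insert_one {x y : V} (hy : y ∉ X) (hx : x ∈ X) (hxy : s(y, x) ∈ A) :
    spanned A X + 1 ≤ spanned A (insert y X) := by
  have h1 : s(y, x) ∉ A ∩ X.sym2 := by simp [hy]
  rw [spanned, ← card_insert_of_notMem h1]
  refine card_le_card fun e he => ?_
  rcases mem_insert.1 he with rfl | he
  · simp [hxy, hx]
  · exact inter_subset_inter_left (sym2_mono (subset_insert y X)) he

theorem spanned_insert_two {x x' y : V} (hy : y ∉ X) (hx : x ∈ X) (hx' : x' ∈ X) (hne : x ≠ x')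
    (hxy : s(y, x) ∈ A) (hxy' : s(y, x') ∈ A) :
    spanned A X + 2 ≤ spanned A (insert y X) := by
  have h1 : s(y, x) ∉ A ∩ X.sym2 := by simp [hy]
  have h2 : s(y, x') ∉ insert s(y, x) (A ∩ X.sym2) := by
    rw [mem_insert, Sym2.congr_right]
    simp [hy, hne.symm]
  rw [spanned, show #(A ∩ X.sym2) + 2 = #(A ∩ X.sym2) + 1 + 1 from rfl,
    ← card_insert_of_notMem h1, ← card_insert_of_notMem h2]
  refine card_le_card fun e he => ?_
  rcases mem_insert.1 he with rfl | he
  · simp [hxy', hx']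
  rcases mem_insert.1 he with rfl | he
  · simp [hxy, hx]
  · exact inter_subset_inter_left (sym2_mono (subset_insert y X)) he

theorem Full.insert {x y : V} (hX : Full A X) (hy : y ∉ X) (hx : x ∈ X) (hxy : s(y, x) ∈ A) :
    Full A (insert y X) := by
  have := spanned_insert_one hy hx hxy
  unfold Full at *
  rw [card_insert_of_notMem hy]
  omega

/-- Subdividing an edge preserves fullness. -/
theorem Full.subdivide {b c v : V} (hX : Full (Insert.insert s(b, c) C) X) (hv : v ∉ X)
    (hb : b ∈ X) (hc : c ∈ X) (hbc : b ≠ c) (hCA : C ⊆ A) (hvb : s(v, b) ∈ A)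
    (hvc : s(v, c) ∈ A) : Full A (Insert.insert v X) := by
  have h1 := spanned_insert_two hv hb hc hbc hvb hvc
  have h2 : spanned (Insert.insert s(b, c) C) X ≤ spanned A X + 1 := by
    unfold spanned
    refine (card_le_card (t := Insert.insert s(b, c) (A ∩ X.sym2)) ?_).trans (card_insert_le _ _)
    intro e he
    rw [mem_inter, mem_insert] at he
    rw [mem_insert, mem_inter]
    rcases he with ⟨he | he, h⟩
    · exact Or.inl he
    · exact Or.inr ⟨hCA he, h⟩
  unfold Full at *
  rw [card_insert_of_notMem hv]
  omega

namespace SymForest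

theorem ne (hA : SymForest σ S A) {x y : V} (h : s(x, y) ∈ A) : x ≠ y := by
  rintro rfl
  have hx : x ∈ S := by simpa using hA.subset h
  have := hA.sparse {x} (by simpa using hx) ⟨x, by simp⟩
  rw [card_singleton] at this
  have h2 : 0 < spanned A {x} := card_pos.2 ⟨s(x, x), mem_inter.2 ⟨h, mk_mem_sym2_iff.2 (by simp)⟩⟩
  omega

theorem mem_left (hA : SymForest σ S A) {x y : V} (h : s(x, y) ∈ A) : x ∈ S :=
  (mk_mem_sym2_iff.1 (hA.subset h)).1

theorem mem_right (hA : SymForest σ S A) {x y : V} (h : s(x, y) ∈ A) : y ∈ S :=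
  (mk_mem_sym2_iff.1 (hA.subset h)).2

theorem map_mem (hA : SymForest σ S A) {x y : V} (h : s(x, y) ∈ A) : s(σ x, σ y) ∈ A :=
  hA.edge_inv _ h

theorem ne_map (hσ : IsPointReflection σ) (hA : SymForest σ S A) {x y : V} (h : s(x, y) ∈ A) :
    y ≠ σ x := by
  rintro rfl
  refine hA.not_fixed _ h ?_
  rw [Sym2.map_mk, hσ.invol, Sym2.eq_swap]

theorem restrict (hA : SymForest σ S A) (hX : X ⊆ S) (hinv : ∀ x ∈ X, σ x ∈ X) :
    SymForest σ X (A ∩ X.sym2) where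
  vertex_inv := hinv
  subset := inter_subset_right
  edge_inv e he := by
    rw [mem_inter] at he ⊢
    refine ⟨hA.edge_inv e he.1, ?_⟩
    induction e with
    | _ x y =>
      have := mk_mem_sym2_iff.1 he.2
      exact mk_mem_sym2_iff.2 ⟨hinv _ this.1, hinv _ this.2⟩
  not_fixed e he := hA.not_fixed e (mem_inter.1 he).1
  sparse Y hY hne := (Nat.add_le_add_right (spanned_mono_left inter_subset_left Y) 1).trans
    (hA.sparse Y (hY.trans hX) hne)

theorem full_image (hσ : IsPointReflection σ) (hA : SymForest σ S A) (hX : Full A X) :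
    Full A (X.image σ) := by
  have : spanned A X ≤ spanned A (X.image σ) := by
    refine card_le_card_of_injOn (Sym2.map σ) ?_ (Sym2.map.injective hσ.injective).injOn
    intro e he
    induction e with
    | _ x y =>
      have he := mem_coe.1 he
      rw [mem_inter, mk_mem_sym2_iff] at he
      refine mem_coe.2 (mem_inter.2 ⟨hA.edge_inv _ he.1, ?_⟩)
      exact mk_mem_sym2_iff.2 ⟨mem_image_of_mem _ he.2.1, mem_image_of_mem _ he.2.2⟩
  unfold Full at *
  rw [hσ.card_image]
  omega

/-- The number of spanned edges is supermodular, and sparsity bounds it on the intersection. For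
subsets of `S`, `Full` means that the induced subgraph is a tree; two such trees with a common
vertex have a tree as union. -/
theorem full_union (hA : SymForest σ S A) (hXS : X ⊆ S) (hX : Full A X) (hY : Full A Y)
    (hne : (X ∩ Y).Nonempty) : Full A (X ∪ Y) := by
  have h1 := hA.sparse (X ∩ Y) (inter_subset_left.trans hXS) hne
  have h2 : spanned A X + spanned A Y ≤ spanned A (X ∪ Y) + spanned A (X ∩ Y) := by
    unfold spanned
    rw [← card_union_add_card_inter]
    refine Nat.add_le_add (card_le_card ?_) (card_le_card ?_)
    · exact union_subset (inter_subset_inter_left (sym2_mono subset_union_left))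
        (inter_subset_inter_left (sym2_mono subset_union_right))
    · intro e he
      induction e with
      | _ x y =>
        simp only [mem_inter, mk_mem_sym2_iff] at he ⊢
        tauto
  have h3 := card_union_add_card_inter X Y
  unfold Full at *
  omega

/-- The map induced by `σ` pairs off the spanned edges, since none of them is fixed. -/
theorem even_spanned (hσ : IsPointReflection σ) (hA : SymForest σ S A)
    (hinv : ∀ x ∈ X, σ x ∈ X) : Even (spanned A X) := by
  rw [← ZMod.natCast_eq_zero_iff_even, spanned, Finset.cast_card]
  refine Finset.sum_involution (fun e _ => e.map σ) (fun e _ => by decide) (fun e he _ => ?_)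
    (fun e he => ?_) (fun e he => ?_)
  · exact hA.not_fixed e (mem_inter.1 he).1
  · rw [mem_inter] at he ⊢
    refine ⟨hA.edge_inv e he.1, ?_⟩
    induction e with
    | _ x y =>
      have := mk_mem_sym2_iff.1 he.2
      exact mk_mem_sym2_iff.2 ⟨hinv _ this.1, hinv _ this.2⟩
  · rw [Sym2.map_map]
    rw [show σ ∘ σ = id from funext hσ.invol, Sym2.map_id, id]

/-- Vertices and edges both come in pairs, so the bound `#X - 1` has the wrong parity and drops by
one more. -/
theorem spanned_add_two_le (hσ : IsPointReflection σ) (hA : SymForest σ S A) (hXS : X ⊆ S)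
    (hinv : ∀ x ∈ X, σ x ∈ X) (hfix : ∀ x ∈ X, σ x ≠ x) (hne : X.Nonempty) :
    spanned A X + 2 ≤ #X := by
  have h1 := hA.sparse X hXS hne
  have h2 := hA.even_spanned hσ hinv
  have h3 : Even #X := by
    rw [← ZMod.natCast_eq_zero_iff_even, Finset.cast_card]
    exact Finset.sum_involution (fun x _ => σ x) (fun e _ => by decide) (fun x hx _ => hfix x hx)
      (fun x hx => hinv x hx) (fun x _ => hσ.invol x)
  grind

/-- Two edges from `y` into a set that spans a tree would close a cycle. -/
theorem nbr_unique (hA : SymForest σ S A) (hXS : X ⊆ S) (hX : Full A X) {x x' y : V}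
    (hy : y ∉ X) (hx : x ∈ X) (hx' : x' ∈ X) (h : s(y, x) ∈ A) (h' : s(y, x') ∈ A) : x = x' := by
  by_contra hne
  have h1 := spanned_insert_two hy hx hx' hne h h'
  have h2 := hA.sparse (insert y X) (insert_subset (hA.mem_left h) hXS) (insert_nonempty _ _)
  rw [card_insert_of_notMem hy] at h2
  unfold Full at hX
  omega

/-- A full set that is disjoint from its mirror image is not joined to it. -/
theorem not_cross (hσ : IsPointReflection σ) (hA : SymForest σ S A) (hXS : X ⊆ S)
    (hX : Full A X) (hd : Disjoint X (X.image σ)) {x y : V} (hx : x ∈ X) (hy : σ y ∈ X) :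
    s(x, y) ∉ A := by
  intro hxy
  have hy' := hσ.mem_image.2 hy
  have hX' := hA.full_image hσ hX
  -- The union with the mirror image has no fixed vertex, so it spans at most `2 * #X - 2` edges.
  -- The two full halves already use all of these, which leaves none between them.
  have h1 := hA.spanned_add_two_le hσ (X := X ∪ X.image σ)
    (union_subset hXS fun z hz => by
      have := hA.vertex_inv _ (hXS (hσ.mem_image.1 hz))
      rwa [hσ.invol] at this)
    (fun z hz => by
      rw [mem_union, hσ.mem_image] at hz ⊢
      rw [hσ.invol]
      exact hz.symm)
    (fun z hz h => by
      rw [mem_union, hσ.mem_image, h, or_self] at hz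
      exact disjoint_left.1 hd hz (hσ.mem_image.2 (by rwa [h])))
    ⟨x, mem_union_left _ hx⟩
  rw [card_union_of_disjoint hd, hσ.card_image] at h1
  have h2 : spanned A X + spanned A (X.image σ) + 1 ≤ spanned A (X ∪ X.image σ) := by
    unfold spanned
    rw [← card_union_of_disjoint, ← card_insert_of_notMem (a := s(x, y))]
    · refine card_le_card (insert_subset ?_ (union_subset ?_ ?_))
      · exact mem_inter.2 ⟨hxy, mk_mem_sym2_iff.2 ⟨mem_union_left _ hx, mem_union_right _ hy'⟩⟩
      · exact (inter_subset_inter_left (sym2_mono subset_union_left))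
      · exact (inter_subset_inter_left (sym2_mono subset_union_right))
    · intro h
      rw [mem_union, mem_inter, mem_inter, mk_mem_sym2_iff, mk_mem_sym2_iff] at h
      rcases h with h | h
      · exact disjoint_left.1 hd h.2.2 hy'
      · exact disjoint_left.1 hd hx h.2.1
    · rw [disjoint_left]
      intro e h h'
      induction e with
      | _ a b =>
        rw [mem_inter, mk_mem_sym2_iff] at h h'
        exact disjoint_left.1 hd h.2.1 h'.2.1
  unfold Full at hX hX'
  rw [hσ.card_image] at hX'
  omega

/-- The sum counts every edge at most once, and a second time only if both ends are non-fixed. With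
at most one fixed vertex, `#A` is at most the number of non-fixed vertices, and the doubly counted
edges number two fewer by parity. -/
theorem sum_degree_le (hA : SymForest σ S A) (hσ : IsPointReflection σ)
    (hW : (S.filter fun x => σ x ≠ x).Nonempty) :
    ∑ v ∈ S.filter (fun x => σ x ≠ x), #(A.filter (v ∈ ·)) + 2 ≤
      2 * #(S.filter fun x => σ x ≠ x) := by
  set W := S.filter fun x => σ x ≠ x with hWdef
  have hWS : W ⊆ S := filter_subset _ _
  have h1 := hA.spanned_add_two_le hσ hWS
    (fun x hx => by
      rw [hWdef, mem_filter] at hx ⊢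
      exact ⟨hA.vertex_inv x hx.1, fun h => hx.2 (hσ.injective h)⟩)
    (fun x hx => (mem_filter.1 hx).2) hW
  have h2 : #A + 1 ≤ #S := by
    have := hA.sparse S subset_rfl (hW.mono hWS)
    rwa [spanned, inter_eq_left.2 hA.subset] at this
  have h3 : #S ≤ #W + 1 := by
    have : #(S.filter fun x => ¬ σ x ≠ x) ≤ 1 := by
      rw [card_le_one]
      intro a ha b hb
      rw [mem_filter, not_not] at ha hb
      exact hσ.fixed_unique a b ha.2 hb.2
    have := card_filter_add_card_filter_not (s := S) fun x => σ x ≠ x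
    rw [← hWdef] at this
    omega
  have h4 : ∑ v ∈ W, #(A.filter (v ∈ ·)) ≤ #A + spanned A W := by
    simp_rw [card_filter]
    rw [sum_comm, spanned, ← filter_mem_eq_inter, card_filter, card_eq_sum_ones,
      ← sum_add_distrib]
    refine sum_le_sum fun e he => ?_
    rw [← card_filter]
    induction e with
    | _ x y =>
      have hmem := mk_mem_sym2_iff.1 (hA.subset he)
      by_cases hxy : x ∈ W ∧ y ∈ W
      · rw [if_pos (by simpa using hxy)]
        refine (card_le_card (t := {x, y}) ?_).trans card_le_two
        intro z hz
        simpa using (mem_filter.1 hz).2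
      · rw [if_neg (by simpa using hxy), card_le_one]
        intro a ha b hb
        rw [mem_filter, Sym2.mem_iff] at ha hb
        rcases ha with ⟨ha, rfl | rfl⟩ <;> rcases hb with ⟨hb, rfl | rfl⟩ <;> tauto
  omega

end SymForest

/-- Averaging: the two degree sums together stay below four times the number of non-fixed vertices.
-/
theorem exists_degree_le_three (hσ : IsPointReflection σ) (hA : SymForest σ S A)
    (hB : SymForest σ S B) (hW : (S.filter fun x => σ x ≠ x).Nonempty) :
    ∃ v ∈ S, σ v ≠ v ∧ #(A.filter (v ∈ ·)) + #(B.filter (v ∈ ·)) ≤ 3 := by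
  by_contra! h
  have h1 := hA.sum_degree_le hσ hW
  have h2 := hB.sum_degree_le hσ hW
  have h3 : #(S.filter fun x => σ x ≠ x) • 4 ≤
      ∑ v ∈ S.filter (fun x => σ x ≠ x), (#(A.filter (v ∈ ·)) + #(B.filter (v ∈ ·))) :=
    card_nsmul_le_sum _ _ _ fun v hv => by
      rw [mem_filter] at hv
      exact h v hv.1 hv.2
  rw [sum_add_distrib, smul_eq_mul] at h3
  omega

end MaxNormPlane

/-! ### Contraction of symmetric forests. -/

namespace MaxNormPlane
open Finset
variable {V : Type*} [DecidableEq V] {σ : V → V} {S X Y : Finset V} {A B C : Finset (Sym2 V)}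

/-- The image of the edge set `A` under the vertex map `π`, without loops. -/
def contract (π : V → V) (A : Finset (Sym2 V)) : Finset (Sym2 V) :=
  (A.image (Sym2.map π)).filter fun e => ¬ e.IsDiag

theorem mk_mem_contract {π : V → V} {x y : V} (h : s(x, y) ∈ A) (hne : π x ≠ π y) :
    s(π x, π y) ∈ contract π A :=
  mem_filter.2 ⟨mem_image_of_mem (Sym2.map π) h, by simpa using hne⟩

theorem exists_of_mem_contract {π : V → V} {e : Sym2 V} (h : e ∈ contract π A) :
    ∃ x y, s(x, y) ∈ A ∧ π x ≠ π y ∧ e = s(π x, π y) := by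
  rw [contract, mem_filter, mem_image] at h
  obtain ⟨⟨f, hf, rfl⟩, h⟩ := h
  induction f with
  | _ x y => exact ⟨x, y, hf, by simpa using h, rfl⟩

/-- Contracting full fibres of a forest gives a forest. -/
theorem SymForest.contract (hσ : IsPointReflection σ) (hA : SymForest σ S A) {π : V → V}
    (hπ : ∀ x, π (σ x) = σ (π x)) (hfull : ∀ x ∈ S, Full A (S.filter (π · = π x)))
    (hcross : ∀ x y, s(x, y) ∈ A → π x ≠ π y → π y ≠ σ (π x)) :
    SymForest σ (S.image π) (contract π A) where
  vertex_inv x hx := by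
    rw [mem_image] at hx ⊢
    obtain ⟨y, hy, rfl⟩ := hx
    exact ⟨σ y, hA.vertex_inv y hy, hπ y⟩
  subset e he := by
    obtain ⟨x, y, hxy, -, rfl⟩ := exists_of_mem_contract he
    exact mk_mem_sym2_iff.2 ⟨mem_image_of_mem _ (hA.mem_left hxy),
      mem_image_of_mem _ (hA.mem_right hxy)⟩
  edge_inv e he := by
    obtain ⟨x, y, hxy, hne, rfl⟩ := exists_of_mem_contract he
    rw [Sym2.map_mk, ← hπ, ← hπ]
    refine mk_mem_contract (hA.map_mem hxy) ?_
    rw [hπ, hπ]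
    exact fun h => hne (hσ.injective h)
  not_fixed e he h := by
    obtain ⟨x, y, hxy, hne, rfl⟩ := exists_of_mem_contract he
    rw [Sym2.map_mk, Sym2.eq_iff] at h
    rcases h with h | h
    · exact hne (hσ.fixed_unique _ _ h.1 h.2)
    · exact hcross x y hxy hne h.1.symm
  sparse Q hQ hne := by
    set R := S.filter (π · ∈ Q) with hR
    have hRne : R.Nonempty := by
      obtain ⟨q, hq⟩ := hne
      obtain ⟨x, hx, rfl⟩ := mem_image.1 (hQ hq)
      exact ⟨x, mem_filter.2 ⟨hx, hq⟩⟩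
    -- The preimage `R` of `Q` spans at most `#R - 1` edges, of which the full fibres use at least
    -- `#R - #Q`. At most `#Q - 1` remain for the contraction.
    have h1 := hA.sparse R (filter_subset _ _) hRne
    rw [spanned] at h1
    have h2 := card_filter_add_card_filter_not (s := A ∩ R.sym2) fun e => (e.map π).IsDiag
    have h3 : spanned (MaxNormPlane.contract π A) Q ≤
        #((A ∩ R.sym2).filter fun e => ¬ (e.map π).IsDiag) := by
      refine (card_le_card fun e he => ?_).trans (card_image_le (f := Sym2.map π))
      rw [mem_inter] at he
      obtain ⟨x, y, hxy, hne, rfl⟩ := exists_of_mem_contract he.1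
      have hQ := mk_mem_sym2_iff.1 he.2
      refine mem_image.2 ⟨s(x, y), mem_filter.2 ⟨mem_inter.2 ⟨hxy, mk_mem_sym2_iff.2
        ⟨mem_filter.2 ⟨hA.mem_left hxy, hQ.1⟩, mem_filter.2 ⟨hA.mem_right hxy, hQ.2⟩⟩⟩, ?_⟩, rfl⟩
      simpa using hne
    have h4 : ∑ q ∈ Q, spanned A (S.filter (π · = q)) ≤
        #((A ∩ R.sym2).filter fun e => (e.map π).IsDiag) := by
      unfold spanned
      rw [← card_biUnion]
      · refine card_le_card fun e he => ?_
        obtain ⟨q, hq, he⟩ := mem_biUnion.1 he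
        induction e with
        | _ x y =>
          simp only [mem_inter, mk_mem_sym2_iff, mem_filter] at he
          simp [hR, he, hq]
      · intro q _ q' _ hqq
        rw [Function.onFun, disjoint_left]
        intro e he he'
        induction e with
        | _ x y =>
          simp only [mem_inter, mk_mem_sym2_iff, mem_filter] at he he'
          exact hqq (he.2.1.2.symm.trans he'.2.1.2)
    have h5 : #R = ∑ q ∈ Q, #(S.filter (π · = q)) := by
      rw [card_eq_sum_card_fiberwise (f := π) (s := R) (t := Q)
        fun x hx => (mem_filter.1 (mem_coe.1 hx)).2]
      refine sum_congr rfl fun q hq => congrArg card ?_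
      ext x
      simp only [hR, mem_filter]
      exact ⟨fun h => ⟨h.1.1, h.2⟩, fun h => ⟨⟨h.1, h.2 ▸ hq⟩, h.2⟩⟩
    have h6 : ∑ q ∈ Q, #(S.filter (π · = q)) ≤ ∑ q ∈ Q, (spanned A (S.filter (π · = q)) + 1) := by
      refine sum_le_sum fun q hq => ?_
      obtain ⟨x, hx, rfl⟩ := mem_image.1 (hQ hq)
      exact hfull x hx
    rw [sum_add_distrib, sum_const, smul_eq_mul, mul_one] at h6
    omega

/-- `X` is either disjoint from its mirror image or equal to it. -/
def IsBlock (σ : V → V) (X : Finset V) : Prop :=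
  Disjoint X (X.image σ) ∨ ∀ x ∈ X, σ x ∈ X

/-- Without a fixed vertex, parity would leave too few edges for a tree. -/
theorem SymForest.exists_fixed (hσ : IsPointReflection σ) (hA : SymForest σ S A) (hXS : X ⊆ S)
    (hX : Full A X) (hne : X.Nonempty) (hinv : ∀ x ∈ X, σ x ∈ X) : ∃ r ∈ X, σ r = r := by
  by_contra! h
  have := hA.spanned_add_two_le hσ hXS hinv h hne
  unfold Full at hX
  omega

/-- The equivariant vertex map that collapses a block `X` and its mirror image to points. -/
theorem exists_collapse (hσ : IsPointReflection σ) (hA : SymForest σ S A) (hXS : X ⊆ S)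
    (hX : Full A X) (hne : X.Nonempty) (hb : IsBlock σ X) :
    ∃ π : V → V, (∀ x, π (σ x) = σ (π x)) ∧ (∀ x ∈ X, ∀ y ∈ X, π x = π y) ∧
      (∀ x y, π x = π y → x = y ∨ (x ∈ X ∧ y ∈ X) ∨ (σ x ∈ X ∧ σ y ∈ X)) ∧
      (∀ x, x ∉ X → σ x ∉ X → π x = x) ∧ ∀ x ∈ X, π x ∈ X := by
  -- `X` collapses to `q` and its mirror image to `σ q`. If `X` is its own mirror image these must
  -- agree, so `q` has to be fixed.
  obtain ⟨q, hq, hqs⟩ : ∃ q ∈ X, (∀ x ∈ X, σ x ∈ X) → σ q = q := by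
    by_cases h : ∀ x ∈ X, σ x ∈ X
    · obtain ⟨r, hr, hr'⟩ := hA.exists_fixed hσ hXS hX hne h
      exact ⟨r, hr, fun _ => hr'⟩
    · obtain ⟨r, hr⟩ := hne
      exact ⟨r, hr, fun h' => absurd h' h⟩
  have hdis : ∀ x ∈ X, σ x ∈ X → ∀ x ∈ X, σ x ∈ X := by
    intro x hx hsx
    rcases hb with hb | hb
    · exact absurd (hσ.mem_image.2 hsx) (disjoint_left.1 hb hx)
    · exact hb
  have hinv := hσ.invol
  refine ⟨fun x => if x ∈ X then q else if σ x ∈ X then σ q else x, ?_, ?_, ?_, ?_, ?_⟩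
  · intro x
    simp only [hinv]
    by_cases h1 : x ∈ X <;> by_cases h2 : σ x ∈ X <;> simp only [h1, h2, if_true, if_false, hinv]
    exact (hqs (hdis x h1 h2)).symm
  · intro x hx y hy
    simp [hx, hy]
  · intro x y
    by_cases h1 : x ∈ X <;> by_cases h2 : y ∈ X <;> by_cases h3 : σ x ∈ X <;>
      by_cases h4 : σ y ∈ X <;> simp only [h1, h2, h3, h4, if_true, if_false] <;> intro h <;>
      grind
  · intro x h1 h2
    simp [h1, h2]
  · intro x h1
    simp [h1, hq]

end MaxNormPlane

/-! ### Horizontal and vertical position of points in the plane. -/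

namespace MaxNormPlane
open Finset

/-- The horizontal distance of two points exceeds the vertical one. -/
def Hz (a b : ℝ × ℝ) : Prop := |a.2 - b.2| < |a.1 - b.1|

/-- The vertical distance of two points exceeds the horizontal one. -/
def Vt (a b : ℝ × ℝ) : Prop := |a.1 - b.1| < |a.2 - b.2|

/-- The reflection in a coordinate axis, for `e = ±1`. -/
def mir (e : ℝ) (a : ℝ × ℝ) : ℝ × ℝ := (e * a.1, -e * a.2)

/-- `a` lies in the closed box with opposite corners `b` and `c` whose sides are parallel to the
diagonals of the coordinate system, and `b` and `c` are its left and right corners. -/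
def Between (b a c : ℝ × ℝ) : Prop :=
  (|a.2 - b.2| ≤ a.1 - b.1 ∧ |c.2 - a.2| ≤ c.1 - a.1) ∨
    (|a.2 - b.2| ≤ b.1 - a.1 ∧ |c.2 - a.2| ≤ a.1 - c.1)

variable {a b c z : ℝ × ℝ} {e : ℝ}

theorem Hz.symm (h : Hz a b) : Hz b a := by
  unfold Hz at *; rwa [abs_sub_comm, abs_sub_comm b.1]

theorem Vt.symm (h : Vt a b) : Vt b a := by
  unfold Vt at *; rwa [abs_sub_comm, abs_sub_comm b.2]

theorem hz_swap : Hz a.swap b.swap ↔ Vt a b := Iff.rfl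

theorem mir_mir (he : e = 1 ∨ e = -1) (a : ℝ × ℝ) : mir e (mir e a) = a := by
  rcases he with rfl | rfl <;> simp [mir]

theorem mir_swap (e : ℝ) (a : ℝ × ℝ) : (mir e a).swap = mir (-e) a.swap := by
  simp [mir]

theorem mir_add (e : ℝ) (a b : ℝ × ℝ) : mir e (a + b) = mir e a + mir e b := by
  ext <;> simp [mir] <;> ring

theorem mir_smul (e d : ℝ) (a : ℝ × ℝ) : mir e (d • a) = d • mir e a := by
  ext <;> simp [mir] <;> ring

theorem mir_zero (e : ℝ) : mir e 0 = 0 := by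
  ext <;> simp [mir]

theorem Hz.map_mir (he : e = 1 ∨ e = -1) (h : Hz a b) : Hz (mir e a) (mir e b) := by
  unfold Hz mir at *
  rcases he with rfl | rfl
  · simpa [← sub_eq_add_neg, neg_add_eq_sub, abs_sub_comm] using h
  · simpa [← sub_eq_add_neg, neg_add_eq_sub, abs_sub_comm] using h

theorem Vt.map_mir (he : e = 1 ∨ e = -1) (h : Vt a b) : Vt (mir e a) (mir e b) := by
  have := Hz.map_mir (e := -e) (a := a.swap) (b := b.swap) (by grind) (hz_swap.2 h)
  rw [← mir_swap, ← mir_swap] at this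
  exact hz_swap.1 this

theorem Hz.sub_right (h : Hz a b) (z : ℝ × ℝ) : Hz (a - z) (b - z) := by
  simpa [Hz] using h

theorem Vt.sub_right (h : Vt a b) (z : ℝ × ℝ) : Vt (a - z) (b - z) := by
  simpa [Vt] using h

theorem Hz.smul (h : Hz a b) {d : ℝ} (hd : 0 < d) (q : ℝ × ℝ) : Hz (q + d • a) (q + d • b) := by
  unfold Hz at *
  simp only [Prod.fst_add, Prod.snd_add, Prod.smul_fst, Prod.smul_snd, smul_eq_mul,
    add_sub_add_left_eq_sub, ← mul_sub, abs_mul]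
  exact mul_lt_mul_of_pos_left h (abs_pos.2 hd.ne')

theorem Vt.smul (h : Vt a b) {d : ℝ} (hd : 0 < d) (q : ℝ × ℝ) : Vt (q + d • a) (q + d • b) :=
  hz_swap.1 (Hz.smul (hz_swap.2 h) hd q.swap)

theorem isOpen_hz : IsOpen {x : (ℝ × ℝ) × (ℝ × ℝ) | Hz x.1 x.2} :=
  isOpen_lt (by fun_prop) (by fun_prop)

theorem isOpen_vt : IsOpen {x : (ℝ × ℝ) × (ℝ × ℝ) | Vt x.1 x.2} :=
  isOpen_lt (by fun_prop) (by fun_prop)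

theorem isOpen_setOf_hz (a : ℝ × ℝ) : IsOpen {z | Hz z a} :=
  isOpen_hz.preimage (Continuous.prodMk_left a)

theorem isOpen_setOf_vt (a : ℝ × ℝ) : IsOpen {z | Vt z a} :=
  isOpen_vt.preimage (Continuous.prodMk_left a)

/-- A point of an open set can be chosen with coordinates outside a given finite set. -/
theorem exists_generic {U : Set (ℝ × ℝ)} (hU : IsOpen U) (hne : U.Nonempty) (F : Finset ℝ) :
    ∃ z ∈ U, z.1 ∉ F ∧ z.2 ∉ F := by
  have hd : Dense ((F : Set ℝ)ᶜ ×ˢ (F : Set ℝ)ᶜ) :=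
    (F.countable_toSet.dense_compl ℝ).prod (F.countable_toSet.dense_compl ℝ)
  obtain ⟨z, hz, h⟩ := hd.inter_open_nonempty U hU hne
  exact ⟨z, hz, h.1, h.2⟩

/-- In the rotated coordinates `u = x + y`, `w = x - y`, the relation `Hz` says that both
differences have the same strict sign, and `Vt` that they have opposite signs. Cones become
quadrants. -/
theorem hz_of_rotated {u w : ℝ} (h : (a.1 + a.2 < u ∧ a.1 - a.2 < w) ∨
    (u < a.1 + a.2 ∧ w < a.1 - a.2)) : Hz ((u + w) / 2, (u - w) / 2) a := by
  unfold Hz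
  rw [lt_abs]
  rcases h with h | h
  · left
    rw [abs_lt]
    constructor <;> linarith [h.1, h.2]
  · right
    rw [abs_lt]
    constructor <;> linarith [h.1, h.2]

theorem vt_of_rotated {u w : ℝ} (h : (u < a.1 + a.2 ∧ a.1 - a.2 < w) ∨
    (a.1 + a.2 < u ∧ w < a.1 - a.2)) : Vt ((u + w) / 2, (u - w) / 2) a := by
  unfold Vt
  rw [lt_abs]
  rcases h with h | h
  · right
    rw [abs_lt]
    constructor <;> linarith [h.1, h.2]
  · left
    rw [abs_lt]
    constructor <;> linarith [h.1, h.2]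

/-- The excluded boxes are where no open quadrant of `a` meets suitable quadrants of `b` and `c`.
Otherwise one coordinate is fitted strictly between two given values and the other is pushed far
out; if `a` lies between in both directions, both coordinates are fitted. -/
theorem exists_rotated_quadrants {au aw bu bw cu cw : ℝ} (hbc : bu ≤ cu)
    (hab : ¬ (au = bu ∧ aw = bw)) (hac : ¬ (au = cu ∧ aw = cw))
    (h1 : ¬ (bu ≤ au ∧ au ≤ cu ∧ bw ≤ aw ∧ aw ≤ cw))
    (h2 : ¬ (cu ≤ au ∧ au ≤ bu ∧ cw ≤ aw ∧ aw ≤ bw)) :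
    ∃ u w : ℝ, ((au < u ∧ aw < w) ∨ (u < au ∧ w < aw)) ∧
      ((u < bu ∧ bw < w) ∨ (bu < u ∧ w < bw)) ∧ ((u < cu ∧ cw < w) ∨ (cu < u ∧ w < cw)) := by
  have above : ∀ x y z : ℝ, ∃ m, x < m ∧ y < m ∧ z < m := fun x y z =>
    ⟨|x| + |y| + |z| + 1, by linarith [le_abs_self x, abs_nonneg y, abs_nonneg z],
      by linarith [le_abs_self y, abs_nonneg x, abs_nonneg z],
      by linarith [le_abs_self z, abs_nonneg y, abs_nonneg x]⟩
  have below : ∀ x y z : ℝ, ∃ m, m < x ∧ m < y ∧ m < z := fun x y z =>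
    ⟨-(|x| + |y| + |z| + 1), by linarith [neg_abs_le x, abs_nonneg y, abs_nonneg z],
      by linarith [neg_abs_le y, abs_nonneg x, abs_nonneg z],
      by linarith [neg_abs_le z, abs_nonneg y, abs_nonneg x]⟩
  by_cases c1 : au < bu
  · obtain ⟨u, hu1, hu2⟩ := exists_between c1
    obtain ⟨w, hw1, hw2, hw3⟩ := above aw bw cw
    exact ⟨u, w, Or.inl ⟨hu1, hw1⟩, Or.inl ⟨hu2, hw2⟩, Or.inl ⟨hu2.trans_le hbc, hw3⟩⟩
  by_cases c2 : cu < au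
  · obtain ⟨u, hu1, hu2⟩ := exists_between c2
    obtain ⟨w, hw1, hw2, hw3⟩ := below aw bw cw
    exact ⟨u, w, Or.inr ⟨hu2, hw1⟩, Or.inr ⟨hbc.trans_lt hu1, hw2⟩, Or.inr ⟨hu1, hw3⟩⟩
  rw [not_lt] at c1 c2
  by_cases c3 : bw < aw ∧ cw < aw
  · obtain ⟨w, hw1, hw2⟩ := exists_between (max_lt c3.1 c3.2)
    obtain ⟨u, hu1, hu2, hu3⟩ := below au bu cu
    rw [max_lt_iff] at hw1
    exact ⟨u, w, Or.inr ⟨hu1, hw2⟩, Or.inl ⟨hu2, hw1.1⟩, Or.inl ⟨hu3, hw1.2⟩⟩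
  by_cases c4 : aw < bw ∧ aw < cw
  · obtain ⟨w, hw1, hw2⟩ := exists_between (lt_min c4.1 c4.2)
    obtain ⟨u, hu1, hu2, hu3⟩ := above au bu cu
    rw [lt_min_iff] at hw2
    exact ⟨u, w, Or.inl ⟨hu1, hw1⟩, Or.inr ⟨hu2, hw2.1⟩, Or.inr ⟨hu3, hw2.2⟩⟩
  have c5 : cw ≤ aw ∧ aw ≤ bw := by
    by_contra! c5
    rcases le_or_gt cw aw with h | h
    · exact c3 ⟨c5 h, (h.lt_or_eq).resolve_right fun h' =>
        h1 ⟨c1, c2, (c5 h).le, h'.ge⟩⟩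
    · exact c4 ⟨lt_of_not_ge fun h' => h1 ⟨c1, c2, h', h.le⟩, h⟩
  by_cases c6 : au < cu ∧ aw < bw
  · obtain ⟨u, hu1, hu2⟩ := exists_between c6.1
    obtain ⟨w, hw1, hw2⟩ := exists_between c6.2
    exact ⟨u, w, Or.inl ⟨hu1, hw1⟩, Or.inr ⟨c1.trans_lt hu1, hw2⟩,
      Or.inl ⟨hu2, c5.1.trans_lt hw1⟩⟩
  by_cases c7 : bu < au ∧ cw < aw
  · obtain ⟨u, hu1, hu2⟩ := exists_between c7.1
    obtain ⟨w, hw1, hw2⟩ := exists_between c7.2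
    exact ⟨u, w, Or.inr ⟨hu2, hw2⟩, Or.inr ⟨hu1, hw2.trans_le c5.2⟩,
      Or.inl ⟨hu2.trans_le c2, hw1⟩⟩
  exfalso
  rcases c1.lt_or_eq with hb | hb
  · have hw : cw = aw := c5.1.lt_or_eq.resolve_left fun h => c7 ⟨hb, h⟩
    rcases c2.lt_or_eq with hc | hc
    · have hw' : aw = bw := c5.2.lt_or_eq.resolve_left fun h => c6 ⟨hc, h⟩
      exact h1 ⟨c1, c2, hw'.ge, hw.ge⟩
    · exact hac ⟨hc, hw.symm⟩
  · rcases c2.lt_or_eq with hc | hc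
    · exact hab ⟨hb.symm, c5.2.lt_or_eq.resolve_left fun h => c6 ⟨hc, h⟩⟩
    · exact h2 ⟨hc.ge, hb.ge, c5⟩

theorem Between.symm (h : Between b a c) : Between c a b := by
  unfold Between at *
  rw [abs_sub_comm a.2 c.2, abs_sub_comm b.2 a.2]
  tauto

theorem exists_hz_vt_vt (hab : a ≠ b) (hac : a ≠ c) (h : ¬ Between b a c) (F : Finset ℝ) :
    ∃ z, Hz z a ∧ Vt z b ∧ Vt z c ∧ z.1 ∉ F ∧ z.2 ∉ F := by
  wlog hbc : b.1 + b.2 ≤ c.1 + c.2 generalizing b c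
  · obtain ⟨z, h1, h2, h3, h4⟩ := this hac hab (fun h' => h h'.symm) (not_le.1 hbc).le
    exact ⟨z, h1, h3, h2, h4⟩
  have hne : ∀ x y : ℝ × ℝ, x ≠ y → ¬ (x.1 + x.2 = y.1 + y.2 ∧ x.1 - x.2 = y.1 - y.2) := by
    intro x y hxy h
    exact hxy (Prod.ext (by linarith) (by linarith))
  obtain ⟨u, w, h1, h2, h3⟩ := exists_rotated_quadrants hbc (hne _ _ hab) (hne _ _ hac)
    (fun h' => h (Or.inl ⟨abs_le.2 (by constructor <;> linarith),
      abs_le.2 (by constructor <;> linarith)⟩))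
    (fun h' => h (Or.inr ⟨abs_le.2 (by constructor <;> linarith),
      abs_le.2 (by constructor <;> linarith)⟩))
  obtain ⟨z, hz, hzF⟩ := exists_generic (((isOpen_setOf_hz a).inter (isOpen_setOf_vt b)).inter
    (isOpen_setOf_vt c)) ⟨((u + w) / 2, (u - w) / 2), ⟨hz_of_rotated h1, vt_of_rotated h2⟩,
      vt_of_rotated h3⟩ F
  exact ⟨z, hz.1.1, hz.1.2, hz.2, hzF⟩

/-- Distinct points differ in some rotated coordinate. Placing that coordinate of `z` strictly
between theirs leaves the other free to be arbitrarily large, which makes both ordinary coordinates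
large. -/
theorem exists_hz_vt_far (hab : a ≠ b) (F : Finset ℝ) (R : ℝ) :
    ∃ z, Hz z a ∧ Vt z b ∧ R < |z.1| ∧ R < |z.2| ∧ z.1 ∉ F ∧ z.2 ∉ F := by
  have hopen : IsOpen {z : ℝ × ℝ | R < |z.1| ∧ R < |z.2|} :=
    IsOpen.and (isOpen_lt (by fun_prop) (by fun_prop)) (isOpen_lt (by fun_prop) (by fun_prop))
  suffices h : ∃ u w : ℝ, ((a.1 + a.2 < u ∧ a.1 - a.2 < w) ∨ (u < a.1 + a.2 ∧ w < a.1 - a.2)) ∧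
      ((u < b.1 + b.2 ∧ b.1 - b.2 < w) ∨ (b.1 + b.2 < u ∧ w < b.1 - b.2)) ∧
      2 * R + |u| < |w| ∨ ((a.1 + a.2 < u ∧ a.1 - a.2 < w) ∨
      (u < a.1 + a.2 ∧ w < a.1 - a.2)) ∧
      ((u < b.1 + b.2 ∧ b.1 - b.2 < w) ∨ (b.1 + b.2 < u ∧ w < b.1 - b.2)) ∧
      2 * R + |w| < |u| by
    obtain ⟨u, w, h⟩ := h
    obtain ⟨z, hz, hzF⟩ := exists_generic (((isOpen_setOf_hz a).inter (isOpen_setOf_vt b)).inter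
      hopen) ⟨((u + w) / 2, (u - w) / 2), ⟨hz_of_rotated (by tauto), vt_of_rotated (by tauto)⟩, by
        have h1 : 2 * R < |u + w| := by
          have h3 := abs_sub_abs_le_abs_sub u (-w)
          have h4 := abs_sub_abs_le_abs_sub w (-u)
          rw [abs_neg, sub_neg_eq_add] at h3 h4
          rw [add_comm w] at h4
          rcases h with ⟨-, -, h⟩ | ⟨-, -, h⟩ <;> linarith
        have h2 : 2 * R < |u - w| := by
          have h3 := abs_sub_abs_le_abs_sub u w
          have h4 := abs_sub_abs_le_abs_sub w u
          rw [abs_sub_comm] at h4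
          rcases h with ⟨-, -, h⟩ | ⟨-, -, h⟩ <;> linarith
        change R < |(u + w) / 2| ∧ R < |(u - w) / 2|
        rw [abs_div, abs_div, abs_of_pos (two_pos : (0 : ℝ) < 2)]
        constructor <;> linarith⟩ F
    exact ⟨z, hz.1.1, hz.1.2, hz.2.1, hz.2.2, hzF⟩
  set au := a.1 + a.2
  set aw := a.1 - a.2
  set bu := b.1 + b.2
  set bw := b.1 - b.2
  have hR := le_abs_self R
  have large : ∀ x y t : ℝ, x < |x| + |y| + 2 * |R| + |t| + 1 ∧ y < |x| + |y| + 2 * |R| + |t| + 1 ∧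
      -(|x| + |y| + 2 * |R| + |t| + 1) < x ∧ -(|x| + |y| + 2 * |R| + |t| + 1) < y ∧
      2 * R + |t| < |(|x| + |y| + 2 * |R| + |t| + 1)| := fun x y t => by
    have hx := le_abs_self x
    have hx' := neg_abs_le x
    have hy := le_abs_self y
    have hy' := neg_abs_le y
    have h1 := abs_nonneg t
    have h2 := abs_nonneg R
    rw [abs_of_pos (a := |x| + |y| + 2 * |R| + |t| + 1) (by linarith)]
    refine ⟨?_, ?_, ?_, ?_, ?_⟩ <;> linarith
  rcases lt_trichotomy au bu with h | h | h
  · obtain ⟨u, hu1, hu2⟩ := exists_between h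
    have hw := large aw bw u
    exact ⟨u, _, Or.inl ⟨Or.inl ⟨hu1, hw.1⟩, Or.inl ⟨hu2, hw.2.1⟩, hw.2.2.2.2⟩⟩
  · rcases lt_trichotomy aw bw with h' | h' | h'
    · obtain ⟨w, hw1, hw2⟩ := exists_between h'
      have hu := large au bu w
      exact ⟨_, w, Or.inr ⟨Or.inl ⟨hu.1, hw1⟩, Or.inr ⟨hu.2.1, hw2⟩, hu.2.2.2.2⟩⟩
    · refine absurd (Prod.ext ?_ ?_) hab <;> linarith
    · obtain ⟨w, hw1, hw2⟩ := exists_between h'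
      have hu := large au bu w
      exact ⟨-_, w, Or.inr ⟨Or.inr ⟨hu.2.2.1, hw2⟩, Or.inl ⟨hu.2.2.2.1, hw1⟩,
        by rw [abs_neg]; exact hu.2.2.2.2⟩⟩
  · obtain ⟨u, hu1, hu2⟩ := exists_between h
    have hw := large aw bw u
    exact ⟨u, -_, Or.inl ⟨Or.inr ⟨hu2, hw.2.2.1⟩, Or.inr ⟨hu1, hw.2.2.2.1⟩,
      by rw [abs_neg]; exact hw.2.2.2.2⟩⟩

theorem exists_forall_vt (P : Finset (ℝ × ℝ)) (F : Finset ℝ) :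
    ∃ z, (∀ a ∈ P, Vt z a) ∧ z.1 ∉ F ∧ z.2 ∉ F := by
  have hopen : IsOpen (⋂ a ∈ P, {z | Vt z a}) :=
    isOpen_biInter_finset fun a _ => isOpen_setOf_vt a
  obtain ⟨z, hz, hzF⟩ := exists_generic hopen ⟨(0, ∑ a ∈ P, (|a.1| + |a.2|) + 1), by
    simp only [Set.mem_iInter]
    intro a ha
    have h1 : |a.1| + |a.2| ≤ ∑ a ∈ P, (|a.1| + |a.2|) :=
      single_le_sum (f := fun a : ℝ × ℝ => |a.1| + |a.2|) (fun _ _ => by positivity) ha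
    change |0 - a.1| < |_ - a.2|
    rw [zero_sub, abs_neg]
    have := le_abs_self a.2
    refine lt_of_lt_of_le ?_ (le_abs_self _)
    linarith⟩ F
  exact ⟨z, fun a ha => by simpa using Set.mem_iInter₂.1 hz a ha, hzF⟩

/-- Adding the two inequalities of `Between` shows that its corners are at least as far apart
horizontally as vertically. -/
theorem Vt.not_between (h : Vt b c) : ¬ Between b a c := by
  unfold Vt Between at *
  grind

/-- `Between` puts the first coordinate of `a` between those of `b` and `c`. -/
theorem not_between_of_lt_abs (hb : |b.1| < |a.1|) (hc : |c.1| < |a.1|) : ¬ Between b a c := by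
  unfold Between
  grind

/-- If the second coordinate is reflected, `c` and its image are one above the other, and `Between`
makes them equal. If the first is reflected, `b` has first coordinate zero, and zero, `-c.1`, `c.1`
cannot be monotone unless `c.1 = 0`. -/
theorem not_between_mir (he : e = 1 ∨ e = -1) (hb : mir e b = b) (hc : mir e c ≠ c) :
    ¬ Between b (mir e c) c := by
  have h1 : e * b.1 = b.1 := congrArg Prod.fst hb
  have h2 : -e * b.2 = b.2 := congrArg Prod.snd hb
  have hc' : e * c.1 = c.1 → ¬ -e * c.2 = c.2 := fun h h' => hc (Prod.ext h h')
  unfold Between mir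
  rcases he with rfl | rfl
  · have h3 : ¬ |c.2 - -1 * c.2| ≤ 0 := fun h => by
      have := abs_nonpos_iff.1 h
      exact hc' (by ring) (by linarith)
    rintro (h | h)
    · exact h3 (h.2.trans (by simp))
    · exact h3 (h.2.trans (by simp))
  · rintro (h | h)
    · have h3 := (abs_nonneg _).trans h.1
      have h4 := (abs_nonneg _).trans h.2
      exact hc' (by linarith) (by ring)
    · have h3 := (abs_nonneg _).trans h.1
      have h4 := (abs_nonneg _).trans h.2
      exact hc' (by linarith) (by ring)

/-- Translation by a far `z` followed by reflection separates the image of `a` from `b - z` and `c -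
z`: by too large a vertical distance if the second coordinate is reflected, and by the sign of the
first coordinate otherwise. -/
theorem not_between_sub_mir (he : e = 1 ∨ e = -1) {R : ℝ} (ha : |a.1| ≤ R ∧ |a.2| ≤ R)
    (hb : |b.1| ≤ R ∧ |b.2| ≤ R) (hc : |c.1| ≤ R ∧ |c.2| ≤ R) (hz : 2 * R < |z.1| ∧ 2 * R < |z.2|) :
    ¬ Between (b - z) (mir e (a - z)) (c - z) := by
  simp only [abs_le] at ha hb hc
  obtain ⟨hz1, hz2⟩ := hz
  rw [lt_abs] at hz1 hz2
  unfold Between mir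
  simp only [Prod.fst_sub, Prod.snd_sub]
  rcases he with rfl | rfl
  · rintro (⟨h, -⟩ | ⟨h, -⟩) <;> rw [abs_le] at h <;> rcases hz2 with hz2 | hz2 <;> linarith
  · rintro (⟨h1, h2⟩ | ⟨h1, h2⟩) <;> replace h1 := (abs_nonneg _).trans h1 <;>
      replace h2 := (abs_nonneg _).trans h2 <;> rcases hz1 with hz1 | hz1 <;> linarith

end MaxNormPlane

/-! ### Extending, translating and combining symmetric placements. -/

namespace MaxNormPlane
open Finset Filter Topology
variable {V : Type*} {σ : V → V} {S T X Y : Finset V} {A B C : Finset (Sym2 V)}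
  {e : ℝ}

/-- `p` is a placement of `S`, symmetric with respect to the axis reflection `mir e`, for which
the edges in `A` are mainly horizontal and the edges in `B` mainly vertical. -/
structure Realises (e : ℝ) (σ : V → V) (S : Finset V) (A B : Finset (Sym2 V))
    (p : V → ℝ × ℝ) : Prop where
  injOn : ∀ x ∈ S, ∀ y ∈ S, p x = p y → x = y
  equivariant : ∀ x ∈ S, p (σ x) = mir e (p x)
  hz : ∀ x y, s(x, y) ∈ A → Hz (p x) (p y)
  vt : ∀ x y, s(x, y) ∈ B → Vt (p x) (p y)

/-- All disjoint pairs of symmetric forests on fewer than `n` vertices can be realised. -/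
def RealisableBelow [DecidableEq V] (σ : V → V) (n : ℕ) : Prop :=
  ∀ (e : ℝ) (S : Finset V) (A B : Finset (Sym2 V)), e = 1 ∨ e = -1 → SymForest σ S A →
    SymForest σ S B → Disjoint A B → #S < n → ∃ p, Realises e σ S A B p

theorem Realises.swap {p : V → ℝ × ℝ} (h : Realises e σ S A B p) :
    Realises (-e) σ S B A fun x => (p x).swap where
  injOn x hx y hy hxy := h.injOn x hx y hy (Prod.swap_injective hxy)
  equivariant x hx := by rw [h.equivariant x hx, mir_swap]
  hz x y hxy := h.vt x y hxy
  vt x y hxy := h.hz x y hxy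

/-- The coordinates of the points of a placement, and zero. -/
noncomputable def coords (S : Finset V) (p : V → ℝ × ℝ) : Finset ℝ :=
  insert 0 (S.image (fun x => (p x).1) ∪ S.image fun x => (p x).2)

theorem ne_of_notMem_coords {p : V → ℝ × ℝ} {z : ℝ × ℝ} (hz : z.1 ∉ coords S p) {x : V}
    (hx : x ∈ S) : z ≠ p x := by
  rintro rfl
  exact hz (mem_insert_of_mem (mem_union_left _ (mem_image_of_mem (fun x => (p x).1) hx)))

theorem mir_ne_self {z : ℝ × ℝ} (he : e = 1 ∨ e = -1) (h1 : z.1 ≠ 0) (h2 : z.2 ≠ 0) :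
    mir e z ≠ z := by
  intro h
  have h3 := congrArg Prod.fst h
  have h4 := congrArg Prod.snd h
  unfold mir at h3 h4
  rcases he with rfl | rfl
  · exact h2 (by linarith)
  · exact h1 (by linarith)

variable [DecidableEq V]

/-- A vertex and its mirror image can be added to a placement. -/
theorem Realises.extend (he : e = 1 ∨ e = -1) (hσ : IsPointReflection σ) {v : V}
    (hA : SymForest σ (insert v (insert (σ v) S)) A)
    (hB : SymForest σ (insert v (insert (σ v) S)) B) (hv : v ∉ S) (hvf : σ v ≠ v)
    (hS : ∀ x ∈ S, σ x ∈ S) {p : V → ℝ × ℝ}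
    (hp : Realises e σ S (A ∩ S.sym2) (B ∩ S.sym2) p) {z : ℝ × ℝ}
    (hz : ∀ x ∈ S, s(v, x) ∈ A → Hz z (p x)) (vt : ∀ x ∈ S, s(v, x) ∈ B → Vt z (p x))
    (h1 : z.1 ∉ coords S p) (h2 : z.2 ∉ coords S p) :
    ∃ q, Realises e σ (insert v (insert (σ v) S)) A B q ∧ (∀ x ∈ S, q x = p x) ∧ q v = z := by
  have hinv := hσ.invol
  have hv' : σ v ∉ S := fun h => hv (by simpa [hinv] using hS _ h)
  set q : V → ℝ × ℝ := fun x => if x = v then z else if x = σ v then mir e z else p x with hq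
  have qv : q v = z := by simp [hq]
  have qv' : q (σ v) = mir e z := by simp [hq, hvf]
  have qS : ∀ x ∈ S, q x = p x := fun x hx => by
    have h3 : x ≠ v := by rintro rfl; exact hv hx
    have h4 : x ≠ σ v := by rintro rfl; exact hv' hx
    simp [hq, h3, h4]
  have hzx : ∀ x ∈ S, z ≠ p x := fun x hx => ne_of_notMem_coords h1 hx
  have hmx : ∀ x ∈ S, mir e z ≠ p x := fun x hx h => hzx (σ x) (hS x hx) (by
    rw [hp.equivariant x hx, ← h, mir_mir he])
  -- Zero belongs to `coords`, so `z` lies on neither axis and differs from its mirror image.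
  have hmz : mir e z ≠ z := mir_ne_self he (fun h => h1 (by simp [coords, h]))
    (fun h => h2 (by simp [coords, h]))
  have key : ∀ (C : Finset (Sym2 V)) (R : ℝ × ℝ → ℝ × ℝ → Prop),
      SymForest σ (insert v (insert (σ v) S)) C → (∀ a b, R a b → R b a) →
      (∀ a b, R a b → R (mir e a) (mir e b)) → (∀ x ∈ S, s(v, x) ∈ C → R z (p x)) →
      (∀ x y, s(x, y) ∈ C ∩ S.sym2 → R (p x) (p y)) → ∀ x y, s(x, y) ∈ C → R (q x) (q y) := by
    intro C R hC hsymm hmir hz hS' 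
    have hvS : ∀ x ∈ S, s(v, x) ∈ C → R (q v) (q x) := fun x hx h => by
      rw [qv, qS x hx]
      exact hz x hx h
    have hvS' : ∀ x ∈ S, s(σ v, x) ∈ C → R (q (σ v)) (q x) := fun x hx h => by
      have h3 := hC.map_mem h
      rw [hinv] at h3
      rw [qv', qS x hx, ← mir_mir he (p x), ← hp.equivariant x hx]
      exact hmir _ _ (hz _ (hS x hx) h3)
    have hvv' : s(v, σ v) ∉ C := fun h => hC.ne_map hσ h rfl
    intro x y hxy
    have hne := hC.ne hxy
    have hx := hC.mem_left hxy
    have hy := hC.mem_right hxy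
    rw [mem_insert, mem_insert] at hx hy
    rcases hx with rfl | rfl | hx
    · rcases hy with rfl | rfl | hy
      · exact absurd rfl hne
      · exact absurd hxy hvv'
      · exact hvS y hy hxy
    · rcases hy with rfl | rfl | hy
      · exact absurd (Sym2.eq_swap ▸ hxy) hvv'
      · exact absurd rfl hne
      · exact hvS' y hy hxy
    · rcases hy with rfl | rfl | hy
      · exact hsymm _ _ (hvS x hx (Sym2.eq_swap ▸ hxy))
      · exact hsymm _ _ (hvS' x hx (Sym2.eq_swap ▸ hxy))
      · rw [qS x hx, qS y hy]
        exact hS' x y (mem_inter.2 ⟨hxy, mk_mem_sym2_iff.2 ⟨hx, hy⟩⟩)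
  refine ⟨q, ⟨?_, ?_, ?_, ?_⟩, qS, qv⟩
  · intro x hx y hy
    rw [mem_insert, mem_insert] at hx hy
    rcases hx with rfl | rfl | hx <;> rcases hy with rfl | rfl | hy
    · exact fun _ => rfl
    · rw [qv, qv']; exact fun h => absurd h.symm hmz
    · rw [qv, qS y hy]; exact fun h => absurd h (hzx y hy)
    · rw [qv, qv']; exact fun h => absurd h hmz
    · exact fun _ => rfl
    · rw [qv', qS y hy]; exact fun h => absurd h (hmx y hy)
    · rw [qv, qS x hx]; exact fun h => absurd h.symm (hzx x hx)
    · rw [qv', qS x hx]; exact fun h => absurd h.symm (hmx x hx)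
    · rw [qS x hx, qS y hy]; exact hp.injOn x hx y hy
  · intro x hx
    rw [mem_insert, mem_insert] at hx
    rcases hx with rfl | rfl | hx
    · rw [qv, qv']
    · rw [hinv, qv, qv', mir_mir he]
    · rw [qS x hx, qS _ (hS x hx), hp.equivariant x hx]
  · exact key A Hz hA (fun _ _ h => h.symm) (fun _ _ h => h.map_mir he) hz hp.hz
  · exact key B Vt hB (fun _ _ h => h.symm) (fun _ _ h => h.map_mir he) vt hp.vt

/-- The midpoints of the coordinates of the points of a placement. -/
noncomputable def midpoints (X : Finset V) (p : V → ℝ × ℝ) : Finset ℝ :=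
  (X ×ˢ X).image (fun x => ((p x.1).1 + (p x.2).1) / 2) ∪
    (X ×ˢ X).image fun x => ((p x.1).2 + (p x.2).2) / 2

/-- A fixed vertex can be added at the origin after translating the two mirror images `X` and
`σ X` in opposite directions. -/
theorem Realises.translate (he : e = 1 ∨ e = -1) (hσ : IsPointReflection σ) {r : V}
    (hA : SymForest σ (insert r (X ∪ X.image σ)) A)
    (hB : SymForest σ (insert r (X ∪ X.image σ)) B) (hAX : ∀ x ∈ X, ∀ y, σ y ∈ X → s(x, y) ∉ A)
    (hBX : ∀ x ∈ X, ∀ y, σ y ∈ X → s(x, y) ∉ B)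
    (hd : Disjoint X (X.image σ)) (hr : σ r = r) {p : V → ℝ × ℝ}
    (hp : Realises e σ (X ∪ X.image σ) (A ∩ (X ∪ X.image σ).sym2)
      (B ∩ (X ∪ X.image σ).sym2) p) {z : ℝ × ℝ}
    (hz : ∀ x ∈ X, s(r, x) ∈ A → Hz z (p x)) (vt : ∀ x ∈ X, s(r, x) ∈ B → Vt z (p x))
    (h1 : z.1 ∉ midpoints X p) (h2 : z.2 ∉ midpoints X p) :
    ∃ q, Realises e σ (insert r (X ∪ X.image σ)) A B q ∧ (∀ x ∈ X, q x = p x - z) ∧ q r = 0 := by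
  have hinv := hσ.invol
  have hdX : ∀ x ∈ X, σ x ∉ X := fun x hx h => disjoint_left.1 hd hx (hσ.mem_image.2 h)
  have hrX : r ∉ X := fun h => hdX r h (by rwa [hr])
  -- Only `X` is translated; its mirror image is placed by reflection. Edges between the two would
  -- be destroyed, which is why `hAX` and `hBX` exclude them.
  set q : V → ℝ × ℝ := fun x => if x ∈ X then p x - z else if x = r then 0 else
    mir e (p (σ x) - z) with hq
  have qX : ∀ x ∈ X, q x = p x - z := fun x hx => by simp [hq, hx]
  have qr : q r = 0 := by simp [hq, hrX]
  have qX' : ∀ x ∈ X, q (σ x) = mir e (p x - z) := fun x hx => by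
    have h3 : σ x ≠ r := fun h => hrX (by rw [← hr, ← h, hinv]; exact hx)
    simp [hq, hdX x hx, h3, hinv]
  have hmem : ∀ x, x ∈ insert r (X ∪ X.image σ) → x = r ∨ x ∈ X ∨ ∃ y ∈ X, x = σ y := by
    intro x hx
    rw [mem_insert, mem_union, hσ.mem_image] at hx
    rcases hx with h | h | h
    · exact Or.inl h
    · exact Or.inr (Or.inl h)
    · exact Or.inr (Or.inr ⟨σ x, h, (hinv x).symm⟩)
  -- A coincidence would make a coordinate of `z` the midpoint of the corresponding coordinates of
  -- `p x` and `p y`. The case `x = y` also keeps the points of `X` away from the origin.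
  have hmid : ∀ x ∈ X, ∀ y ∈ X, p x - z ≠ mir e (p y - z) := by
    intro x hx y hy h
    have h3 := congrArg Prod.fst h
    have h4 := congrArg Prod.snd h
    simp only [mir, Prod.fst_sub, Prod.snd_sub] at h3 h4
    rcases he with rfl | rfl
    · exact h2 (mem_union_right _ (mem_image.2 ⟨(x, y), mk_mem_product hx hy,
        by dsimp only; linarith⟩))
    · exact h1 (mem_union_left _ (mem_image.2 ⟨(x, y), mk_mem_product hx hy,
        by dsimp only; linarith⟩))
  have hzero : ∀ x ∈ X, p x - z ≠ 0 := fun x hx h => hmid x hx x hx (by rw [h, mir_zero])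
  have hmzero : ∀ x ∈ X, mir e (p x - z) ≠ 0 := fun x hx h => hzero x hx (by
    rw [← mir_mir he (p x - z), h, mir_zero])
  have key : ∀ (C : Finset (Sym2 V)) (R : ℝ × ℝ → ℝ × ℝ → Prop),
      SymForest σ (insert r (X ∪ X.image σ)) C →
      (∀ x ∈ X, ∀ y, σ y ∈ X → s(x, y) ∉ C) → (∀ a b, R a b → R b a) →
      (∀ a b, R a b → R (mir e a) (mir e b)) → (∀ a b c, R a b → R (a - c) (b - c)) →
      (∀ x ∈ X, s(r, x) ∈ C → R z (p x)) →
      (∀ x y, s(x, y) ∈ C ∩ (X ∪ X.image σ).sym2 → R (p x) (p y)) →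
      ∀ x y, s(x, y) ∈ C → R (q x) (q y) := by
    intro C R hC hCX hsymm hmir hsub hz hS
    have hrx : ∀ x ∈ X, s(r, x) ∈ C → R (q r) (q x) := fun x hx h => by
      rw [qr, qX x hx, ← sub_self z]
      exact hsub _ _ _ (hz x hx h)
    have hrx' : ∀ x ∈ X, s(r, σ x) ∈ C → R (q r) (q (σ x)) := fun x hx h => by
      have h3 := hC.map_mem h
      rw [hinv, hr] at h3
      have h4 := hmir _ _ (hrx x hx h3)
      rwa [qr, mir_zero, qX x hx, ← qX' x hx, ← qr] at h4
    have hxx : ∀ x ∈ X, ∀ y ∈ X, s(x, y) ∈ C → R (q x) (q y) := fun x hx y hy h => by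
      rw [qX x hx, qX y hy]
      refine hsub _ _ _ (hS x y (mem_inter.2 ⟨h, mk_mem_sym2_iff.2 ⟨?_, ?_⟩⟩))
      · exact mem_union_left _ hx
      · exact mem_union_left _ hy
    intro x y hxy
    have hne := hC.ne hxy
    rcases hmem x (hC.mem_left hxy) with rfl | hx | ⟨x, hx, rfl⟩
    · rcases hmem y (hC.mem_right hxy) with rfl | hy | ⟨y, hy, rfl⟩
      · exact absurd rfl hne
      · exact hrx y hy hxy
      · exact hrx' y hy hxy
    · rcases hmem y (hC.mem_right hxy) with rfl | hy | ⟨y, hy, rfl⟩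
      · exact hsymm _ _ (hrx x hx (Sym2.eq_swap ▸ hxy))
      · exact hxx x hx y hy hxy
      · exact absurd hxy (hCX x hx _ (by rwa [hinv]))
    · rcases hmem y (hC.mem_right hxy) with rfl | hy | ⟨y, hy, rfl⟩
      · exact hsymm _ _ (hrx' x hx (Sym2.eq_swap ▸ hxy))
      · exact absurd (Sym2.eq_swap ▸ hxy) (hCX y hy (σ x) (by rwa [hinv]))
      · have h3 := hC.map_mem hxy
        rw [hinv, hinv] at h3
        have h4 := hmir _ _ (hxx x hx y hy h3)
        rwa [qX x hx, qX y hy, ← qX' x hx, ← qX' y hy] at h4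
  have hpinj : ∀ x ∈ X, ∀ y ∈ X, p x - z = p y - z → x = y := fun x hx y hy h =>
    hp.injOn x (mem_union_left _ hx) y (mem_union_left _ hy) (sub_left_injective h)
  refine ⟨q, ⟨?_, ?_, ?_, ?_⟩, qX, qr⟩
  · intro x hx0 y hy0
    rcases hmem x hx0 with rfl | hx | ⟨x, hx, rfl⟩
    · rcases hmem y hy0 with rfl | hy | ⟨y, hy, rfl⟩
      · exact fun _ => rfl
      · rw [qr, qX y hy]; exact fun h => absurd h.symm (hzero y hy)
      · rw [qr, qX' y hy]; exact fun h => absurd h.symm (hmzero y hy)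
    · rcases hmem y hy0 with rfl | hy | ⟨y, hy, rfl⟩
      · rw [qr, qX x hx]; exact fun h => absurd h (hzero x hx)
      · rw [qX x hx, qX y hy]; exact hpinj x hx y hy
      · rw [qX x hx, qX' y hy]; exact fun h => absurd h (hmid x hx y hy)
    · rcases hmem y hy0 with rfl | hy | ⟨y, hy, rfl⟩
      · rw [qr, qX' x hx]; exact fun h => absurd h (hmzero x hx)
      · rw [qX y hy, qX' x hx]; exact fun h => absurd h.symm (hmid y hy x hx)
      · rw [qX' x hx, qX' y hy]
        intro h
        have h3 := congrArg (mir e) h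
        rw [mir_mir he, mir_mir he] at h3
        rw [hpinj x hx y hy h3]
  · intro x hx0
    rcases hmem x hx0 with rfl | hx | ⟨x, hx, rfl⟩
    · rw [hr, qr, mir_zero]
    · rw [qX x hx, qX' x hx]
    · rw [hinv, qX x hx, qX' x hx, mir_mir he]
  · exact key A Hz hA hAX (fun _ _ h => h.symm) (fun _ _ h => h.map_mir he)
      (fun _ _ c h => h.sub_right c) hz hp.hz
  · exact key B Vt hB hBX (fun _ _ h => h.symm) (fun _ _ h => h.map_mir he)
      (fun _ _ c h => h.sub_right c) vt hp.vt

/-- A realisation of a contracted graph and a realisation of the contracted part combine. -/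
theorem eventually_realises {B' : Finset (Sym2 V)} (hA : SymForest σ S A)
    (hB' : SymForest σ S B') (hBB' : B ⊆ B') (hT : ∀ x ∈ T, σ x ∈ T) (hσ : IsPointReflection σ)
    {π : V → V} (hπ : ∀ x, π (σ x) = σ (π x))
    (hker : ∀ x y, π x = π y → x = y ∨ (x ∈ T ∧ y ∈ T)) {P q : V → ℝ × ℝ}
    (hP : Realises e σ (S.image π) (contract π A) (contract π B') P)
    (hq : Realises e σ T (A ∩ T.sym2) (B ∩ T.sym2) q) :
    ∀ᶠ d in 𝓝[>] (0 : ℝ),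
      Realises e σ S A B fun x => P (π x) + d • if x ∈ T then q x else 0 := by
  have hlim : ∀ x, Tendsto (fun d : ℝ => P (π x) + d • if x ∈ T then q x else 0) (𝓝[>] 0)
      (𝓝 (P (π x))) := by
    intro x
    refine Tendsto.mono_left ?_ nhdsWithin_le_nhds
    have : Continuous fun d : ℝ => P (π x) + d • if x ∈ T then q x else 0 := by fun_prop
    simpa using this.tendsto 0
  have hlim2 : ∀ x y, Tendsto (fun d : ℝ => ((P (π x) + d • if x ∈ T then q x else 0),
      (P (π y) + d • if y ∈ T then q y else 0))) (𝓝[>] 0) (𝓝 (P (π x), P (π y))) :=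
    fun x y => (hlim x).prodMk_nhds (hlim y)
  have hT' : ∀ x, σ x ∈ T ↔ x ∈ T := fun x =>
    ⟨fun h => by simpa [hσ.invol] using hT _ h, hT x⟩
  have e1 : ∀ᶠ d in 𝓝[>] (0 : ℝ), ∀ x ∈ S, ∀ y ∈ S,
      (P (π x) + d • if x ∈ T then q x else 0) = (P (π y) + d • if y ∈ T then q y else 0) →
      x = y := by
    refine (eventually_all_finset S).2 fun x hx => (eventually_all_finset S).2 fun y hy => ?_
    by_cases hxy : π x = π y
    · rcases hker x y hxy with h | h
      · exact Eventually.of_forall fun _ _ => h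
      · filter_upwards [self_mem_nhdsWithin] with d hd heq
        rw [hxy, if_pos h.1, if_pos h.2] at heq
        exact hq.injOn x h.1 y h.2
          (smul_right_injective _ (ne_of_gt hd) (add_left_cancel heq))
    · have hne : P (π x) ≠ P (π y) := fun h => hxy
        (hP.injOn _ (mem_image_of_mem π hx) _ (mem_image_of_mem π hy) h)
      filter_upwards [(hlim2 x y).eventually (isOpen_ne_fun continuous_fst continuous_snd
        |>.mem_nhds hne)] with d hd h using absurd h hd
  have key : ∀ (C C' : Finset (Sym2 V)) (R : ℝ × ℝ → ℝ × ℝ → Prop),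
      IsOpen {x : (ℝ × ℝ) × (ℝ × ℝ) | R x.1 x.2} → SymForest σ S C' → C ⊆ C' →
      (∀ (a b : ℝ × ℝ) (d : ℝ) (q : ℝ × ℝ), 0 < d → R a b → R (q + d • a) (q + d • b)) →
      (∀ x y, s(x, y) ∈ contract π C' → R (P x) (P y)) →
      (∀ x y, s(x, y) ∈ C ∩ T.sym2 → R (q x) (q y)) → ∀ᶠ d in 𝓝[>] (0 : ℝ),
      ∀ x ∈ S, ∀ y ∈ S, s(x, y) ∈ C → R (P (π x) + d • if x ∈ T then q x else 0)
        (P (π y) + d • if y ∈ T then q y else 0) := by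
    intro C C' R hR hC' hCC' hsmul h1 h2
    refine (eventually_all_finset S).2 fun x hx => (eventually_all_finset S).2 fun y hy => ?_
    by_cases hC : s(x, y) ∈ C
    swap
    · exact Eventually.of_forall fun _ h => absurd h hC
    -- On a collapsed pair the contribution of `P` cancels and scaling by `d > 0` preserves the
    -- relation for `q`. On any other pair the relation holds for `P`, is open, and survives for
    -- small `d`.
    by_cases hxy : π x = π y
    · have h := (hker x y hxy).resolve_left (hC'.ne (hCC' hC))
      filter_upwards [self_mem_nhdsWithin] with d hd _
      rw [hxy, if_pos h.1, if_pos h.2]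
      exact hsmul _ _ _ _ hd (h2 x y (mem_inter.2 ⟨hC, mk_mem_sym2_iff.2 h⟩))
    · filter_upwards [(hlim2 x y).eventually
        (hR.mem_nhds (h1 _ _ (mk_mem_contract (hCC' hC) hxy)))] with d hd _ using hd
  filter_upwards [e1, key A A Hz isOpen_hz hA subset_rfl (fun a b d q hd h => h.smul hd q) hP.hz
    hq.hz, key B B' Vt isOpen_vt hB' hBB' (fun a b d q hd h => h.smul hd q) hP.vt hq.vt]
    with d h1 h2 h3
  refine ⟨h1, fun x hx => ?_, fun x y hxy => h2 x (hA.mem_left hxy) y (hA.mem_right hxy) hxy,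
    fun x y hxy => h3 x (hB'.mem_left (hBB' hxy)) y (hB'.mem_right (hBB' hxy)) hxy⟩
  rw [hπ, hP.equivariant _ (mem_image_of_mem π hx), mir_add, mir_smul]
  congr 2
  by_cases h : x ∈ T
  · rw [if_pos h, if_pos (hT x h), hq.equivariant x h]
  · rw [if_neg h, if_neg (by rwa [hT']), mir_zero]

end MaxNormPlane

/-! ### Realising a graph from the contraction of a block. -/

namespace MaxNormPlane
open Finset Filter Topology
variable {V : Type*} [DecidableEq V] {σ : V → V} {S T X Y : Finset V} {A B C : Finset (Sym2 V)}
  {e : ℝ}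

theorem IsBlock.not_mem (hb : IsBlock σ X) (hσ : IsPointReflection σ)
    (hA : SymForest σ S A) (hXS : X ⊆ S) (hX : Full A X) {x y : V} (hxy : s(x, y) ∈ A)
    (hx : x ∈ X) (hy : σ y ∈ X) : y ∈ X := by
  rcases hb with hb | hb
  · exact absurd hxy (hA.not_cross hσ hXS hX hb hx hy)
  · simpa [hσ.invol] using hb _ hy

/-- Contraction of a block `X` and its mirror image: the contracted graph and the block can be
realised separately. -/
theorem exists_contraction {n : ℕ} {B' : Finset (Sym2 V)} (hσ : IsPointReflection σ)
    (he : e = 1 ∨ e = -1) (ih : RealisableBelow σ n) (hA : SymForest σ S A)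
    (hB : SymForest σ S B) (hB' : SymForest σ S B') (hBB' : B ⊆ B') (hAB : Disjoint A B)
    (hB'B : ∀ x y, s(x, y) ∈ B' → s(x, y) ∉ B → (x ∈ X ∧ y ∈ X) ∨ (σ x ∈ X ∧ σ y ∈ X))
    (hXS : X ⊆ S) (hAX : Full A X) (hBX : Full B' X) (hX2 : 2 ≤ #X) (hb : IsBlock σ X)
    (hSn : #S ≤ n) (hTn : #(X ∪ X.image σ) < n)
    (hpar : ∀ y ∈ S, y ∉ X → σ y ∉ X → ∀ x ∈ X, ∀ x' ∈ X, s(y, x) ∈ A → s(y, x') ∉ B') :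
    ∃ (Q : V → ℝ × ℝ) (p : ℝ → V → ℝ × ℝ),
      (∀ x, Tendsto (fun d => p d x) (𝓝[>] 0) (𝓝 (Q x))) ∧
      (∀ᶠ d in 𝓝[>] (0 : ℝ), Realises e σ S A B (p d)) ∧
      (∀ x ∈ X, ∀ y ∈ X, Q x = Q y) ∧ ∀ x ∈ X, ∀ y ∈ S, y ∉ X → Q x ≠ Q y := by
  have hinv := hσ.invol
  have hXne : X.Nonempty := card_pos.1 (by omega)
  obtain ⟨π, hπ, hπX, hker, hfix, hπmem⟩ := exists_collapse hσ hA hXS hAX hXne hb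
  have hπX' : ∀ x y, σ x ∈ X → σ y ∈ X → π x = π y := fun x y hx hy =>
    hσ.injective (by rw [← hπ, ← hπ]; exact hπX _ hx _ hy)
  -- An edge that survives contraction has at most one end in the block or its mirror image, because
  -- no edge joins two disjoint mirror images.
  have hsep : ∀ C, SymForest σ S C → Full C X → ∀ x y, s(x, y) ∈ C → π x ≠ π y →
      (x ∈ X ∨ σ x ∈ X) → ¬ (y ∈ X ∨ σ y ∈ X) := by
    intro C hC hCX x y hxy hne hx hy
    rcases hx with hx | hx <;> rcases hy with hy | hy
    · exact hne (hπX x hx y hy)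
    · exact hne (hπX x hx y (hb.not_mem hσ hC hXS hCX hxy hx hy))
    · exact hne (hπX x (hb.not_mem hσ hC hXS hCX (Sym2.eq_swap ▸ hxy) hy hx) y hy)
    · exact hne (hπX' x y hx hy)
  -- A fibre that meets `S` is `X`, the mirror image of `X`, or a single vertex.
  have hfull : ∀ C, SymForest σ S C → Full C X → ∀ x ∈ S, Full C (S.filter (π · = π x)) := by
    intro C hC hCX x hx
    by_cases h1 : x ∈ X
    · convert hCX using 1
      ext y
      rw [mem_filter]
      refine ⟨fun h => ?_, fun h => ⟨hXS h, hπX _ h _ h1⟩⟩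
      have h2 := hπmem x h1
      rw [← h.2] at h2
      by_contra hy
      rcases hker y x h.2 with rfl | h3 | h3
      · exact hy h1
      · exact hy h3.1
      · rcases hb with hb | hb
        · exact disjoint_left.1 hb h1 (hσ.mem_image.2 h3.2)
        · exact hy (by simpa [hinv] using hb _ h3.1)
    · by_cases h2 : σ x ∈ X
      · convert hC.full_image hσ hCX using 1
        ext y
        rw [mem_filter, hσ.mem_image]
        refine ⟨fun h => ?_, fun h => ⟨?_, hπX' y x h h2⟩⟩
        · rcases hker y x h.2 with rfl | h3 | h3
          · exact h2
          · exact absurd h3.2 h1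
          · exact h3.1
        · simpa [hinv] using hC.vertex_inv _ (hXS h)
      · convert full_singleton C x using 1
        ext y
        rw [mem_filter, mem_singleton]
        refine ⟨fun h => ?_, fun h => by rw [h]; exact ⟨hx, rfl⟩⟩
        rcases hker y x h.2 with h3 | h3 | h3
        · exact h3
        · exact absurd h3.2 h1
        · exact absurd h3.2 h2
  have hcross : ∀ C, SymForest σ S C → Full C X → ∀ x y, s(x, y) ∈ C → π x ≠ π y →
      π y ≠ σ (π x) := by
    intro C hC hCX x y hxy hne h
    rw [← hπ] at h
    rcases hker _ _ h with h | h | h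
    · exact hC.ne_map hσ hxy h
    · exact hsep C hC hCX x y hxy hne (Or.inr h.2) (Or.inl h.1)
    · rw [hinv] at h
      exact hsep C hC hCX x y hxy hne (Or.inl h.2) (Or.inr h.1)
  have hcA := hA.contract hσ hπ (hfull A hA hAX) (hcross A hA hAX)
  have hcB := hB'.contract hσ hπ (hfull B' hB' hBX) (hcross B' hB' hBX)
  -- Edges of `A` and `B'` from one vertex can be identified only inside the block or its mirror
  -- image, where `hpar` forbids it. The edges of `B'` outside `B` are collapsed, so an overlap of
  -- `A` and `B'` there does no harm.
  have hpar' : ∀ x y y', s(x, y) ∈ A → s(x, y') ∈ B' → π x ≠ π y → π y = π y' → False := by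
    intro x y y' hxy hxy' hne hyy
    rcases hker y y' hyy with rfl | h | h
    · by_cases hB : s(x, y) ∈ B
      · exact disjoint_left.1 hAB hxy hB
      · rcases hB'B _ _ hxy' hB with h | h
        · exact hne (hπX x h.1 y h.2)
        · exact hne (hπX' x y h.1 h.2)
    · have hx := mt (hsep A hA hAX x y hxy hne) (not_not.2 (Or.inl h.1))
      rw [not_or] at hx
      exact hpar x (hA.mem_left hxy) hx.1 hx.2 y h.1 y' h.2 hxy hxy'
    · have hx := mt (hsep A hA hAX x y hxy hne) (not_not.2 (Or.inr h.1))
      rw [not_or] at hx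
      exact hpar (σ x) (hA.vertex_inv _ (hA.mem_left hxy)) hx.2 (by rw [hinv]; exact hx.1)
        (σ y) h.1 (σ y') h.2 (hA.map_mem hxy) (hB'.map_mem hxy')
  have hboth : ∀ x y x' y', s(x, y) ∈ A → s(x', y') ∈ B' → π x ≠ π y → π x = π x' →
      π y = π y' → False := by
    intro x y x' y' hxy hxy' hne hx hy
    have h1 := hsep A hA hAX x y hxy hne
    rcases hker x x' hx with rfl | h | h
    · exact hpar' x y y' hxy hxy' hne hy
    all_goals
      rcases hker y y' hy with rfl | h' | h'
      · exact hpar' y x x' (Sym2.eq_swap ▸ hxy) (Sym2.eq_swap ▸ hxy') hne.symm hx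
      all_goals tauto
  have hcd : Disjoint (contract π A) (contract π B') := by
    rw [disjoint_left]
    intro f hf hf'
    obtain ⟨x, y, hxy, hne, rfl⟩ := exists_of_mem_contract hf
    obtain ⟨x', y', hxy', -, h⟩ := exists_of_mem_contract hf'
    rcases Sym2.eq_iff.1 h with h | h
    · exact hboth x y x' y' hxy hxy' hne h.1 h.2
    · exact hboth x y y' x' hxy (Sym2.eq_swap ▸ hxy') hne h.1 h.2
  have hcard : #(S.image π) < n := by
    refine lt_of_lt_of_le (lt_of_le_of_ne card_image_le fun h => ?_) hSn
    obtain ⟨a, ha, b, hb', hab⟩ := one_lt_card.1 hX2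
    exact hab (card_image_iff.1 h (hXS ha) (hXS hb') (hπX a ha b hb'))
  obtain ⟨P, hP⟩ := ih e _ _ _ he hcA hcB hcd hcard
  have hTS : X ∪ X.image σ ⊆ S := union_subset hXS fun x hx => by
    simpa [hinv] using hA.vertex_inv _ (hXS (hσ.mem_image.1 hx))
  have hTinv : ∀ x ∈ X ∪ X.image σ, σ x ∈ X ∪ X.image σ := fun x hx => by
    rw [mem_union, hσ.mem_image] at hx ⊢
    rw [hinv]
    exact hx.symm
  -- Inside the block `B` is realised instead of `B'`, which need not be disjoint from `A` there.
  obtain ⟨q, hq⟩ := ih e _ _ _ he (hA.restrict hTS hTinv) (hB.restrict hTS hTinv)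
    (hAB.mono inter_subset_left inter_subset_left) hTn
  refine ⟨fun x => P (π x), _, fun x => ?_, eventually_realises hA hB' hBB' hTinv hσ hπ
    (fun x y h => ?_) hP hq, fun x hx y hy => congrArg P (hπX x hx y hy),
    fun x hx y hy hyX h => ?_⟩
  · refine Tendsto.mono_left ?_ nhdsWithin_le_nhds
    have : Continuous fun d : ℝ => P (π x) + d • if x ∈ X ∪ X.image σ then q x else 0 := by
      fun_prop
    simpa using this.tendsto 0
  · rcases hker x y h with h | h | h
    · exact Or.inl h
    · exact Or.inr ⟨mem_union_left _ h.1, mem_union_left _ h.2⟩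
    · exact Or.inr ⟨mem_union_right _ (hσ.mem_image.2 h.1),
        mem_union_right _ (hσ.mem_image.2 h.2)⟩
  · have h3 := hP.injOn _ (mem_image_of_mem π (hXS hx)) _ (mem_image_of_mem π hy) h
    rcases hker x y h3 with rfl | h | h
    · exact hyX hx
    · exact hyX h.2
    · rcases hb with hb | hb
      · exact disjoint_left.1 hb hx (hσ.mem_image.2 h.1)
      · exact hyX (by simpa [hinv] using hb _ h.2)

end MaxNormPlane

/-! ### Graphs with a proper set that spans trees in both forests. -/

namespace MaxNormPlane
open Finset Filter Topology
variable {V : Type*} [DecidableEq V] {σ : V → V} {S T X Y : Finset V} {A B C : Finset (Sym2 V)}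
  {e : ℝ}

/-- The union of `X` and its mirror image. -/
def hull (σ : V → V) (X : Finset V) : Finset V := X ∪ X.image σ

theorem mem_hull (hσ : IsPointReflection σ) {x : V} : x ∈ hull σ X ↔ x ∈ X ∨ σ x ∈ X := by
  rw [hull, mem_union, hσ.mem_image]

theorem hull_inv (hσ : IsPointReflection σ) : ∀ x ∈ hull σ X, σ x ∈ hull σ X := by
  intro x hx
  rw [mem_hull hσ] at hx ⊢
  rw [hσ.invol]
  exact hx.symm

theorem hull_subset (hσ : IsPointReflection σ) (hA : SymForest σ S A) (hXS : X ⊆ S) :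
    hull σ X ⊆ S := by
  intro x hx
  rcases (mem_hull hσ).1 hx with h | h
  · exact hXS h
  · simpa [hσ.invol] using hA.vertex_inv _ (hXS h)

theorem hull_insert (hσ : IsPointReflection σ) (y : V) :
    hull σ (insert y X) = insert y (insert (σ y) (hull σ X)) := by
  ext x
  have : σ x = y ↔ x = σ y := ⟨fun h => by rw [← h, hσ.invol], fun h => by rw [h, hσ.invol]⟩
  rw [mem_insert, mem_insert, mem_hull hσ, mem_hull hσ, mem_insert, mem_insert, this]
  tauto

theorem isBlock_insert (hσ : IsPointReflection σ) {y : V} (hd : Disjoint X (X.image σ))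
    (hy : σ y ≠ y) (hyX : σ y ∉ X) : Disjoint (insert y X) ((insert y X).image σ) := by
  rw [disjoint_left]
  intro x hx hx'
  rw [hσ.mem_image, mem_insert] at hx'
  rcases mem_insert.1 hx with rfl | hx
  · exact hx'.elim hy hyX
  · rcases hx' with rfl | hx'
    · exact hyX (by rwa [hσ.invol])
    · exact disjoint_left.1 hd hx (hσ.mem_image.2 hx')

/-- If `X` meets its mirror image, their union is still full in both forests and is invariant. -/
theorem exists_block (hσ : IsPointReflection σ) (hA : SymForest σ S A) (hB : SymForest σ S B)
    (hXS : X ⊆ S) (hAX : Full A X) (hBX : Full B X) :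
    ∃ Y, X ⊆ Y ∧ Y ⊆ S ∧ Full A Y ∧ Full B Y ∧ IsBlock σ Y ∧ hull σ Y = hull σ X := by
  by_cases hd : Disjoint X (X.image σ)
  · exact ⟨X, subset_rfl, hXS, hAX, hBX, Or.inl hd, rfl⟩
  · have hne : (X ∩ X.image σ).Nonempty := not_disjoint_iff_nonempty_inter.1 hd
    refine ⟨hull σ X, subset_union_left, hull_subset hσ hA hXS,
      hA.full_union hXS hAX (hA.full_image hσ hAX) hne,
      hB.full_union hXS hBX (hB.full_image hσ hBX) hne, Or.inr (hull_inv hσ), ?_⟩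
    ext x
    rw [mem_hull hσ]
    exact ⟨fun h => h.elim id fun h => by simpa [hσ.invol] using hull_inv hσ _ h, Or.inl⟩

/-- For a disjoint block, `insert y X` is again full and disjoint from its mirror image, so `y` has
no neighbour in the image of `X`. -/
theorem IsBlock.nbr_unique (hb : IsBlock σ X) (hσ : IsPointReflection σ) (hA : SymForest σ S A)
    (hXS : X ⊆ S) (hX : Full A X) {x x' y : V} (hy : y ∉ X) (hy' : σ y ∉ X) (hyf : σ y ≠ y)
    (hx : x ∈ X) (h : s(y, x) ∈ A) (hx' : x' ∈ hull σ X) (h' : s(y, x') ∈ A) : x' = x := by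
  by_cases hx'X : x' ∈ X
  · exact hA.nbr_unique hXS hX hy hx'X hx h' h
  · have hx'' := ((mem_hull hσ).1 hx').resolve_left hx'X
    rcases hb with hb | hb
    · exact absurd h' (hA.not_cross hσ (insert_subset (hA.mem_left h) hXS) (hX.insert hy hx h)
        (isBlock_insert hσ hb hyf hy') (mem_insert_self _ _) (mem_insert_of_mem hx''))
    · exact absurd (by simpa [hσ.invol] using hb _ hx'') hx'X

/-- A fixed vertex outside a block forces the block to be disjoint from its mirror image. -/
theorem IsBlock.disjoint_of_fixed (hb : IsBlock σ X) (hσ : IsPointReflection σ)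
    (hA : SymForest σ S A) (hXS : X ⊆ S) (hX : Full A X) (hne : X.Nonempty) {r : V}
    (hr : σ r = r) (hrX : r ∉ X) : Disjoint X (X.image σ) := by
  refine hb.resolve_right fun hb => ?_
  obtain ⟨s, hs, hs'⟩ := hA.exists_fixed hσ hXS hX hne hb
  exact hrX (hσ.fixed_unique r s hr hs' ▸ hs)

/-- Two forests with a common proper full set can be realised if smaller pairs of forests can. -/
theorem exists_realises_of_full (hσ : IsPointReflection σ) (he : e = 1 ∨ e = -1)
    (ih : RealisableBelow σ #S) (hA : SymForest σ S A) (hB : SymForest σ S B)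
    (hAB : Disjoint A B) (hXS : X ⊆ S) (hAX : Full A X) (hBX : Full B X) (hX2 : 2 ≤ #X)
    (hXne : hull σ X ≠ S) : ∃ p, Realises e σ S A B p := by
  classical
  obtain ⟨X₀, h1, h2, h3, h4, h5, h6⟩ := exists_block hσ hA hB hXS hAX hBX
  have hX₀ : X₀ ∈ S.powerset.filter
      fun X => Full A X ∧ Full B X ∧ 2 ≤ #X ∧ IsBlock σ X ∧ hull σ X ≠ S :=
    mem_filter.2 ⟨mem_powerset.2 h2, h3, h4, hX2.trans (card_le_card h1), h5, h6 ▸ hXne⟩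
  -- The block is chosen with the largest proper hull, so that any vertex obstructing the
  -- contraction completes it to all of `S`.
  obtain ⟨X, hX, hmax⟩ := exists_max_image _ (fun X => #(hull σ X)) ⟨X₀, hX₀⟩
  clear h1 h2 h3 h4 h5 h6 hX₀ X₀ hXS hAX hBX hX2 hXne
  obtain ⟨hXS, hAX, hBX, hX2, hb, hXne⟩ := mem_filter.1 hX
  rw [mem_powerset] at hXS
  have hhS := hull_subset hσ hA hXS
  have hcard : #(hull σ X) < #S := card_lt_card (hhS.ssubset_of_ne hXne)
  by_cases hpar : ∀ y ∈ S, y ∉ X → σ y ∉ X → ∀ x ∈ X, ∀ x' ∈ X, s(y, x) ∈ A → s(y, x') ∉ B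
  · obtain ⟨-, p, -, hp, -⟩ := exists_contraction hσ he ih hA hB hB subset_rfl hAB
      (fun x y h h' => absurd h h') hXS hAX hBX hX2 hb le_rfl hcard hpar
    obtain ⟨d, hd⟩ := hp.exists
    exact ⟨_, hd⟩
  push Not at hpar
  obtain ⟨y, hyS, hyX, hyX', x₁, hx₁, x₂, hx₂, h₁, h₂⟩ := hpar
  have hx : x₁ ≠ x₂ := by
    rintro rfl
    exact disjoint_left.1 hAB h₁ h₂
  -- Joined to `X` in both forests, `y` can be added while `X` stays full in both. Maximality then
  -- forces the new hull to be everything.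
  have hSeq : insert y (insert (σ y) (hull σ X)) = S := by
    by_contra hne
    obtain ⟨Y, h1, h2, h3, h4, h5, h6⟩ := exists_block hσ hA hB (insert_subset hyS hXS)
      (hAX.insert hyX hx₁ h₁) (hBX.insert hyX hx₂ h₂)
    rw [hull_insert hσ] at h6
    have h7 := hmax Y (mem_filter.2 ⟨mem_powerset.2 h2, h3, h4, hX2.trans (card_le_card
      ((subset_insert _ _).trans h1)), h5, h6 ▸ hne⟩)
    have h8 : hull σ X ⊂ hull σ Y := by
      rw [h6]
      refine Finset.ssubset_iff_subset_ne.2 ⟨(subset_insert (σ y) _).trans (subset_insert _ _), fun h => ?_⟩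
      have hy := mem_insert_self y (insert (σ y) (hull σ X))
      rw [← h, mem_hull hσ] at hy
      exact hy.elim hyX hyX'
    exact absurd (card_lt_card h8) (not_lt.2 h7)
  have hxh : X ⊆ hull σ X := subset_union_left
  obtain ⟨p, hp⟩ := ih e _ _ _ he (hA.restrict hhS (hull_inv hσ)) (hB.restrict hhS (hull_inv hσ))
    (hAB.mono inter_subset_left inter_subset_left) hcard
  have hpx : p x₁ ≠ p x₂ := fun h => hx (hp.injOn _ (hxh hx₁) _ (hxh hx₂) h)
  -- Only `y` and `σ y` are left to place, and each forest joins `y` to exactly one vertex of `X`. A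
  -- fixed `y` has to lie on the axis, so the two halves are moved instead of `y`.
  by_cases hyf : σ y = y
  · have hd := hb.disjoint_of_fixed hσ hA hXS hAX ⟨x₁, hx₁⟩ hyf hyX
    rw [hyf, insert_eq_of_mem (mem_insert_self _ _)] at hSeq
    subst hSeq
    obtain ⟨z, hz, hz', -, -, hz1, hz2⟩ := exists_hz_vt_far hpx (midpoints X p) 0
    obtain ⟨q, hq, -⟩ := Realises.translate he hσ hA hB
      (fun _ hx _ hy => hA.not_cross hσ hXS hAX hd hx hy)
      (fun _ hx _ hy => hB.not_cross hσ hXS hBX hd hx hy) hd hyf hp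
      (fun x hx h => (hA.nbr_unique hXS hAX hyX hx hx₁ h h₁) ▸ hz)
      (fun x hx h => (hB.nbr_unique hXS hBX hyX hx hx₂ h h₂) ▸ hz') hz1 hz2
    exact ⟨q, hq⟩
  · subst hSeq
    obtain ⟨z, hz, hz', -, -, hz1, hz2⟩ := exists_hz_vt_far hpx (coords (hull σ X) p) 0
    obtain ⟨q, hq, -⟩ := Realises.extend he hσ hA hB
      (fun h => ((mem_hull hσ).1 h).elim hyX hyX') hyf (hull_inv hσ) hp
      (fun x hx h => (hb.nbr_unique hσ hA hXS hAX hyX hyX' hyf hx₁ h₁ hx h) ▸ hz)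
      (fun x hx h => (hb.nbr_unique hσ hB hXS hBX hyX hyX' hyf hx₂ h₂ hx h) ▸ hz') hz1 hz2
    exact ⟨q, hq⟩

end MaxNormPlane

/-! ### Bridging a vertex of degree three. -/

namespace MaxNormPlane
open Finset Filter Topology
variable {V : Type*} [DecidableEq V] {σ : V → V} {S T X Y : Finset V} {A B C : Finset (Sym2 V)}
  {e : ℝ}

/-- The edges of `B` in `S` together with `bc` and its mirror image. -/
def bridged (σ : V → V) (S : Finset V) (B : Finset (Sym2 V)) (b c : V) : Finset (Sym2 V) :=
  insert s(b, c) (insert s(σ b, σ c) (B ∩ S.sym2))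

theorem spanned_insert_le (f : Sym2 V) : spanned (insert f C) X ≤ spanned C X + 1 := by
  unfold spanned
  refine (card_le_card (t := insert f (C ∩ X.sym2)) ?_).trans (card_insert_le _ _)
  intro g hg
  rw [mem_inter, mem_insert] at hg
  rw [mem_insert, mem_inter]
  tauto

theorem spanned_insert_of_notMem {f : Sym2 V} (hf : f ∉ X.sym2) :
    spanned (insert f C) X = spanned C X := by
  unfold spanned
  rw [insert_inter_of_notMem hf]

theorem full_of_insert {f : Sym2 V} (hf : f ∉ X.sym2) (h : Full (insert f C) X) : Full C X := by
  rwa [Full, spanned_insert_of_notMem hf] at h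

/-- Replacing the paths `b v c` and `σ b, σ v, σ c` by edges `bc` and `σ b, σ c` gives a forest. -/
theorem SymForest.bridged (hσ : IsPointReflection σ) {v b c : V}
    (hB : SymForest σ (insert v (insert (σ v) S)) B) (hv : v ∉ S) (hvf : σ v ≠ v)
    (hS : ∀ x ∈ S, σ x ∈ S) (hb : b ∈ S) (hc : c ∈ S) (hbc : b ≠ c) (hvb : s(v, b) ∈ B)
    (hvc : s(v, c) ∈ B) : SymForest σ S (bridged σ S B b c) := by
  have hinv := hσ.invol
  have hv' : σ v ∉ S := fun h => hv (by simpa [hinv] using hS _ h)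
  have hvb' := hB.map_mem hvb
  have hvc' := hB.map_mem hvc
  have hbc' : σ b ≠ σ c := fun h => hbc (hσ.injective h)
  have hSS : S ⊆ insert v (insert (σ v) S) := (subset_insert _ _).trans (subset_insert _ _)
  have htwo : ∀ X ⊆ S, b ∈ X → c ∈ X → σ b ∈ X → σ c ∈ X →
      spanned B X + 4 ≤ spanned B (insert v (insert (σ v) X)) := by
    intro X hX h1 h2 h3 h4
    have h5 := spanned_insert_two (X := X) (fun h => hv' (hX h)) h3 h4 hbc' hvb' hvc'
    have h6 := spanned_insert_two (X := insert (σ v) X) (y := v)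
      (fun h => (mem_insert.1 h).elim (fun h => hvf h.symm) fun h => hv (hX h))
      (mem_insert_of_mem h1) (mem_insert_of_mem h2) hbc hvb hvc
    omega
  -- Otherwise `b`, `v`, `σ b`, `σ v` would form a 4-cycle in `B`.
  have hcross : c ≠ σ b := by
    rintro rfl
    have hX : ({b, σ b} : Finset V) ⊆ S := by
      intro x hx
      rcases mem_insert.1 hx with rfl | hx
      · exact hb
      · rwa [mem_singleton.1 hx]
    have h1 := htwo {b, σ b} hX (by simp) (by simp) (by simp) (by simp [hinv])
    have h2 := hB.spanned_add_two_le hσ (X := insert v (insert (σ v) {b, σ b}))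
      (insert_subset_insert _ (insert_subset_insert _ hX)) (by simp [hinv])
      (by simp [hinv, hvf, hvf.symm, hbc, hbc.symm]) (insert_nonempty _ _)
    have h3 : #(insert v (insert (σ v) ({b, σ b} : Finset V))) ≤ 4 := card_le_four
    omega
  refine ⟨hS, ?_, ?_, ?_, ?_⟩
  · refine insert_subset ?_ (insert_subset ?_ inter_subset_right)
    · exact mk_mem_sym2_iff.2 ⟨hb, hc⟩
    · exact mk_mem_sym2_iff.2 ⟨hS b hb, hS c hc⟩
  · intro f hf
    rw [MaxNormPlane.bridged, mem_insert, mem_insert] at hf ⊢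
    rcases hf with rfl | rfl | hf
    · exact Or.inr (Or.inl rfl)
    · left
      rw [Sym2.map_mk, hinv, hinv]
    · exact Or.inr (Or.inr ((hB.restrict hSS hS).edge_inv f hf))
  · intro f hf
    rw [MaxNormPlane.bridged, mem_insert, mem_insert] at hf
    rcases hf with rfl | rfl | hf
    · rw [Sym2.map_mk, Ne, Sym2.eq_iff]
      rintro (h | h)
      · exact hbc (hσ.fixed_unique b c h.1 h.2)
      · exact hcross h.1.symm
    · rw [Sym2.map_mk, hinv, hinv, Ne, Sym2.eq_iff]
      rintro (h | h)
      · exact hbc (hσ.fixed_unique b c h.1.symm h.2.symm)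
      · exact hcross h.2
    · exact hB.not_fixed f (mem_inter.1 hf).1
  · intro X hX hne
    have hsp : spanned (B ∩ S.sym2) X ≤ spanned B X := spanned_mono_left inter_subset_left X
    unfold MaxNormPlane.bridged
    have h0 := hB.sparse X (hX.trans hSS) hne
    have hXv : v ∉ X := fun h => hv (hX h)
    have hXv' : σ v ∉ X := fun h => hv' (hX h)
    have l1 := spanned_insert_le (X := X) (C := insert s(σ b, σ c) (B ∩ S.sym2)) s(b, c)
    have l2 := spanned_insert_le (X := X) (C := B ∩ S.sym2) s(σ b, σ c)
    -- For each bridge inside `X`, its removed midpoint is added back: one more vertex and two more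
    -- edges of `B`. Sparsity of `B` on the enlarged set is the required bound on `X`.
    by_cases h1 : b ∈ X ∧ c ∈ X <;> by_cases h2 : σ b ∈ X ∧ σ c ∈ X
    · have h3 := htwo X hX h1.1 h1.2 h2.1 h2.2
      have h4 := hB.sparse (insert v (insert (σ v) X))
        (insert_subset_insert _ (insert_subset_insert _ hX)) (insert_nonempty _ _)
      have h5 : #(insert v (insert (σ v) X)) ≤ #X + 2 :=
        (card_insert_le _ _).trans (Nat.add_le_add_right (card_insert_le _ _) 1)
      omega
    · have h3 := spanned_insert_two hXv h1.1 h1.2 hbc hvb hvc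
      have h4 := hB.sparse (insert v X) (insert_subset_insert _ (hX.trans (subset_insert _ _)))
        (insert_nonempty _ _)
      rw [card_insert_of_notMem hXv] at h4
      rw [spanned_insert_of_notMem (f := s(σ b, σ c)) (by rwa [mk_mem_sym2_iff])] at l1
      omega
    · have h3 := spanned_insert_two hXv' h2.1 h2.2 hbc' hvb' hvc'
      have h4 := hB.sparse (insert (σ v) X) (insert_subset (by simp) (hX.trans hSS))
        (insert_nonempty _ _)
      rw [card_insert_of_notMem hXv'] at h4
      rw [spanned_insert_of_notMem (f := s(b, c)) (by rwa [mk_mem_sym2_iff])]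
      omega
    · rw [spanned_insert_of_notMem (f := s(b, c)) (by rwa [mk_mem_sym2_iff]),
        spanned_insert_of_notMem (f := s(σ b, σ c)) (by rwa [mk_mem_sym2_iff])]
      omega

/-- The first coordinates of `b - z` and `c - z` have the same strict sign. -/
theorem not_between_sub_zero {b c z : ℝ × ℝ} {R : ℝ} (hb : |b.1| ≤ R) (hc : |c.1| ≤ R)
    (hz : R < |z.1|) : ¬ Between (b - z) 0 (c - z) := by
  rw [abs_le] at hb hc
  unfold Between
  simp only [Prod.fst_sub, Prod.fst_zero]
  rintro (⟨h1, h2⟩ | ⟨h1, h2⟩) <;> replace h1 := (abs_nonneg _).trans h1 <;>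
      replace h2 := (abs_nonneg _).trans h2 <;> rw [lt_abs] at hz <;>
      rcases hz with hz | hz <;> linarith

/-- A vertex of degree three and its mirror image can be added to a placement unless its
neighbours are in special position. -/
theorem Realises.extend_three (he : e = 1 ∨ e = -1) (hσ : IsPointReflection σ) {v a b c : V}
    (hA : SymForest σ (insert v (insert (σ v) S)) A)
    (hB : SymForest σ (insert v (insert (σ v) S)) B) (hv : v ∉ S) (hvf : σ v ≠ v)
    (hS : ∀ x ∈ S, σ x ∈ S) (hva : ∀ x, s(v, x) ∈ A → x = a)
    (hvb : ∀ x, s(v, x) ∈ B → x = b ∨ x = c) {p : V → ℝ × ℝ}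
    (hp : Realises e σ S (A ∩ S.sym2) (B ∩ S.sym2) p)
    (hz : ∃ z, Hz z (p a) ∧ Vt z (p b) ∧ Vt z (p c)) :
    ∃ q, Realises e σ (insert v (insert (σ v) S)) A B q := by
  obtain ⟨z, hz, h1, h2⟩ := exists_generic (((isOpen_setOf_hz (p a)).inter
    (isOpen_setOf_vt (p b))).inter (isOpen_setOf_vt (p c)))
    (by obtain ⟨z, h1, h2, h3⟩ := hz; exact ⟨z, ⟨h1, h2⟩, h3⟩) (coords S p)
  obtain ⟨q, hq, -⟩ := hp.extend he hσ hA hB hv hvf hS (z := z)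
    (fun x _ h => (hva x h) ▸ hz.1.1)
    (fun x _ h => (hvb x h).elim (fun h => h ▸ hz.1.2) fun h => h ▸ hz.2) h1 h2
  exact ⟨q, hq⟩

end MaxNormPlane

/-! ### Reinserting a vertex of degree three: direct placements. -/

namespace MaxNormPlane
open Finset Filter Topology
variable {V : Type*} [DecidableEq V] {σ : V → V} {S T X Y : Finset V} {A B C : Finset (Sym2 V)}
  {e : ℝ}

/-- A vertex `v` with one neighbour `a` in `A` and two neighbours `b`, `c` in `B`, and its mirror
image, outside the set `S` of the other vertices. -/
structure IsThreeVertex (σ : V → V) (S : Finset V) (A B : Finset (Sym2 V)) (v a b c : V) :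
    Prop where
  notMem : v ∉ S
  not_fixed : σ v ≠ v
  inv : ∀ x ∈ S, σ x ∈ S
  memA : s(v, a) ∈ A
  memB : s(v, b) ∈ B
  memC : s(v, c) ∈ B
  nbrA : ∀ x, s(v, x) ∈ A → x = a
  nbrB : ∀ x, s(v, x) ∈ B → x = b ∨ x = c
  bc : b ≠ c
  forestA : SymForest σ (insert v (insert (σ v) S)) A
  forestB : SymForest σ (insert v (insert (σ v) S)) B
  disjoint : Disjoint A B

theorem SymForest.mem_of_adj {v : V} (hσ : IsPointReflection σ)
    (hC : SymForest σ (insert v (insert (σ v) S)) C) {x : V} (hx : s(v, x) ∈ C) : x ∈ S := by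
  have := hC.mem_right hx
  rw [mem_insert, mem_insert] at this
  rcases this with h | h | h
  · exact absurd h.symm (hC.ne hx)
  · exact absurd h (hC.ne_map hσ hx)
  · exact h

namespace IsThreeVertex

variable {v a b c : V}

theorem image_notMem (h : IsThreeVertex σ S A B v a b c) (hσ : IsPointReflection σ) :
    σ v ∉ S := fun h' => h.notMem (by simpa [hσ.invol] using h.inv _ h')

theorem subset (_h : IsThreeVertex σ S A B v a b c) : S ⊆ insert v (insert (σ v) S) :=
  (subset_insert _ _).trans (subset_insert _ _)

theorem memaS (h : IsThreeVertex σ S A B v a b c) (hσ : IsPointReflection σ) : a ∈ S :=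
  h.forestA.mem_of_adj hσ h.memA

theorem membS (h : IsThreeVertex σ S A B v a b c) (hσ : IsPointReflection σ) : b ∈ S :=
  h.forestB.mem_of_adj hσ h.memB

theorem memcS (h : IsThreeVertex σ S A B v a b c) (hσ : IsPointReflection σ) : c ∈ S :=
  h.forestB.mem_of_adj hσ h.memC

theorem ab (h : IsThreeVertex σ S A B v a b c) : a ≠ b := by
  rintro rfl
  exact disjoint_left.1 h.disjoint h.memA h.memB

theorem ac (h : IsThreeVertex σ S A B v a b c) : a ≠ c := by
  rintro rfl
  exact disjoint_left.1 h.disjoint h.memA h.memC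

theorem restrictA (h : IsThreeVertex σ S A B v a b c) : SymForest σ S (A ∩ S.sym2) :=
  h.forestA.restrict h.subset h.inv

theorem restrictB (h : IsThreeVertex σ S A B v a b c) : SymForest σ S (B ∩ S.sym2) :=
  h.forestB.restrict h.subset h.inv

theorem bridged (h : IsThreeVertex σ S A B v a b c) (hσ : IsPointReflection σ) :
    SymForest σ S (bridged σ S B b c) :=
  h.forestB.bridged hσ h.notMem h.not_fixed h.inv (h.membS hσ) (h.memcS hσ) h.bc h.memB h.memC

theorem card_lt (h : IsThreeVertex σ S A B v a b c) : #S < #(insert v (insert (σ v) S)) :=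
  card_lt_card (Finset.ssubset_iff_subset_ne.2 ⟨h.subset, fun h' =>
    h.notMem (h' ▸ mem_insert_self _ _)⟩)

theorem swap (h : IsThreeVertex σ S A B v a b c) : IsThreeVertex σ S A B v a c b :=
  { h with memB := h.memC, memC := h.memB, nbrB := fun x hx => (h.nbrB x hx).symm, bc := h.bc.symm }

theorem extend (h : IsThreeVertex σ S A B v a b c) (he : e = 1 ∨ e = -1)
    (hσ : IsPointReflection σ) {p : V → ℝ × ℝ}
    (hp : Realises e σ S (A ∩ S.sym2) (B ∩ S.sym2) p) (hbet : ¬ Between (p b) (p a) (p c)) :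
    ∃ q, Realises e σ (insert v (insert (σ v) S)) A B q := by
  refine hp.extend_three he hσ h.forestA h.forestB h.notMem h.not_fixed h.inv h.nbrA h.nbrB ?_
  obtain ⟨z, h1, h2, h3, -⟩ := exists_hz_vt_vt
    (fun h' => h.ab (hp.injOn _ (h.memaS hσ) _ (h.membS hσ) h'))
    (fun h' => h.ac (hp.injOn _ (h.memaS hσ) _ (h.memcS hσ) h')) hbet ∅
  exact ⟨z, h1, h2, h3⟩

/-- With `bc` absent from `A`, the bridged forest is disjoint from `A`. Its realisation has `bc`
vertical, and the box spanned by such `b` and `c` is empty. -/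
theorem exists_realises_of_notMem (h : IsThreeVertex σ S A B v a b c) (he : e = 1 ∨ e = -1)
    (hσ : IsPointReflection σ) (ih : RealisableBelow σ #(insert v (insert (σ v) S)))
    (hbc : s(b, c) ∉ A) : ∃ q, Realises e σ (insert v (insert (σ v) S)) A B q := by
  have hd : Disjoint (A ∩ S.sym2) (MaxNormPlane.bridged σ S B b c) := by
    rw [disjoint_left]
    intro f hf hf'
    rw [MaxNormPlane.bridged, mem_insert, mem_insert] at hf'
    rcases hf' with rfl | rfl | hf'
    · exact hbc (mem_inter.1 hf).1
    · have := h.forestA.map_mem (mem_inter.1 hf).1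
      rw [hσ.invol, hσ.invol] at this
      exact hbc this
    · exact disjoint_left.1 h.disjoint (mem_inter.1 hf).1 (mem_inter.1 hf').1
  obtain ⟨p, hp⟩ := ih e _ _ _ he h.restrictA (h.bridged hσ) hd h.card_lt
  refine h.extend he hσ (p := p) ⟨hp.injOn, hp.equivariant, hp.hz, fun x y hxy =>
    hp.vt x y (mem_insert_of_mem (mem_insert_of_mem hxy))⟩ (Vt.not_between (hp.vt _ _ ?_))
  exact mem_insert_self _ _

/-- The case in which one of `b` and `c` is fixed and `a` is the mirror image of the other. -/
theorem exists_realises_of_fixed (h : IsThreeVertex σ S A B v a b c) (he : e = 1 ∨ e = -1)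
    (hσ : IsPointReflection σ) (ih : RealisableBelow σ #(insert v (insert (σ v) S)))
    (hb : σ b = b) (ha : a = σ c) :
    ∃ q, Realises e σ (insert v (insert (σ v) S)) A B q := by
  obtain ⟨p, hp⟩ := ih e _ _ _ he h.restrictA h.restrictB
    (h.disjoint.mono inter_subset_left inter_subset_left) h.card_lt
  have hm := hp.equivariant _ (h.memcS hσ)
  have hac : p a ≠ p c := fun h' => h.ac (hp.injOn _ (h.memaS hσ) _ (h.memcS hσ) h')
  rw [ha] at hac
  refine h.extend he hσ hp ?_
  rw [ha, hm]
  refine not_between_mir he ?_ (hm ▸ hac)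
  rw [← hp.equivariant _ (h.membS hσ), hb]

/-- The case in which `S` is a disjoint block and its mirror image with a fixed vertex. -/
theorem exists_realises_of_insert_fixed {r x₁ x₂ : V}
    (h : IsThreeVertex σ (insert r (hull σ Y)) A B v a b c)
    (he : e = 1 ∨ e = -1) (hσ : IsPointReflection σ)
    (ih : RealisableBelow σ #(insert v (insert (σ v) (insert r (hull σ Y)))))
    (hAY : Full (A ∩ (insert r (hull σ Y)).sym2) Y)
    (hBY : Full (MaxNormPlane.bridged σ (insert r (hull σ Y)) B b c) Y)
    (hbY : b ∈ Y) (hcY : c ∈ Y) (hd : Disjoint Y (Y.image σ)) (hr : σ r = r)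
    (hx₁ : x₁ ∈ Y) (hx₂ : x₂ ∈ Y) (h₁ : s(r, x₁) ∈ A) (h₂ : s(r, x₂) ∈ B)
    (ha : a = r ∨ σ a ∈ Y) :
    ∃ q, Realises e σ (insert v (insert (σ v) (insert r (hull σ Y)))) A B q := by
  set S := insert r (hull σ Y) with hS
  have hhS : hull σ Y ⊆ S := subset_insert _ _
  have hYh : Y ⊆ hull σ Y := subset_union_left
  have hYS : Y ⊆ S := hYh.trans hhS
  have hrY : r ∉ Y := fun h' => disjoint_left.1 hd h' (hσ.mem_image.2 (by rwa [hr]))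
  have hA0 := h.restrictA
  have hB0 := h.restrictB
  have h₁' : s(r, x₁) ∈ A ∩ S.sym2 :=
    mem_inter.2 ⟨h₁, mk_mem_sym2_iff.2 ⟨mem_insert_self _ _, hYS hx₁⟩⟩
  have h₂' : s(r, x₂) ∈ B ∩ S.sym2 :=
    mem_inter.2 ⟨h₂, mk_mem_sym2_iff.2 ⟨mem_insert_self _ _, hYS hx₂⟩⟩
  have hBle : B ∩ S.sym2 ⊆ MaxNormPlane.bridged σ S B b c :=
    (subset_insert _ _).trans (subset_insert _ _)
  have hx : x₁ ≠ x₂ := by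
    rintro rfl
    exact disjoint_left.1 h.disjoint h₁ h₂
  obtain ⟨p, hp⟩ := ih e _ _ _ he (hA0.restrict hhS (hull_inv hσ))
    (hB0.restrict hhS (hull_inv hσ)) ((h.disjoint.mono inter_subset_left inter_subset_left).mono
      inter_subset_left inter_subset_left) ((card_le_card hhS).trans_lt h.card_lt)
  obtain ⟨R, hR⟩ : ∃ R, ∀ x ∈ Y, |(p x).1| ≤ R ∧ |(p x).2| ≤ R := by
    refine ⟨∑ x ∈ Y, (|(p x).1| + |(p x).2|), fun x hx => ?_⟩
    have := single_le_sum (f := fun x => |(p x).1| + |(p x).2|) (fun _ _ => by positivity) hx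
    have h1 := abs_nonneg (p x).1
    have h2 := abs_nonneg (p x).2
    constructor <;> linarith
  have hR0 : 0 ≤ R := (abs_nonneg _).trans (hR b hbY).1
  -- The fixed vertex goes to the origin and `Y` is moved by `-z`. The bound `2 * R` keeps `a`,
  -- whether it is `r` or lies in the mirror image of `Y`, out of the box of `b` and `c`.
  obtain ⟨z, hz, hz', hz1, hz2, hz3, hz4⟩ := exists_hz_vt_far
    (fun h' => hx (hp.injOn _ (hYh hx₁) _ (hYh hx₂) h')) (midpoints Y p) (2 * R)
  obtain ⟨q, hq, hqp, hqr⟩ := Realises.translate he hσ hA0 hB0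
    (fun _ hx _ hy => hA0.not_cross hσ hYS hAY hd hx hy)
    (fun _ hx _ hy h' => (h.bridged hσ).not_cross hσ hYS hBY hd hx hy (hBle h')) hd hr hp
    (fun x hx h' => (hA0.nbr_unique hYS hAY hrY hx hx₁ h' h₁') ▸ hz)
    (fun x hx h' => ((h.bridged hσ).nbr_unique hYS hBY hrY hx hx₂ (hBle h') (hBle h₂')) ▸ hz')
    hz3 hz4
  refine h.extend he hσ hq ?_
  rw [hqp b hbY, hqp c hcY]
  rcases ha with rfl | ha
  · rw [hqr]
    exact not_between_sub_zero (hR b hbY).1 (hR c hcY).1 (by linarith)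
  · have h3 := hq.equivariant _ (hYS ha)
    rw [hσ.invol, hqp _ ha] at h3
    rw [h3]
    exact not_between_sub_mir he (hR _ ha) (hR b hbY) (hR c hcY) ⟨hz1, hz2⟩

/-- The case in which `S` consists of a block, its mirror image, `a` and `σ a`. -/
theorem exists_realises_of_insert_nbr {x₁ x₂ : V}
    (h : IsThreeVertex σ (insert a (insert (σ a) (hull σ Y))) A B v a b c)
    (he : e = 1 ∨ e = -1) (hσ : IsPointReflection σ)
    (ih : RealisableBelow σ #(insert v (insert (σ v) (insert a (insert (σ a) (hull σ Y))))))
    (hAY : Full (A ∩ (insert a (insert (σ a) (hull σ Y))).sym2) Y)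
    (hBY : Full (MaxNormPlane.bridged σ (insert a (insert (σ a) (hull σ Y))) B b c) Y)
    (hbY : b ∈ Y) (hcY : c ∈ Y) (hb : IsBlock σ Y) (haf : σ a ≠ a) (haY : a ∉ Y) (haY' : σ a ∉ Y)
    (hx₁ : x₁ ∈ Y) (hx₂ : x₂ ∈ Y) (h₁ : s(a, x₁) ∈ A) (h₂ : s(a, x₂) ∈ B) :
    ∃ q, Realises e σ (insert v (insert (σ v) (insert a (insert (σ a) (hull σ Y))))) A B q := by
  set S := insert a (insert (σ a) (hull σ Y)) with hS
  have hhS : hull σ Y ⊆ S := (subset_insert _ _).trans (subset_insert _ _)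
  have hYS : Y ⊆ S := subset_union_left.trans hhS
  have hah : a ∉ hull σ Y := fun h => ((mem_hull hσ).1 h).elim haY haY'
  have hA0 := h.restrictA
  have hB0 := h.restrictB
  have h₁' : s(a, x₁) ∈ A ∩ S.sym2 :=
    mem_inter.2 ⟨h₁, mk_mem_sym2_iff.2 ⟨mem_insert_self _ _, hYS hx₁⟩⟩
  have h₂' : s(a, x₂) ∈ B ∩ S.sym2 :=
    mem_inter.2 ⟨h₂, mk_mem_sym2_iff.2 ⟨mem_insert_self _ _, hYS hx₂⟩⟩
  have hBle : B ∩ S.sym2 ⊆ MaxNormPlane.bridged σ S B b c :=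
    (subset_insert _ _).trans (subset_insert _ _)
  have hx : x₁ ≠ x₂ := by
    rintro rfl
    exact disjoint_left.1 h.disjoint h₁ h₂
  obtain ⟨p, hp⟩ := ih e _ _ _ he (hA0.restrict hhS (hull_inv hσ))
    (hB0.restrict hhS (hull_inv hσ)) ((h.disjoint.mono inter_subset_left inter_subset_left).mono
      inter_subset_left inter_subset_left) ((card_le_card hhS).trans_lt h.card_lt)
  have hYh : Y ⊆ hull σ Y := subset_union_left
  -- Here `a` is itself the added vertex, placed so far out that it cannot lie between `b` and `c`.
  obtain ⟨z, hz, hz', hz1, -, hz3, hz4⟩ := exists_hz_vt_far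
    (fun h' => hx (hp.injOn _ (hYh hx₁) _ (hYh hx₂) h')) (coords (hull σ Y) p)
    (max |(p b).1| |(p c).1|)
  rw [max_lt_iff] at hz1
  obtain ⟨q, hq, hqp, hqa⟩ := Realises.extend he hσ hA0 hB0 hah haf (hull_inv hσ) hp
    (fun x hx h' => (hb.nbr_unique hσ hA0 hYS hAY haY haY' haf hx₁ h₁' hx h') ▸ hz)
    (fun x hx h' => (hb.nbr_unique hσ (h.bridged hσ) hYS hBY haY haY' haf hx₂ (hBle h₂') hx
      (hBle h')) ▸ hz') hz3 hz4
  refine h.extend he hσ hq ?_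
  rw [hqa, hqp b (hYh hbY), hqp c (hYh hcY)]
  exact not_between_of_lt_abs hz1.1 hz1.2

end IsThreeVertex

end MaxNormPlane

/-! ### Reinserting a vertex of degree three when its two neighbours in `B` are adjacent in `A`. -/

namespace MaxNormPlane
open Finset Filter Topology
variable {V : Type*} [DecidableEq V] {σ : V → V} {S T X Y : Finset V} {A B C : Finset (Sym2 V)}
  {e : ℝ}

theorem hull_eq_of_inv (hσ : IsPointReflection σ) (h : ∀ x ∈ X, σ x ∈ X) : hull σ X = X := by
  ext x
  rw [mem_hull hσ]
  exact ⟨fun hx => hx.elim id fun hx => by simpa [hσ.invol] using h _ hx, Or.inl⟩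

theorem eq_of_insert_insert_eq {v w : V} (hX : X ⊆ S) (hv : v ∉ S) (hw : w ∉ S)
    (h : insert v (insert w X) = insert v (insert w S)) : X = S := by
  refine hX.antisymm fun x hx => ?_
  have : x ∈ insert v (insert w X) := h ▸ mem_insert_of_mem (mem_insert_of_mem hx)
  rw [mem_insert, mem_insert] at this
  rcases this with rfl | rfl | h
  · exact absurd hx hv
  · exact absurd hx hw
  · exact h

theorem mem_bridged_of_mem {b c : V} {f : Sym2 V} (h : f ∈ B ∩ S.sym2) :
    f ∈ bridged σ S B b c :=
  mem_insert_of_mem (mem_insert_of_mem h)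

theorem two_le_card {W : Type*} {X : Finset W} {b c : W} (hb : b ∈ X) (hc : c ∈ X) (hbc : b ≠ c) :
    2 ≤ #X :=
  one_lt_card.2 ⟨b, hb, c, hc, hbc⟩

namespace IsThreeVertex

variable {v a b c : V}

/-- The fixed vertex `r` glues `Y` to its mirror image in both forests. Adding `v` and `σ v`, as
leaves at `a` and `σ a` in `A` and as subdivisions of the bridges in `B`, gives a common full set.
It is either proper, and can be contracted, or everything, and is placed directly. -/
theorem exists_realises_of_fixed_parallel {r x₁ x₂ : V} (h : IsThreeVertex σ S A B v a b c)
    (he : e = 1 ∨ e = -1) (hσ : IsPointReflection σ)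
    (ih : RealisableBelow σ #(insert v (insert (σ v) S))) (hYS : Y ⊆ S)
    (hAY : Full (A ∩ S.sym2) Y) (hBY : Full (MaxNormPlane.bridged σ S B b c) Y)
    (hbY : b ∈ Y) (hcY : c ∈ Y) (hd : Disjoint Y (Y.image σ)) (hr : σ r = r) (hrS : r ∈ S)
    (hx₁ : x₁ ∈ Y) (hx₂ : x₂ ∈ Y) (h₁ : s(r, x₁) ∈ A ∩ S.sym2) (h₂ : s(r, x₂) ∈ B ∩ S.sym2)
    (ha : a = r ∨ σ a ∈ Y) :
    ∃ q, Realises e σ (insert v (insert (σ v) S)) A B q := by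
  have hrY : r ∉ Y := fun h' => disjoint_left.1 hd h' (hσ.mem_image.2 (by rwa [hr]))
  have hWS : hull σ (insert r Y) ⊆ S :=
    hull_subset hσ h.restrictA (insert_subset hrS hYS)
  have hrT : insert r Y ⊆ insert v (insert (σ v) S) := (insert_subset hrS hYS).trans h.subset
  have hrimg : ∀ X : Finset V, r ∈ X → (X ∩ X.image σ).Nonempty := fun X hX =>
    ⟨r, mem_inter.2 ⟨hX, hσ.mem_image.2 (by rwa [hr])⟩⟩
  have hvW : v ∉ hull σ (insert r Y) := fun h' => h.notMem (hWS h')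
  have hvW' : σ v ∉ hull σ (insert r Y) := fun h' => h.image_notMem hσ (hWS h')
  have haW : a ∈ hull σ (insert r Y) := by
    rw [mem_hull hσ, mem_insert, mem_insert]
    tauto
  have hA1 : Full A (insert r Y) :=
    (hAY.insert hrY hx₁ h₁).mono inter_subset_left
  have hA2 : Full A (hull σ (insert r Y)) :=
    h.forestA.full_union hrT hA1 (h.forestA.full_image hσ hA1) (hrimg _ (mem_insert_self _ _))
  have hA3 : Full A (insert v (insert (σ v) (hull σ (insert r Y)))) :=
    (hA2.insert hvW' (hull_inv hσ _ haW) (h.forestA.map_mem h.memA)).insert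
      (fun h' => (mem_insert.1 h').elim (fun h' => h.not_fixed h'.symm) hvW)
      (mem_insert_of_mem haW) h.memA
  have hB1 : Full (insert s(b, c) (B ∩ S.sym2)) (insert r Y) := by
    have hB0 := hBY.insert hrY hx₂ (mem_bridged_of_mem h₂)
    unfold MaxNormPlane.bridged at hB0
    rw [Finset.insert_comm] at hB0
    refine full_of_insert (fun h' => ?_) hB0
    rcases mem_insert.1 (mk_mem_sym2_iff.1 h').1 with h' | h'
    · exact hrY (by rw [← hr, ← h', hσ.invol]; exact hbY)
    · exact disjoint_left.1 hd hbY (hσ.mem_image.2 h')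
  have hB2 : Full B (insert v (insert r Y)) :=
    hB1.subdivide (fun h' => hvW (subset_union_left h')) (mem_insert_of_mem hbY)
      (mem_insert_of_mem hcY) h.bc inter_subset_left h.memB h.memC
  have hB3 : Full B (hull σ (insert v (insert r Y))) :=
    h.forestB.full_union (insert_subset (mem_insert_self _ _) hrT) hB2
      (h.forestB.full_image hσ hB2) (hrimg _ (by simp))
  rw [hull_insert hσ] at hB3
  by_cases hS : insert v (insert (σ v) (hull σ (insert r Y))) = insert v (insert (σ v) S)
  · have hS' := eq_of_insert_insert_eq hWS h.notMem (h.image_notMem hσ) hS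
    rw [hull_insert hσ, hr, insert_eq_of_mem (mem_insert_self _ _)] at hS'
    subst hS'
    exact h.exists_realises_of_insert_fixed he hσ ih hAY hBY hbY hcY hd hr hx₁ hx₂
      (mem_inter.1 h₁).1 (mem_inter.1 h₂).1 ha
  · refine exists_realises_of_full hσ he ih h.forestA h.forestB h.disjoint
      (insert_subset_insert _ (insert_subset_insert _ hWS)) hA3 hB3 ?_ ?_
    · exact two_le_card (mem_insert_self v _) (mem_insert_of_mem (mem_insert_self _ _))
        h.not_fixed.symm
    · rw [← hull_insert hσ, hull_eq_of_inv hσ (hull_inv hσ), hull_insert hσ]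
      exact hS

/-- Here `a` is the vertex joined to `Y` in both forests. `Y` with `a` and `v` (and with `σ a`, `σ
v` if `Y` is invariant) is full in `A` and `B`, and again it either generates a proper part or
everything. -/
theorem exists_realises_of_nbr_parallel {x₁ x₂ : V} (h : IsThreeVertex σ S A B v a b c)
    (he : e = 1 ∨ e = -1) (hσ : IsPointReflection σ)
    (ih : RealisableBelow σ #(insert v (insert (σ v) S))) (hYS : Y ⊆ S)
    (hAY : Full (A ∩ S.sym2) Y) (hBY : Full (MaxNormPlane.bridged σ S B b c) Y)
    (hbY : b ∈ Y) (hcY : c ∈ Y) (hb : IsBlock σ Y) (haf : σ a ≠ a) (haY : a ∉ Y) (haY' : σ a ∉ Y)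
    (hx₁ : x₁ ∈ Y) (hx₂ : x₂ ∈ Y) (h₁ : s(a, x₁) ∈ A ∩ S.sym2) (h₂ : s(a, x₂) ∈ B ∩ S.sym2) :
    ∃ q, Realises e σ (insert v (insert (σ v) S)) A B q := by
  have haS := h.memaS hσ
  have hWS : insert a (insert (σ a) (hull σ Y)) ⊆ S :=
    insert_subset haS (insert_subset (h.inv a haS) (hull_subset hσ h.restrictA hYS))
  have hvS := h.notMem
  have hvS' := h.image_notMem hσ
  obtain ⟨Z, hZT, hAZ, hBZ, hvZ, haZ, hZ⟩ : ∃ Z, Z ⊆ insert v (insert (σ v) S) ∧ Full A Z ∧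
      Full B Z ∧ v ∈ Z ∧ a ∈ Z ∧
      hull σ Z = insert v (insert (σ v) (insert a (insert (σ a) (hull σ Y)))) := by
    rcases hb with hd | hinv
    · have hvaY : v ∉ insert a Y := fun h' => hvS (insert_subset haS hYS h')
      refine ⟨insert v (insert a Y), insert_subset (mem_insert_self _ _)
        ((insert_subset haS hYS).trans h.subset), ?_, ?_, mem_insert_self _ _,
        mem_insert_of_mem (mem_insert_self _ _), by rw [hull_insert hσ, hull_insert hσ]⟩
      · exact ((hAY.insert haY hx₁ h₁).mono inter_subset_left).insert hvaY (mem_insert_self _ _)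
          h.memA
      -- The mirror bridge is not inside `Y`, so only the bridge `bc` has to be subdivided by `v`.
      · unfold MaxNormPlane.bridged at hBY
        rw [Finset.insert_comm] at hBY
        have hB1 := full_of_insert (fun h' => disjoint_left.1 hd hbY
          (hσ.mem_image.2 (mk_mem_sym2_iff.1 h').1)) hBY
        exact (hB1.insert haY hx₂ (mem_insert_of_mem h₂)).subdivide hvaY (mem_insert_of_mem hbY)
          (mem_insert_of_mem hcY) h.bc inter_subset_left h.memB h.memC
    · have hY : hull σ Y = Y := hull_eq_of_inv hσ hinv
      rw [hY] at hWS ⊢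
      set W := insert a (insert (σ a) Y) with hW
      have hYW : Y ⊆ W := (subset_insert _ _).trans (subset_insert _ _)
      have hWinv : ∀ x ∈ W, σ x ∈ W := by
        have := hull_inv (X := insert a Y) hσ
        rwa [hull_insert hσ, hY, ← hW] at this
      have hvW' : σ v ∉ W := fun h' => hvS' (hWS h')
      have hvW : v ∉ insert (σ v) W := fun h' =>
        (mem_insert.1 h').elim (fun h' => h.not_fixed h'.symm) fun h' => hvS (hWS h')
      have haY2 : a ∉ insert (σ a) Y := fun h' =>
        (mem_insert.1 h').elim (fun h' => haf h'.symm) haY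
      have full_W : ∀ (C : Finset (Sym2 V)) (x : V), SymForest σ S C → Full C Y → x ∈ Y →
          s(a, x) ∈ C → Full C W := fun C x hC hCY hx hax =>
        (hCY.insert haY' (hinv x hx) (hC.map_mem hax)).insert haY2 (mem_insert_of_mem hx) hax
      refine ⟨insert v (insert (σ v) W), insert_subset_insert _ (insert_subset_insert _ hWS),
        ?_, ?_, mem_insert_self _ _,
        mem_insert_of_mem (mem_insert_of_mem (mem_insert_self _ _)), ?_⟩
      · exact (((full_W _ _ h.restrictA hAY hx₁ h₁).mono inter_subset_left).insert hvW'
          (hWinv a (mem_insert_self _ _)) (h.forestA.map_mem h.memA)).insert hvW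
          (mem_insert_of_mem (mem_insert_self _ _)) h.memA
      · have hB1 := full_W _ _ (h.bridged hσ) hBY hx₂ (mem_bridged_of_mem h₂)
        unfold MaxNormPlane.bridged at hB1
        rw [Finset.insert_comm] at hB1
        -- Both bridges lie in the invariant block; they are subdivided one after the other, by `σ
        -- v` and by `v`.
        have hB2 := hB1.subdivide (A := insert s(b, c) B) hvW' (hYW (hinv b hbY))
          (hYW (hinv c hcY)) (fun h' => h.bc (hσ.injective h'))
          (insert_subset_insert _ inter_subset_left)
          (mem_insert_of_mem (h.forestB.map_mem h.memB))
          (mem_insert_of_mem (h.forestB.map_mem h.memC))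
        exact hB2.subdivide hvW (mem_insert_of_mem (hYW hbY)) (mem_insert_of_mem (hYW hcY)) h.bc
          subset_rfl h.memB h.memC
      · rw [← hull_eq_of_inv hσ hWinv, ← hull_insert hσ, hull_eq_of_inv hσ (hull_inv hσ)]
  by_cases hS : insert v (insert (σ v) (insert a (insert (σ a) (hull σ Y)))) =
      insert v (insert (σ v) S)
  · have hS' := eq_of_insert_insert_eq hWS hvS hvS' hS
    subst hS'
    exact h.exists_realises_of_insert_nbr he hσ ih hAY hBY hbY hcY hb haf haY haY' hx₁ hx₂
      (mem_inter.1 h₁).1 (mem_inter.1 h₂).1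
  · exact exists_realises_of_full hσ he ih h.forestA h.forestB h.disjoint hZT hAZ hBZ
      (two_le_card hvZ haZ fun h' => hvS (h' ▸ haS)) (hZ ▸ hS)

/-- Now `bc` lies in both `A` and the bridged forest, so `b` and `c` must be collapsed before
induction applies. The sets that may be collapsed avoid `a`, since `v` can be placed only if `a`
stays away from the limit of `b` and `c`. -/
theorem exists_realises_of_mem (h : IsThreeVertex σ S A B v a b c) (he : e = 1 ∨ e = -1)
    (hσ : IsPointReflection σ) (ih : RealisableBelow σ #(insert v (insert (σ v) S)))
    (hbc : s(b, c) ∈ A) : ∃ q, Realises e σ (insert v (insert (σ v) S)) A B q := by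
  classical
  have haS := h.memaS hσ
  have hbS := h.membS hσ
  have hcS := h.memcS hσ
  have hbc0 : s(b, c) ∈ A ∩ S.sym2 := mem_inter.2 ⟨hbc, mk_mem_sym2_iff.2 ⟨hbS, hcS⟩⟩
  have hF := h.bridged hσ
  have hbcB : s(b, c) ∈ MaxNormPlane.bridged σ S B b c := mem_insert_self _ _
  set cand := S.powerset.filter fun Y => Full (A ∩ S.sym2) Y ∧
    Full (MaxNormPlane.bridged σ S B b c) Y ∧ IsBlock σ Y ∧ b ∈ Y ∧ c ∈ Y ∧ a ∉ Y with hcand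
  by_cases hne : cand.Nonempty
  swap
  · rw [not_nonempty_iff_eq_empty] at hne
    have hno : ∀ Y ⊆ S, Full (A ∩ S.sym2) Y → Full (MaxNormPlane.bridged σ S B b c) Y →
        IsBlock σ Y → b ∈ Y → c ∈ Y → a ∈ Y := by
      intro Y h1 h2 h3 h4 h5 h6
      by_contra h7
      have : Y ∈ cand := mem_filter.2 ⟨mem_powerset.2 h1, h2, h3, h4, h5, h6, h7⟩
      rw [hne] at this
      exact notMem_empty _ this
    have hbcS : ({b, c} : Finset V) ⊆ S := insert_subset hbS (singleton_subset_iff.2 hcS)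
    have hpair : ∀ C : Finset (Sym2 V), s(b, c) ∈ C → Full C {b, c} := fun C hC =>
      (full_singleton C c).insert (fun h' => h.bc (mem_singleton.1 h')) (mem_singleton_self c) hC
    -- Without a candidate, the block generated by `b` and `c` contains `a`, so `a` is `σ b` or `σ
    -- c`. The set `{b, c}` must also meet its mirror image, and as `bc` is not a fixed edge, `b` or
    -- `c` is fixed.
    obtain ⟨Y, h1, h2, h3, h4, h5, h6⟩ := exists_block hσ h.restrictA hF hbcS
      (hpair _ hbc0) (hpair _ hbcB)
    have h7 := hno Y h2 h3 h4 h5 (h1 (by simp)) (h1 (by simp))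
    have h8 : a ∈ hull σ {b, c} := h6 ▸ subset_union_left h7
    rw [mem_hull hσ] at h8
    simp only [mem_insert, mem_singleton, h.ab, h.ac, false_or] at h8
    have h9 : ¬ Disjoint ({b, c} : Finset V) (({b, c} : Finset V).image σ) := fun hd => by
      have := hno _ hbcS (hpair _ hbc0) (hpair _ hbcB) (Or.inl hd) (by simp) (by simp)
      simp [h.ab, h.ac] at this
    have h10 : σ b = b ∨ σ c = c := by
      by_contra! h'
      have hcb : σ b ≠ c := fun h' => h.forestA.ne_map hσ hbc h'.symm
      have hcb' : σ c ≠ b := fun h' => hcb (by rw [← h', hσ.invol])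
      refine h9 (disjoint_left.2 fun x hx hx' => ?_)
      rw [hσ.mem_image] at hx'
      simp only [mem_insert, mem_singleton] at hx hx'
      rcases hx with rfl | rfl <;> tauto
    have hab : ∀ x, σ a = x → a = σ x := fun x hx => by rw [← hx, hσ.invol]
    rcases h10 with h10 | h10
    · refine h.exists_realises_of_fixed he hσ ih h10 (h8.elim (fun h8 => ?_) (hab c))
      exact absurd ((hab b h8).trans h10) h.ab
    · refine h.swap.exists_realises_of_fixed he hσ ih h10 (h8.elim (hab b) fun h8 => ?_)
      exact absurd ((hab c h8).trans h10) h.ac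
  obtain ⟨Y, hY, hmax⟩ := exists_max_image cand card hne
  obtain ⟨hYS, hAY, hBY, hb, hbY, hcY, haY⟩ := mem_filter.1 hY
  rw [mem_powerset] at hYS
  have hYh : Y ⊆ hull σ Y := subset_union_left
  by_cases hpar : ∀ y ∈ S, y ∉ Y → σ y ∉ Y → ∀ x ∈ Y, ∀ x' ∈ Y, s(y, x) ∈ A ∩ S.sym2 →
      s(y, x') ∉ MaxNormPlane.bridged σ S B b c
  · obtain ⟨Q, p, hlim, hp, hQ, hQ'⟩ := exists_contraction hσ he ih h.restrictA h.restrictB hF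
      (fun f hf => mem_bridged_of_mem hf) (h.disjoint.mono inter_subset_left inter_subset_left)
      (fun x y hxy hxy' => by
        rw [MaxNormPlane.bridged, mem_insert, mem_insert, or_iff_left hxy', Sym2.eq_iff,
          Sym2.eq_iff] at hxy
        rcases hxy with (⟨rfl, rfl⟩ | ⟨rfl, rfl⟩) | (⟨rfl, rfl⟩ | ⟨rfl, rfl⟩)
        · exact Or.inl ⟨hbY, hcY⟩
        · exact Or.inl ⟨hcY, hbY⟩
        · right; rw [hσ.invol, hσ.invol]; exact ⟨hbY, hcY⟩
        · right; rw [hσ.invol, hσ.invol]; exact ⟨hcY, hbY⟩)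
      hYS hAY hBY (two_le_card hbY hcY h.bc) hb h.card_lt.le
      ((card_le_card (hull_subset hσ hF hYS)).trans_lt h.card_lt) hpar
    -- In the limit `b` and `c` coincide and differ from `a`, so a position for `v` relative to two
    -- points suffices. It remains good for small `d` because the relations are open.
    obtain ⟨z, hz, hz', -⟩ := exists_hz_vt_far (hQ' b hbY a haS haY).symm ∅ 0
    have l1 := (tendsto_const_nhds (x := z)).prodMk_nhds (hlim a)
    have l2 := (tendsto_const_nhds (x := z)).prodMk_nhds (hlim b)
    have l3 := (tendsto_const_nhds (x := z)).prodMk_nhds (hlim c)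
    have hz'' : Vt z (Q c) := hQ b hbY c hcY ▸ hz'
    obtain ⟨d, hd, h1, h2, h3⟩ := (hp.and ((l1.eventually (isOpen_hz.mem_nhds hz)).and
      ((l2.eventually (isOpen_vt.mem_nhds hz')).and
        (l3.eventually (isOpen_vt.mem_nhds hz''))))).exists
    exact hd.extend_three he hσ h.forestA h.forestB h.notMem h.not_fixed h.inv h.nbrA h.nbrB
      ⟨z, h1, h2, h3⟩
  push Not at hpar
  obtain ⟨y, hyS, hyY, hyY', x₁, hx₁, x₂, hx₂, h₁, h₂⟩ := hpar
  -- Neither bridge has `y` as an end, since the ends lie in `Y` or its mirror image.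
  have h₂' : s(y, x₂) ∈ B ∩ S.sym2 := by
    rw [MaxNormPlane.bridged, mem_insert, mem_insert] at h₂
    rcases h₂ with h₂ | h₂ | h₂
    · rcases Sym2.eq_iff.1 h₂ with h₂ | h₂
      · exact absurd (h₂.1 ▸ hbY) hyY
      · exact absurd (h₂.1 ▸ hcY) hyY
    · rcases Sym2.eq_iff.1 h₂ with h₂ | h₂
      · exact absurd (by rw [h₂.1, hσ.invol]; exact hbY) hyY'
      · exact absurd (by rw [h₂.1, hσ.invol]; exact hcY) hyY'
    · exact h₂
  have hAy := hAY.insert hyY hx₁ h₁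
  have hBy := hBY.insert hyY hx₂ h₂
  obtain ⟨Z, hZ1, hZ2, hZ3, hZ4, hZ5, hZ6⟩ := exists_block hσ h.restrictA hF
    (insert_subset hyS hYS) hAy hBy
  -- By maximality of `Y`, any larger block contains `a`. This ties the obstructing vertex `y` to
  -- `a`.
  have hmem : ∀ Z ⊆ S, Full (A ∩ S.sym2) Z → Full (MaxNormPlane.bridged σ S B b c) Z →
      IsBlock σ Z → insert y Y ⊆ Z → a ∈ Z := by
    intro Z h1 h2 h3 h4 h5
    by_contra h6
    have h7 := hmax Z (mem_filter.2 ⟨mem_powerset.2 h1, h2, h3, h4,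
      h5 (mem_insert_of_mem hbY), h5 (mem_insert_of_mem hcY), h6⟩)
    have h8 := card_le_card h5
    rw [card_insert_of_notMem hyY] at h8
    omega
  have haZ : a ∈ insert y (insert (σ y) (hull σ Y)) := by
    rw [← hull_insert hσ, ← hZ6]
    exact subset_union_left (hmem Z hZ2 hZ3 hZ4 hZ5 hZ1)
  by_cases hyf : σ y = y
  · have hd := hb.disjoint_of_fixed hσ h.restrictA hYS hAY ⟨b, hbY⟩ hyf hyY
    refine h.exists_realises_of_fixed_parallel he hσ ih hYS hAY hBY hbY hcY hd hyf hyS hx₁ hx₂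
      h₁ h₂' ?_
    rw [mem_insert, mem_insert, mem_hull hσ, hyf] at haZ
    tauto
  · have hay : a = y ∨ (a = σ y ∧ ∀ x ∈ Y, σ x ∈ Y) := by
      rcases hb with hd | hinv
      · have := hmem (insert y Y) (insert_subset hyS hYS) hAy hBy
          (Or.inl (isBlock_insert hσ hd hyf hyY')) subset_rfl
        exact Or.inl ((mem_insert.1 this).resolve_right haY)
      · rw [mem_insert, mem_insert, hull_eq_of_inv hσ hinv] at haZ
        tauto
    rcases hay with rfl | ⟨rfl, hinv⟩
    · exact h.exists_realises_of_nbr_parallel he hσ ih hYS hAY hBY hbY hcY hb hyf hyY hyY' hx₁ hx₂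
        h₁ h₂'
    · exact h.exists_realises_of_nbr_parallel he hσ ih hYS hAY hBY hbY hcY hb
        (fun h' => hyf (hσ.injective h')) hyY' (by rwa [hσ.invol]) (hinv _ hx₁) (hinv _ hx₂)
        (h.restrictA.map_mem h₁) (h.restrictB.map_mem h₂')

end IsThreeVertex

end MaxNormPlane

/-! ### The induction. -/

namespace MaxNormPlane
open Finset Filter Topology
variable {V : Type*} [DecidableEq V] {σ : V → V} {S T X Y : Finset V} {A B C : Finset (Sym2 V)}
  {e : ℝ}

theorem exists_nbr_of_card_eq_one {v : V} (h : #(A.filter (v ∈ ·)) = 1) :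
    ∃ a, s(v, a) ∈ A ∧ ∀ x, s(v, x) ∈ A → x = a := by
  obtain ⟨f, hf⟩ := card_eq_one.1 h
  obtain ⟨hfA, hvf⟩ := mem_filter.1 (hf ▸ mem_singleton_self f)
  obtain ⟨a, rfl⟩ := Sym2.mem_iff_exists.1 hvf
  refine ⟨a, hfA, fun x hx => ?_⟩
  have : s(v, x) ∈ A.filter (v ∈ ·) := mem_filter.2 ⟨hx, Sym2.mem_mk_left _ _⟩
  rwa [hf, mem_singleton, Sym2.congr_right] at this

theorem exists_nbr_of_card_eq_two {v : V} (h : #(A.filter (v ∈ ·)) = 2) :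
    ∃ a b, a ≠ b ∧ s(v, a) ∈ A ∧ s(v, b) ∈ A ∧ ∀ x, s(v, x) ∈ A → x = a ∨ x = b := by
  obtain ⟨f, g, hfg, hf⟩ := card_eq_two.1 h
  obtain ⟨hfA, hvf⟩ := mem_filter.1 (hf ▸ mem_insert_self f {g})
  obtain ⟨hgA, hvg⟩ := mem_filter.1 (hf ▸ mem_insert_of_mem (mem_singleton_self g))
  obtain ⟨a, rfl⟩ := Sym2.mem_iff_exists.1 hvf
  obtain ⟨b, rfl⟩ := Sym2.mem_iff_exists.1 hvg
  refine ⟨a, b, fun h => hfg (h ▸ rfl), hfA, hgA, fun x hx => ?_⟩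
  have : s(v, x) ∈ A.filter (v ∈ ·) := mem_filter.2 ⟨hx, Sym2.mem_mk_left _ _⟩
  rwa [hf, mem_insert, mem_singleton, Sym2.congr_right, Sym2.congr_right] at this

theorem not_adj_of_card_eq_zero {v : V} (h : #(A.filter (v ∈ ·)) = 0) (x : V) : s(v, x) ∉ A :=
  fun hx => (filter_eq_empty_iff.1 (card_eq_zero.1 h)) hx (Sym2.mem_mk_left _ _)

theorem exists_realises_of_isolated (he : e = 1 ∨ e = -1) (hσ : IsPointReflection σ) {v : V}
    (ih : RealisableBelow σ #(insert v (insert (σ v) S)))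
    (hA : SymForest σ (insert v (insert (σ v) S)) A)
    (hB : SymForest σ (insert v (insert (σ v) S)) B) (hAB : Disjoint A B) (hv : v ∉ S)
    (hvf : σ v ≠ v) (hS : ∀ x ∈ S, σ x ∈ S) (hvA : ∀ x, s(v, x) ∉ A) :
    ∃ p, Realises e σ (insert v (insert (σ v) S)) A B p := by
  have hsub : S ⊆ insert v (insert (σ v) S) := (subset_insert _ _).trans (subset_insert _ _)
  obtain ⟨p, hp⟩ := ih e _ _ _ he (hA.restrict hsub hS) (hB.restrict hsub hS)
    (hAB.mono inter_subset_left inter_subset_left)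
    (card_lt_card (Finset.ssubset_iff_subset_ne.2 ⟨hsub, fun h => hv (h ▸ mem_insert_self _ _)⟩))
  obtain ⟨z, hz, h1, h2⟩ := exists_forall_vt (S.image p) (coords S p)
  obtain ⟨q, hq, -⟩ := hp.extend he hσ hA hB hv hvf hS (fun x _ h => absurd h (hvA x))
    (fun x hx _ => hz _ (mem_image_of_mem p hx)) h1 h2
  exact ⟨q, hq⟩

theorem exists_realises_step (he : e = 1 ∨ e = -1) (hσ : IsPointReflection σ)
    (ih : RealisableBelow σ #S) (hA : SymForest σ S A) (hB : SymForest σ S B)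
    (hAB : Disjoint A B) : ∃ p, Realises e σ S A B p := by
  by_cases hW : (S.filter fun x => σ x ≠ x).Nonempty
  swap
  · rw [not_nonempty_iff_eq_empty, filter_eq_empty_iff] at hW
    -- With only fixed vertices there is at most one vertex, hence no edge.
    have heq : ∀ x ∈ S, ∀ y ∈ S, x = y := fun x hx y hy =>
      hσ.fixed_unique x y (not_not.1 (hW hx)) (not_not.1 (hW hy))
    refine ⟨fun _ => 0, fun x hx y hy _ => heq x hx y hy, fun x _ => (mir_zero e).symm,
      fun x y h => ?_, fun x y h => ?_⟩
    · exact absurd (heq x (hA.mem_left h) y (hA.mem_right h)) (hA.ne h)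
    · exact absurd (heq x (hB.mem_left h) y (hB.mem_right h)) (hB.ne h)
  obtain ⟨v, hvS, hvf, hdeg⟩ := exists_degree_le_three hσ hA hB hW
  obtain ⟨S, rfl, hv, hv'⟩ : ∃ S', S = insert v (insert (σ v) S') ∧ v ∉ S' ∧ σ v ∉ S' :=
    ⟨(S.erase v).erase (σ v), by
      rw [insert_erase (mem_erase.2 ⟨hvf, hA.vertex_inv v hvS⟩), insert_erase hvS],
      by simp, by simp⟩
  have hS : ∀ x ∈ S, σ x ∈ S := by
    intro x hx
    have := hA.vertex_inv x (mem_insert_of_mem (mem_insert_of_mem hx))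
    rw [mem_insert, mem_insert] at this
    rcases this with h | h | h
    · exact absurd hx (by rwa [← h, hσ.invol] at hv')
    · exact absurd hx (by rwa [← hσ.injective h] at hv)
    · exact h
  have he' : -e = 1 ∨ -e = -1 := by
    rcases he with rfl | rfl <;> simp
  have hsub : S ⊆ insert v (insert (σ v) S) := (subset_insert _ _).trans (subset_insert _ _)
  have three : ∀ (e : ℝ) (A B : Finset (Sym2 V)), e = 1 ∨ e = -1 →
      SymForest σ (insert v (insert (σ v) S)) A → SymForest σ (insert v (insert (σ v) S)) B →
      Disjoint A B → #(A.filter (v ∈ ·)) = 1 → #(B.filter (v ∈ ·)) = 2 →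
      ∃ p, Realises e σ (insert v (insert (σ v) S)) A B p := by
    intro e A B he hA hB hAB h1 h2
    obtain ⟨a, ha, ha'⟩ := exists_nbr_of_card_eq_one h1
    obtain ⟨b, c, hbc, hb, hc, hbc'⟩ := exists_nbr_of_card_eq_two h2
    have h : IsThreeVertex σ S A B v a b c := ⟨hv, hvf, hS, ha, hb, hc, ha', hbc', hbc, hA, hB, hAB⟩
    by_cases hA : s(b, c) ∈ A
    · exact h.exists_realises_of_mem he hσ ih hA
    · exact h.exists_realises_of_notMem he hσ ih hA
  -- Exchanging the coordinates exchanges the forests and replaces `e` by `-e`. The induction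
  -- hypothesis covers both signs for this reason.
  have swap : (∃ p, Realises (-e) σ (insert v (insert (σ v) S)) B A p) →
      ∃ p, Realises e σ (insert v (insert (σ v) S)) A B p := by
    rintro ⟨p, hp⟩
    exact ⟨_, neg_neg e ▸ hp.swap⟩
  by_cases hA0 : #(A.filter (v ∈ ·)) = 0
  · exact exists_realises_of_isolated he hσ ih hA hB hAB hv hvf hS (not_adj_of_card_eq_zero hA0)
  by_cases hB0 : #(B.filter (v ∈ ·)) = 0
  · exact swap (exists_realises_of_isolated he' hσ ih hB hA hAB.symm hv hvf hS
      (not_adj_of_card_eq_zero hB0))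
  by_cases hA2 : #(A.filter (v ∈ ·)) = 2
  · exact swap (three _ _ _ he' hB hA hAB.symm (by omega) hA2)
  by_cases hB2 : #(B.filter (v ∈ ·)) = 2
  · exact three _ _ _ he hA hB hAB (by omega) hB2
  obtain ⟨a, ha, ha'⟩ := exists_nbr_of_card_eq_one (A := A) (v := v) (by omega)
  obtain ⟨b, hb, hb'⟩ := exists_nbr_of_card_eq_one (A := B) (v := v) (by omega)
  obtain ⟨p, hp⟩ := ih e _ _ _ he (hA.restrict hsub hS) (hB.restrict hsub hS)
    (hAB.mono inter_subset_left inter_subset_left)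
    (card_lt_card (Finset.ssubset_iff_subset_ne.2 ⟨hsub, fun h => hv (h ▸ mem_insert_self _ _)⟩))
  have hab : a ≠ b := by
    rintro rfl
    exact disjoint_left.1 hAB ha hb
  obtain ⟨z, hz, hz', -, -, h1, h2⟩ := exists_hz_vt_far (fun h => hab (hp.injOn a
    (hA.mem_of_adj hσ ha) b (hB.mem_of_adj hσ hb) h)) (coords S p) 0
  obtain ⟨q, hq, -⟩ := hp.extend he hσ hA hB hv hvf hS (fun x _ h => (ha' x h) ▸ hz)
    (fun x _ h => (hb' x h) ▸ hz') h1 h2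
  exact ⟨q, hq⟩

/-- Any two disjoint symmetric forests without fixed edges have a symmetric realisation. -/
theorem exists_realises (he : e = 1 ∨ e = -1) (hσ : IsPointReflection σ)
    (hA : SymForest σ S A) (hB : SymForest σ S B) (hAB : Disjoint A B) :
    ∃ p, Realises e σ S A B p := by
  suffices h : ∀ n, RealisableBelow σ n from h (#S + 1) e S A B he hA hB hAB (Nat.lt_succ_self _)
  intro n
  induction n with
  | zero => exact fun _ _ _ _ _ _ _ _ h => absurd h (Nat.not_lt_zero _)
  | succ n ih =>
    intro e S A B he hA hB hAB hS
    exact exists_realises_step he hσ (fun e S' A' B' he hA hB hAB h =>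
      ih e S' A' B' he hA hB hAB (h.trans_le (Nat.lt_succ_iff.1 hS))) hA hB hAB

end MaxNormPlane

/-! ### Rigidity of realisations in the maximum norm. -/

namespace MaxNormPlane
open Filter Topology TreeRealisation
variable {V : Type*} {d : ℕ} {G : SimpleGraph V} {p : V → Fin d → ℝ}

theorem norm_eq_abs_of_forall_le {x : Fin d → ℝ} {i : Fin d} (h : ∀ j, |x j| ≤ |x i|) :
    ‖x‖ = |x i| :=
  le_antisymm ((pi_norm_le_iff_of_nonneg (abs_nonneg _)).2 h) (norm_le_pi_norm x i)

theorem abs_lt_of_hasColour (hG : WellPositioned G p) {u v : V} (huv : G.Adj u v) {i j : Fin d}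
    (hi : HasColour (p u) (p v) i) (hj : j ≠ i) : |p u j - p v j| < |p u i - p v i| := by
  rw [← hi]
  refine lt_of_le_of_ne (norm_le_pi_norm (p u - p v) j) fun h => hj ?_
  exact (hG u v huv).unique h.symm hi

theorem sub_ne_zero_of_hasColour (hp : Function.Injective p) {u v : V} (huv : u ≠ v) {i : Fin d}
    (hi : HasColour (p u) (p v) i) : p u i - p v i ≠ 0 := by
  intro h
  rw [HasColour, h, abs_zero, norm_eq_zero, sub_eq_zero] at hi
  exact huv (hp hi)

theorem eventually_forall_abs_le {i : Fin d} {x : Fin d → ℝ} (hx : ∀ j, j ≠ i → |x j| < |x i|) :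
    ∀ᶠ y in 𝓝 x, ∀ j, |y j| ≤ |y i| := by
  refine eventually_all.2 fun j => ?_
  by_cases hj : j = i
  · exact Eventually.of_forall fun y => by rw [hj]
  · have : IsOpen {y : Fin d → ℝ | |y j| < |y i|} := isOpen_lt (by fun_prop) (by fun_prop)
    filter_upwards [this.mem_nhds (hx j hj)] with y hy using le_of_lt hy

/-- Strict dominance of coordinate `i` persists near `p`, so the norm is locally the absolute value
of a linear functional that does not vanish at `p`; `c` is its sign. -/
theorem exists_hasFDerivAt_norm_sub [Finite V] (hG : WellPositioned G p)
    (hp : Function.Injective p) {u v : V} (huv : G.Adj u v) {i : Fin d}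
    (hi : HasColour (p u) (p v) i) :
    ∃ c : ℝ, c ≠ 0 ∧ HasFDerivAt (fun x : V → Fin d → ℝ => ‖x u - x v‖)
      (c • ((ContinuousLinearMap.proj i : (Fin d → ℝ) →L[ℝ] ℝ).comp
        ((ContinuousLinearMap.proj u : (V → Fin d → ℝ) →L[ℝ] (Fin d → ℝ)) -
          ContinuousLinearMap.proj v))) p := by
  cases nonempty_fintype V
  set L : (V → Fin d → ℝ) →L[ℝ] ℝ := (ContinuousLinearMap.proj i : (Fin d → ℝ) →L[ℝ] ℝ).comp
    ((ContinuousLinearMap.proj u : (V → Fin d → ℝ) →L[ℝ] (Fin d → ℝ)) -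
      ContinuousLinearMap.proj v) with hL
  have h0 : L p ≠ 0 := sub_ne_zero_of_hasColour hp huv.ne hi
  refine ⟨(SignType.sign (L p) : ℝ), ?_, ?_⟩
  · rcases lt_or_gt_of_ne h0 with h | h
    · simp [sign_neg h]
    · simp [sign_pos h]
  · have h1 : HasFDerivAt (fun x => |L x|) ((SignType.sign (L p) : ℝ) • L) p :=
      L.hasFDerivAt.abs h0
    refine h1.congr_of_eventuallyEq ?_
    have h2 : Tendsto (fun x : V → Fin d → ℝ => x u - x v) (𝓝 p) (𝓝 (p u - p v)) :=
      Continuous.tendsto (by fun_prop) p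
    filter_upwards [h2.eventually (eventually_forall_abs_le (i := i)
      fun j hj => abs_lt_of_hasColour hG huv hi hj)] with x hx
    exact norm_eq_abs_of_forall_le hx

theorem exists_hasFDerivAt_rigidityMap [Finite V] (hG : WellPositioned G p)
    (hp : Function.Injective p) :
    ∃ L : (V → Fin d → ℝ) →L[ℝ] (G.edgeSet → ℝ), HasFDerivAt (rigidityMap G) L p ∧
      ∀ η, L η = 0 ↔ ∀ u v i, (monochrome G p i).Adj u v → η u i = η v i := by
  cases nonempty_fintype V
  have key : ∀ f : G.edgeSet, ∃ l : (V → Fin d → ℝ) →L[ℝ] ℝ,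
      HasFDerivAt (fun x => rigidityMap G x f) l p ∧ ∀ u v i, s(u, v) = f.1 →
        HasColour (p u) (p v) i → ∀ η, l η = 0 ↔ η u i = η v i := by
    rintro ⟨f, hf⟩
    induction f with
    | _ u v =>
      obtain ⟨i, hi, hiu⟩ := hG u v hf
      obtain ⟨c, hc, hL⟩ := exists_hasFDerivAt_norm_sub hG hp hf hi
      refine ⟨_, hL, fun u' v' j h hj η => ?_⟩
      have hz : ∀ η : V → Fin d → ℝ, (c • ((ContinuousLinearMap.proj i : (Fin d → ℝ) →L[ℝ] ℝ).comp
        ((ContinuousLinearMap.proj u : (V → Fin d → ℝ) →L[ℝ] (Fin d → ℝ)) -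
          ContinuousLinearMap.proj v))) η = c * (η u i - η v i) := fun η => rfl
      rw [hz, mul_eq_zero, or_iff_right hc, sub_eq_zero]
      rcases Sym2.eq_iff.1 h with ⟨rfl, rfl⟩ | ⟨rfl, rfl⟩
      · rw [hiu j hj]
      · rw [hiu j ((monochrome G p j).symm.symm _ _ ⟨hf.symm, hj⟩ : (monochrome G p j).Adj _ _).2,
          eq_comm]
  choose l hl hl' using key
  refine ⟨ContinuousLinearMap.pi l, hasFDerivAt_pi.2 hl, fun η => ?_⟩
  rw [funext_iff]
  constructor
  · intro h u v i huv
    exact (hl' ⟨s(u, v), huv.1⟩ u v i rfl huv.2 η).1 (h _)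
  · rintro h ⟨f, hf⟩
    induction f with
    | _ u v =>
      obtain ⟨i, hi, -⟩ := hG u v hf
      exact (hl' ⟨s(u, v), hf⟩ u v i rfl hi η).2 (h u v i ⟨hf, hi⟩)

theorem infinitesimallyRigid_iff [Finite V] (hG : WellPositioned G p)
    (hp : Function.Injective p) : InfinitesimallyRigid G p ↔ ∀ η : V → Fin d → ℝ,
      (∀ u v i, (monochrome G p i).Adj u v → η u i = η v i) → ∃ a, η = fun _ => a := by
  obtain ⟨L, hL, h⟩ := exists_hasFDerivAt_rigidityMap hG hp
  unfold InfinitesimallyRigid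
  rw [hL.fderiv]
  simp_rw [h]

theorem eq_of_preconnected {T : SimpleGraph V} (hT : T.Preconnected) {R : Type*} {f : V → R}
    (h : ∀ u v, T.Adj u v → f u = f v) (u v : V) : f u = f v := by
  obtain ⟨w⟩ := hT u v
  induction w with
  | nil => rfl
  | cons h' _ ih => exact (h _ _ h').trans ih

theorem infinitesimallyRigid_of_connected [Finite V] (hG : WellPositioned G p)
    (hp : Function.Injective p) (hc : ∀ i, (monochrome G p i).Preconnected) :
    InfinitesimallyRigid G p := by
  rw [infinitesimallyRigid_iff hG hp]
  intro η h
  cases isEmpty_or_nonempty V with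
  | inl hV => exact ⟨0, funext fun v => hV.elim v⟩
  | inr hV =>
    obtain ⟨v⟩ := hV
    refine ⟨η v, funext fun u => funext fun i => ?_⟩
    exact eq_of_preconnected (hc i) (f := fun u => η u i) (fun x y => h x y i) u v

/-- The times at which all differences agree with those of `p` form a nonempty clopen set in the
unit interval. For openness: near such a time the colour and the sign of each edge persist, so its
dominant coordinate difference is constant, and connectedness of each colour propagates this to all
pairs of vertices. -/
theorem locallyRigid_of_connected [Finite V] (hG : WellPositioned G p)
    (hp : Function.Injective p) (hc : ∀ i, (monochrome G p i).Connected) :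
    LocallyRigid G p := by
  intro α hα
  have hcont := hα.continuous
  have hclopen : IsClopen {t | ∀ u v, α t u - α t v = p u - p v} := by
    constructor
    · simp only [Set.ofPred_forall]
      refine isClosed_iInter fun u => isClosed_iInter fun v => ?_
      exact isClosed_eq ((hcont u).sub (hcont v)) continuous_const
    · rw [isOpen_iff_mem_nhds]
      intro t ht
      have hedge : ∀ u v i, ∀ᶠ t' in 𝓝 t, (monochrome G p i).Adj u v →
          α t' u i - α t' v i = p u i - p v i := by
        intro u v i
        by_cases huv : (monochrome G p i).Adj u v
        swap
        · exact Eventually.of_forall fun _ h => absurd h huv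
        have h1 : Tendsto (fun t' => α t' u - α t' v) (𝓝 t) (𝓝 (p u - p v)) := by
          rw [← ht u v]
          exact ((hcont u).sub (hcont v)).tendsto t
        have h0 : p u i - p v i ≠ 0 := sub_ne_zero_of_hasColour hp huv.1.ne huv.2
        have h2 : ∀ᶠ y : Fin d → ℝ in 𝓝 (p u - p v), 0 < y i * (p u i - p v i) := by
          have : IsOpen {y : Fin d → ℝ | 0 < y i * (p u i - p v i)} :=
            isOpen_lt (by fun_prop) (by fun_prop)
          exact this.mem_nhds (mul_self_pos.2 h0)
        filter_upwards [h1.eventually h2, h1.eventually (eventually_forall_abs_le (i := i)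
          fun j hj => abs_lt_of_hasColour hG huv.1 huv.2 hj)] with t' h3 h4 _
        have h5 := hα.length_eq t' u v huv.1
        rw [norm_eq_abs_of_forall_le h4, huv.2] at h5
        rcases abs_eq_abs.1 h5 with h | h
        · exact h
        · rw [h] at h3
          nlinarith [mul_self_nonneg (p u i - p v i)]
      filter_upwards [eventually_all.2 fun u => eventually_all.2 fun v => eventually_all.2 fun i =>
        hedge u v i] with t' h u v
      funext i
      have := eq_of_preconnected (hc i).preconnected (f := fun u => α t' u i - p u i)
        (fun x y hxy => by have := h x y i hxy; linarith) u v
      simp only [Pi.sub_apply]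
      linarith
  have huniv := hclopen.eq_univ ⟨0, fun u v => by rw [hα.start]⟩
  have hall : ∀ t u v, α t u - α t v = p u - p v := fun t => by
    have : t ∈ {t | ∀ u v, α t u - α t v = p u - p v} := huniv ▸ Set.mem_univ t
    exact this
  by_cases hd : Nonempty (Fin d)
  · obtain ⟨i⟩ := hd
    obtain ⟨v₀⟩ := (hc i).nonempty
    refine ⟨fun t x => x + (α t v₀ - p v₀), ⟨fun x => ?_, ?_, fun t => ?_⟩, fun t v => ?_⟩
    · exact continuous_const.add ((hcont v₀).sub continuous_const)
    · funext x
      simp [hα.start]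
    · exact isometry_add_right _
    · have := hall t v v₀
      rw [sub_eq_iff_eq_add] at this
      change _ = p v + (α t v₀ - p v₀)
      rw [this]
      abel
  · rw [not_nonempty_iff] at hd
    exact ⟨fun _ => id, ⟨fun _ => continuous_const, rfl, fun _ => isometry_id⟩,
      fun t v => Subsingleton.elim _ _⟩

/-- The indicator of one of the two parts of a forest without the edge `uv`. -/
theorem exists_indicator {T : SimpleGraph V} (hT : T.IsAcyclic) {u v : V} (huv : T.Adj u v) :
    ∃ f : V → ℝ, f u = 1 ∧ f v = 0 ∧ (∀ x, f x = 0 ∨ f x = 1) ∧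
      ∀ x y, T.Adj x y → s(x, y) ≠ s(u, v) → f x = f y := by
  classical
  have hb := SimpleGraph.isBridge_iff.1 (SimpleGraph.isAcyclic_iff_forall_adj_isBridge.1 hT huv)
  refine ⟨fun x => if (T.deleteEdges {s(u, v)}).Reachable u x then 1 else 0, by simp, if_neg hb,
    fun x => by by_cases h : (T.deleteEdges {s(u, v)}).Reachable u x <;> simp [h],
    fun x y hxy hne => ?_⟩
  have h : (T.deleteEdges {s(u, v)}).Adj x y := by
    rw [SimpleGraph.deleteEdges_adj]
    exact ⟨hxy, hne⟩
  have : (T.deleteEdges {s(u, v)}).Reachable u x ↔ (T.deleteEdges {s(u, v)}).Reachable u y :=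
    ⟨fun h' => h'.trans h.reachable, fun h' => h'.trans h.symm.reachable⟩
  simp only [this]

theorem WellPositioned.mono {H : SimpleGraph V} (h : H ≤ G) (hG : WellPositioned G p) :
    WellPositioned H p := fun u v huv => hG u v (h huv)

theorem not_infinitesimallyRigid_deleteEdges [Finite V] (hG : WellPositioned G p)
    (hp : Function.Injective p) {k : Fin d} (hT : (monochrome G p k).IsAcyclic) {u v : V}
    (huv : (monochrome G p k).Adj u v) :
    ¬ InfinitesimallyRigid (G.deleteEdges {s(u, v)}) p := by
  rw [infinitesimallyRigid_iff (WellPositioned.mono (G.deleteEdges_le _) hG) hp]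
  obtain ⟨f, hfu, hfv, -, hf⟩ := exists_indicator hT huv
  intro h
  obtain ⟨a, ha⟩ := h (fun x => Pi.single k (f x)) fun x y i hxy => by
    by_cases hi : i = k
    · subst hi
      have h1 := SimpleGraph.deleteEdges_adj.1 hxy.1
      rw [hf x y ⟨h1.1, hxy.2⟩ h1.2]
    · simp [hi]
  have h1 := congrFun (congrFun ha u) k
  have h2 := congrFun (congrFun ha v) k
  simp only [Pi.single_eq_same, hfu, hfv] at h1 h2
  exact one_ne_zero (h1.trans h2.symm)

/-- One part of the cut forest slides in direction `k`. The other edges of colour `k` keep both ends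
together, and the remaining colours have room for a small shift. The motion is not isometric because
the distance between `u` and `v` changes. -/
theorem not_locallyRigid_deleteEdges [Finite V] (hG : WellPositioned G p)
    (hp : Function.Injective p) {k : Fin d} (hT : (monochrome G p k).IsAcyclic) {u v : V}
    (huv : (monochrome G p k).Adj u v) : ¬ LocallyRigid (G.deleteEdges {s(u, v)}) p := by
  obtain ⟨f, hfu, hfv, hf01, hf⟩ := exists_indicator hT huv
  have hsmall : ∀ r : ℝ, 0 < r → ∀ᶠ δ in 𝓝[>] (0 : ℝ), δ < r := fun r hr =>
    nhdsWithin_le_nhds (Iio_mem_nhds hr)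
  have h0 := sub_ne_zero_of_hasColour hp huv.1.ne huv.2
  have h1 : ∀ᶠ δ in 𝓝[>] (0 : ℝ), ∀ x y i, i ≠ k → (monochrome G p i).Adj x y →
      |p x k - p y k| + δ < |p x i - p y i| := by
    refine eventually_all.2 fun x => eventually_all.2 fun y => eventually_all.2 fun i => ?_
    by_cases h : i ≠ k ∧ (monochrome G p i).Adj x y
    · have := abs_lt_of_hasColour hG h.2.1 h.2.2 h.1.symm
      filter_upwards [hsmall _ (sub_pos.2 this)] with δ hδ _ _
      linarith
    · exact Eventually.of_forall fun _ h1 h2 => absurd ⟨h1, h2⟩ h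
  -- The shift is below the slack of every edge of another colour, and below twice the
  -- `k`-difference of `u` and `v`, so that this difference cannot turn into its negative.
  obtain ⟨δ, h1, h2, h3⟩ := (h1.and ((hsmall _ (mul_pos two_pos (abs_pos.2 h0))).and
    self_mem_nhdsWithin)).exists
  intro hrigid
  have hdiff : ∀ (t : unitInterval) x y j, (p x + Pi.single k ((t : ℝ) * δ * f x) -
      (p y + Pi.single k ((t : ℝ) * δ * f y)) : Fin d → ℝ) j =
      p x j - p y j + if j = k then (t : ℝ) * δ * (f x - f y) else 0 := by
    intro t x y j
    by_cases hj : j = k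
    · subst hj
      simp
      ring
    · simp [hj]
  have hflex : IsFlex (G.deleteEdges {s(u, v)}) p
      fun t x => p x + Pi.single k ((t : ℝ) * δ * f x) := by
    refine ⟨fun x => ?_, ?_, ?_⟩
    · have h4 : Continuous fun t : unitInterval => (t : ℝ) * δ * f x := by fun_prop
      exact continuous_const.add ((continuous_single (A := fun _ : Fin d => ℝ) k).comp h4)
    · funext x
      simp
    · intro t x y hxy
      rw [SimpleGraph.deleteEdges_adj] at hxy
      obtain ⟨i, hi, -⟩ := hG x y hxy.1
      have hstrict : ∀ j, j ≠ i → |p x j - p y j| < |p x i - p y i| := fun j hj =>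
        abs_lt_of_hasColour hG hxy.1 hi hj
      rw [hi]
      by_cases hik : i = k
      · subst hik
        rw [hf x y ⟨hxy.1, hi⟩ hxy.2, add_sub_add_right_eq_sub, hi]
      · have hki := hdiff t x y i
        rw [if_neg hik, add_zero] at hki
        rw [← hki]
        refine norm_eq_abs_of_forall_le fun j => ?_
        rw [hki, hdiff]
        by_cases hj : j = k
        · subst hj
          rw [if_pos rfl]
          refine ((abs_add_le _ _).trans ?_).trans (h1 x y i hik ⟨hxy.1, hi⟩).le
          have h4 : |f x - f y| ≤ 1 := by
            rcases hf01 x with h | h <;> rcases hf01 y with h' | h' <;> rw [h, h'] <;> norm_num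
          have h5 : |(t : ℝ) * δ * (f x - f y)| ≤ δ := by
            rw [abs_mul, abs_mul, abs_of_nonneg t.2.1, abs_of_pos h3]
            have := t.2.2
            have h6 := t.2.1
            calc (t : ℝ) * δ * |f x - f y| ≤ 1 * δ * 1 := by gcongr
              _ = δ := by ring
          linarith
        · rw [if_neg hj, add_zero]
          by_cases hji : j = i
          · rw [hji]
          · exact (hstrict j hji).le
  obtain ⟨Γ, hΓ, h⟩ := hrigid _ hflex
  have h4 := (hΓ.isometry 1).dist_eq (p u) (p v)
  rw [← h, ← h, dist_eq_norm, dist_eq_norm, huv.2] at h4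
  have h5 := norm_le_pi_norm (p u + Pi.single k (((1 : unitInterval) : ℝ) * δ * f u) -
    (p v + Pi.single k (((1 : unitInterval) : ℝ) * δ * f v))) k
  have h6 : ∀ j, j ≠ k → |p u j - p v j| < |p u k - p v k| := fun j hj =>
    abs_lt_of_hasColour hG huv.1 huv.2 hj
  -- If the `k`-difference shrank, all coordinates would be strictly below the old length, and the
  -- distance would drop.
  have h7 : |p u k - p v k| ≤ |p u k - p v k + δ| := by
    by_contra! h7
    refine absurd h4 (ne_of_lt ((pi_norm_lt_iff (abs_pos.2 h0)).2 fun j => ?_))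
    rw [hdiff]
    by_cases hj : j = k
    · subst hj
      simpa [hfu, hfv] using h7
    · simpa [hj] using h6 j hj
  rw [h4, hdiff] at h5
  simp only [if_true, hfu, hfv, Set.Icc.coe_one, one_mul, sub_zero, mul_one,
    Real.norm_eq_abs] at h5
  rcases abs_eq_abs.1 (le_antisymm h5 h7) with h8 | h8
  · linarith
  · rw [show p u k - p v k = -(δ / 2) by linarith, abs_neg, abs_of_pos (by linarith)] at h2
    linarith

end MaxNormPlane

/-! ### Edge counts and fixed vertices in trees. -/

namespace MaxNormPlane
open Finset TreeRealisation
variable {V : Type*} {G H : SimpleGraph V}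

/-- A forest spans at most `#X - 1` edges on a nonempty finite set `X` of vertices. -/
theorem spanned_add_one_le_card [Fintype V] [DecidableEq V] [Fintype H.edgeSet]
    (hH : H.IsAcyclic) {X : Finset V} (hX : X.Nonempty) : spanned H.edgeFinset X + 1 ≤ #X := by
  classical
  have : Nonempty (X : Set V) := hX.to_subtype
  -- The induced forest is extended to a spanning tree of the complete graph on `X`, whose edge
  -- count is known.
  obtain ⟨F, hF, -, hFt⟩ :=
    (SimpleGraph.connected_top (V := (X : Set V))).exists_isTree_le_of_le_of_isAcyclic
      le_top (hH.induce (X : Set V))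
  have h1 := hFt.card_edgeFinset
  have h2 : Fintype.card (X : Set V) = #X := by simp
  rw [← h2, ← h1, spanned]
  refine Nat.add_le_add_right ?_ 1
  rw [← card_map (Function.Embedding.subtype (· ∈ (X : Set V))).sym2Map (s := F.edgeFinset)]
  refine card_le_card fun f hf => ?_
  obtain ⟨hf, hfX⟩ := mem_inter.1 hf
  induction f with | _ x y
  obtain ⟨hx, hy⟩ := mk_mem_sym2_iff.1 hfX
  rw [SimpleGraph.mem_edgeFinset, SimpleGraph.mem_edgeSet] at hf
  exact mem_map.2 ⟨s(⟨x, hx⟩, ⟨y, hy⟩), SimpleGraph.mem_edgeFinset.2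
    (hF (SimpleGraph.comap_adj.2 hf)), rfl⟩

/-- An automorphism of a tree that fixes no edge pointwise fixes at most one vertex. -/
theorem fixed_unique_of_isTree (hH : H.IsTree) {φ : H →g H} (hφ : Function.Injective φ)
    (hfix : ∀ x y, H.Adj x y → φ x = x → φ y ≠ y) {u v : V} (hu : φ u = u) (hv : φ v = v) :
    u = v := by
  by_contra huv
  obtain ⟨w, hw⟩ := (hH.connected.preconnected u v).exists_isPath
  have hw2 : ((w.map φ).copy hu hv).IsPath :=
    (SimpleGraph.Walk.isPath_copy _ _ _).2 (hw.map hφ)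
  -- Paths in a tree are unique, so the path between two fixed vertices is mapped to itself and its
  -- first edge is fixed pointwise.
  have h1 : (w.map φ).copy hu hv = w :=
    congrArg Subtype.val ((hH.isAcyclic.subsingleton_path u v).elim ⟨_, hw2⟩ ⟨w, hw⟩)
  have h2 : φ w.snd = w.snd := by
    have := congrArg SimpleGraph.Walk.snd h1
    simpa [SimpleGraph.Walk.snd] using this
  exact hfix u w.snd (w.adj_snd (SimpleGraph.Walk.not_nil_of_ne huv)) hu h2

end MaxNormPlane

/-! ### From tree decompositions to symmetric forests, and conclusion. -/

namespace MaxNormPlane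
open Finset TreeRealisation
variable {V : Type*} {G : SimpleGraph V} {T : Fin 2 → SimpleGraph V} {θ : Z2 →* (G ≃g G)}

theorem exists_monoidHom_eq {M : Type*} [Monoid M] {r : M} (hr : r * r = 1) :
    ∃ τ : Z2 →* M, τ s = r := by
  have hs : s ≠ 1 := by decide
  have hall : ∀ a : Z2, a = 1 ∨ a = s := by decide
  have hss : s * s = 1 := by decide
  let f : Z2 → M := fun a => if a = 1 then 1 else r
  refine ⟨⟨⟨f, by simp [f]⟩, fun a b => ?_⟩, by simp [f, hs]⟩
  rcases hall a with rfl | rfl <;> rcases hall b with rfl | rfl <;>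
    simp [f, hs, hss, hr]

/-- The reflection of the plane that changes the sign of the first coordinate. -/
def firstReflection : (Fin 2 → ℝ) →ₗ[ℝ] (Fin 2 → ℝ) where
  toFun x := Function.update x 0 (-x 0)
  map_add' x y := by
    funext i
    fin_cases i <;> simp [add_comm]
  map_smul' c x := by
    funext i
    fin_cases i <;> simp

theorem firstReflection_mul_self : firstReflection * firstReflection = 1 := by
  refine LinearMap.ext fun x => funext fun i => ?_
  fin_cases i <;> simp [firstReflection]

theorem exists_hom_firstReflection :
    ∃ τ : Z2 →* LinearMap.GeneralLinearGroup ℝ (Fin 2 → ℝ), ∀ x,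
      (τ s : (Fin 2 → ℝ) →ₗ[ℝ] (Fin 2 → ℝ)) x = Function.update x 0 (-x 0) := by
  obtain ⟨τ, hτ⟩ := exists_monoidHom_eq (M := LinearMap.GeneralLinearGroup ℝ (Fin 2 → ℝ))
    (r := ⟨firstReflection, firstReflection, firstReflection_mul_self, firstReflection_mul_self⟩)
    (Units.ext firstReflection_mul_self)
  exact ⟨τ, fun x => by rw [hτ]; rfl⟩

theorem adj_of_tree (hT : IsSymmetricTreeDecomposition G T θ) {i : Fin 2} {x y : V}
    (h : (T i).Adj x y) : G.Adj x y := by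
  rw [← hT.decomposition.union]
  exact le_iSup T i h

theorem tree_adj_apply (hT : IsSymmetricTreeDecomposition G T θ) {i : Fin 2} {x y : V}
    (h : (T i).Adj x y) :
    (T i).Adj (θ s x) (θ s y) := by
  rw [← hT.symmetric i]
  exact SimpleGraph.map_adj_apply.2 h

theorem apply_apply (x : V) : θ s (θ s x) = x := by
  have h : θ s * θ s = 1 := by
    rw [← map_mul, show s * s = 1 by decide, map_one]
  exact congrArg (fun g : G ≃g G => g x) h

theorem isPointReflection (hT : IsSymmetricTreeDecomposition G T θ) (hfix : NoFixedEdges G θ) :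
    IsPointReflection (θ s) where
  invol := apply_apply
  fixed_unique _ _ hu hv :=
    fixed_unique_of_isTree (hT.decomposition.isTree 0)
      (φ := ⟨θ s, fun h => tree_adj_apply hT h⟩) (θ s).injective
      (fun x y hxy hx hy => hfix s(x, y) (adj_of_tree hT hxy)
        (congrArg₂ (fun a b => s(a, b)) hx hy)) hu hv

theorem symForest [Fintype V] [DecidableEq V] (hT : IsSymmetricTreeDecomposition G T θ)
    (hfix : NoFixedEdges G θ) (i : Fin 2) [Fintype (T i).edgeSet] :
    SymForest (θ s) univ (T i).edgeFinset where
  vertex_inv x _ := mem_univ _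
  subset f _ := by simp
  edge_inv f hf := by
    induction f with | _ x y
    rw [SimpleGraph.mem_edgeFinset, SimpleGraph.mem_edgeSet] at hf
    exact SimpleGraph.mem_edgeFinset.2 (tree_adj_apply hT hf)
  not_fixed f hf := by
    induction f with | _ x y
    rw [SimpleGraph.mem_edgeFinset, SimpleGraph.mem_edgeSet] at hf
    exact hfix _ (adj_of_tree hT hf)
  sparse X _ hX := spanned_add_one_le_card (hT.decomposition.isTree i).isAcyclic hX

theorem hasColour_zero_iff {x y : Fin 2 → ℝ} :
    HasColour x y 0 ↔ |x 1 - y 1| ≤ |x 0 - y 0| := by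
  constructor
  · intro h
    rw [← h]
    exact norm_le_pi_norm (x - y) 1
  · intro h
    exact norm_eq_abs_of_forall_le (x := x - y) (Fin.forall_fin_two.2 ⟨le_rfl, h⟩)

theorem hasColour_one_iff {x y : Fin 2 → ℝ} :
    HasColour x y 1 ↔ |x 0 - y 0| ≤ |x 1 - y 1| := by
  constructor
  · intro h
    rw [← h]
    exact norm_le_pi_norm (x - y) 0
  · intro h
    exact norm_eq_abs_of_forall_le (x := x - y) (Fin.forall_fin_two.2 ⟨h, le_rfl⟩)

/-- If the edges of `T i` are longest in direction `i`, then `p` is a realisation. -/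
theorem isRealisation_of_forall_tree {p : V → Fin 2 → ℝ} (hT : IsTreeDecomposition G T)
    (hp : Function.Injective p)
    (h0 : ∀ x y, (T 0).Adj x y → |p x 1 - p y 1| < |p x 0 - p y 0|)
    (h1 : ∀ x y, (T 1).Adj x y → |p x 0 - p y 0| < |p x 1 - p y 1|) : IsRealisation G T p := by
  have hG : ∀ x y, G.Adj x y ↔ (T 0).Adj x y ∨ (T 1).Adj x y := fun x y => by
    rw [← hT.union, SimpleGraph.iSup_adj, Fin.exists_fin_two]
  refine ⟨hp, fun x y hxy => ?_, Fin.forall_fin_two.2 ⟨?_, ?_⟩⟩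
  · rcases (hG x y).1 hxy with h | h
    · refine ⟨0, hasColour_zero_iff.2 (h0 x y h).le, Fin.forall_fin_two.2 ⟨fun _ => rfl, ?_⟩⟩
      exact fun h2 => absurd (hasColour_one_iff.1 h2) (h0 x y h).not_ge
    · refine ⟨1, hasColour_one_iff.2 (h1 x y h).le, Fin.forall_fin_two.2 ⟨?_, fun _ => rfl⟩⟩
      exact fun h2 => absurd (hasColour_zero_iff.1 h2) (h1 x y h).not_ge
  · ext x y
    constructor
    · rintro ⟨hxy, hc⟩
      refine ((hG x y).1 hxy).resolve_right fun h => ?_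
      exact (hasColour_zero_iff.1 hc).not_gt (h1 x y h)
    · exact fun h => ⟨(hG x y).2 (Or.inl h), hasColour_zero_iff.2 (h0 x y h).le⟩
  · ext x y
    constructor
    · rintro ⟨hxy, hc⟩
      refine ((hG x y).1 hxy).resolve_left fun h => ?_
      exact (hasColour_one_iff.1 hc).not_gt (h0 x y h)
    · exact fun h => ⟨(hG x y).2 (Or.inr h), hasColour_one_iff.2 (h1 x y h).le⟩

theorem exists_isCsRealisation [Finite V] (hT : IsSymmetricTreeDecomposition G T θ)
    (hfix : NoFixedEdges G θ) :
    ∃ (p : V → Fin 2 → ℝ) (τ : Z2 →* LinearMap.GeneralLinearGroup ℝ (Fin 2 → ℝ)),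
      IsCsRealisation G T θ p τ := by
  classical
  have := Fintype.ofFinite V
  -- The value `-1` selects the reflection that changes the sign of the first coordinate, in
  -- accordance with `firstReflection`.
  obtain ⟨q, hq⟩ := exists_realises (e := -1) (Or.inr rfl) (isPointReflection hT hfix)
    (symForest hT hfix 0) (symForest hT hfix 1)
    (SimpleGraph.disjoint_edgeFinset.2 (hT.decomposition.disjoint 0 1 zero_ne_one))
  obtain ⟨τ, hτ⟩ := exists_hom_firstReflection
  have hp : Function.Injective fun v => ![(q v).1, (q v).2] := fun x y h =>
    hq.injOn x (mem_univ _) y (mem_univ _) (Prod.ext (congrFun h 0) (congrFun h 1))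
  refine ⟨fun v => ![(q v).1, (q v).2], τ, ⟨hp, fun v => ?_, 0, hτ⟩,
    isRealisation_of_forall_tree hT.decomposition hp (fun x y h => ?_) fun x y h => ?_⟩
  · rw [hτ, hq.equivariant v (mem_univ _)]
    funext i
    fin_cases i <;> simp [mir]
  · exact hq.hz x y (SimpleGraph.mem_edgeFinset.2 h)
  · exact hq.vt x y (SimpleGraph.mem_edgeFinset.2 h)

theorem minimallyRigid_of_isRealisation [Finite V] {p : V → Fin 2 → ℝ}
    (hT : IsTreeDecomposition G T) (hp : IsRealisation G T p) :
    MinimallyRigid G p ∧ MinimallyInfinitesimallyRigid G p := by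
  have htree : ∀ i, (monochrome G p i).IsTree := fun i => by
    rw [hp.monochrome_eq]
    exact hT.isTree i
  refine ⟨⟨locallyRigid_of_connected hp.wellPositioned hp.injective fun i => (htree i).connected,
    fun f hf => ?_⟩, infinitesimallyRigid_of_connected hp.wellPositioned hp.injective
    fun i => (htree i).connected.preconnected, fun f hf => ?_⟩
  all_goals
    induction f with | _ x y
    obtain ⟨i, hi, -⟩ := hp.wellPositioned x y hf
  · exact not_locallyRigid_deleteEdges hp.wellPositioned hp.injective (htree i).isAcyclic ⟨hf, hi⟩
  · exact not_infinitesimallyRigid_deleteEdges hp.wellPositioned hp.injective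
      (htree i).isAcyclic ⟨hf, hi⟩

end MaxNormPlane

theorem mainTheorem5 {V : Type*} [Finite V] (G : SimpleGraph V)
    (θ : TreeRealisation.Z2 →* (G ≃g G)) (T : Fin 2 → SimpleGraph V)
    (hT : TreeRealisation.IsSymmetricTreeDecomposition G T θ)
    (hfix : TreeRealisation.NoFixedEdges G θ) :
    ∃ (p : V → Fin 2 → ℝ)
      (τ : TreeRealisation.Z2 →* LinearMap.GeneralLinearGroup ℝ (Fin 2 → ℝ)),
      TreeRealisation.IsCsRealisation G T θ p τ ∧
      TreeRealisation.WellPositioned G p ∧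
      DifferentiableAt ℝ (TreeRealisation.rigidityMap G) p ∧
      TreeRealisation.MinimallyRigid G p ∧
      TreeRealisation.MinimallyInfinitesimallyRigid G p := by
  obtain ⟨p, τ, h⟩ := MaxNormPlane.exists_isCsRealisation hT hfix
  have hp := h.realisation
  obtain ⟨h1, h2⟩ := MaxNormPlane.minimallyRigid_of_isRealisation hT.decomposition hp
  obtain ⟨L, hL, -⟩ := MaxNormPlane.exists_hasFDerivAt_rigidityMap hp.wellPositioned hp.injective
  exact ⟨p, τ, h, hp.wellPositioned, hL.differentiableAt, h1, h2⟩
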